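/- Let $\mathbb T^2=\mathbb R^2/\mathbb Z^2$ be the flat torus and $V\in C^\infty(\mathbb T^2;\mathbb R)$. For $\hbar>0$ let $\varepsilon_\hbar>0$ and $\tau_\hbar$ be real numbers such that, as $\hbar\to0^+$, $$\varepsilon_\hbar\to0,\qquad \hbar\,\varepsilon_\hbar^{-1}\to0,\qquad \tau_\hbar\,\varepsilon_\hbar\to+\infty$$ (so in particular $\tau_\hbar\to+\infty$). *Geometry.* Let $\Omega_1$ be the set of $\xi\in\mathbb R^2\setminus\{0\}$ for which the geodesics $s\mapsto x+s\xi$ of $\mathbb T^2$ are periodic; the images of these are the closed geodesics. Put $\mathcal I(V)(x,\xi)=\lim_{T\to+\infty}\frac1T\int_0^TV(x+s\xi)\,ds$ and $$\mathcal C(V)=\{x_0\in\mathbb T^2:\ \exists\,\xi\in\Omega_1,\ \partial_x\mathcal I(V)(x_0,\xi)=0\}.$$ For a closed geodesic $\gamma$ let $\delta_\gamma$ be the normalized Lebesgue measure along $\gamma$, and let $\mathcal N(V)$ be the closed convex hull, for the weak topology of measures, of $\{\delta_\gamma:\ \gamma\subset\mathcal C(V)\text{ a closed geodesic}\}$. *Solutions.*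 Let $(u_\hbar)_{\hbar>0}$ be a family in $L^2(\mathbb T^2)$ with $\|u_\hbar\|_{L^2}=1$ and $$\lim_{R\to\infty}\limsup_{\hbar\to0^+}\|\mathbf 1_{[R,\infty)}(-\hbar^2\Delta)u_\hbar\|_{L^2}=0,\qquad \lim_{\delta\to0^+}\limsup_{\hbar\to0^+}\|\mathbf 1_{[0,\delta]}(-\hbar^2\Delta)u_\hbar\|_{L^2}=0,$$ and let $v_\hbar\in C(\mathbb R;L^2(\mathbb T^2))$ be the weak solution of $$i\hbar\,\partial_tv_\hbar=\Big(-\tfrac{\hbar^2}{2}\Delta+\varepsilon_\hbar^2V\Big)v_\hbar,\qquad v_\hbar|_{t=0}=u_\hbar .$$ Let $t\mapsto\nu(t)$ be an accumulation point of $|v_\hbar(t\tau_\hbar,x)|^2dx$ as $\hbar\to0^+$, that is, an essentially bounded, weakly measurable family of finite positive measures on $\mathbb T^2$ such that, for some sequence $\hbar_n\to0^+$ and for all $\theta\in L^1(\mathbb R)$ and $a\in C(\mathbb T^2)$, $$\int_{\mathbb R}\theta(t)\int_{\mathbb T^2}a(x)\,|v_{\hbar_n}(t\tau_{\hbar_n},x)|^2\,dx\,dt\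 \longrightarrow\ \int_{\mathbb R}\theta(t)\int_{\mathbb T^2}a(x)\,\nu(t,dx)\,dt .$$ *Theorem.* For a.e. $t\in\mathbb R$, one has $\nu(t)(\gamma)=0$ for every closed geodesic $\gamma$ that is not included in $\mathcal C(V)$. Moreover, for a.e. $t\in\mathbb R$, $$\nu(t)=f(t)\,dx+\alpha(t)\,\nu_{\mathrm{sing}}(t)$$ for some $f(t)\in L^1(\mathbb T^2)$ with $f(t)\ge0$, some $\alpha(t)\in[0,1]$ and some $\nu_{\mathrm{sing}}(t)\in\mathcal N(V)$. -/

import Mathlib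

open MeasureTheory Filter Topology
open scoped NNReal ENNReal ContDiff

noncomputable section

namespace TorusSchrodinger

/-- The plane `ℝ²` with its Euclidean structure. -/
abbrev Plane : Type := EuclideanSpace ℝ (Fin 2)

/-- The flat torus `𝕋² = ℝ²/ℤ²`, with its Lebesgue (probability) measure `volume`. -/
abbrev Torus : Type := UnitAddTorus (Fin 2)

/-- The Hilbert space `L²(𝕋²; ℂ)`. -/
abbrev L2Torus : Type := Lp ℂ 2 (volume : Measure Torus)

/-- The covering map `ℝ² → 𝕋²`. -/
def proj (y : Plane) : Torus := fun i => (y i : UnitAddCircle)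

/-- Smoothness of a function on `𝕋²`: its `ℤ²`-periodic lift to `ℝ²` is smooth. -/
def SmoothOnTorus {F : Type} [NormedAddCommGroup F] [NormedSpace ℝ F] (g : Torus → F) : Prop :=
  ContDiff ℝ ∞ (fun y : Plane => g (proj y))

/-- The Laplacian of a function on `𝕋²`, computed at `x` in the flat chart `h ↦ x + h`. -/
def torusLaplacian (g : Torus → ℂ) (x : Torus) : ℂ :=
  Laplacian.laplacian (fun h : Plane => g (x + proj h)) 0

/-! ### Geodesics, averages of the potential, and critical geodesics -/

/-- The geodesic `s ↦ x + s ξ` of `𝕋²`. -/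
def geodesic (x : Torus) (ξ : Plane) (s : ℝ) : Torus := x + proj (s • ξ)

/-- `T` is a (not necessarily minimal) period of the geodesics with velocity `ξ`. -/
def IsPeriod (ξ : Plane) (T : ℝ) : Prop := 0 < T ∧ proj (T • ξ) = 0

/-- `Ω₁`: the nonzero vectors that generate a periodic geodesic. -/
def periodicDirections : Set Plane := {ξ | ξ ≠ 0 ∧ ∃ T : ℝ, IsPeriod ξ T}

/-- `γ` is (the image of) a closed geodesic of `𝕋²`. -/
def IsClosedGeodesic (γ : Set Torus) : Prop :=
  ∃ x : Torus, ∃ ξ ∈ periodicDirections, γ = Set.range (geodesic x ξ)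

/-- The average `𝓘(V)(x, ξ) = lim_{T → ∞} (1/T) ∫₀ᵀ V(x + s ξ) ds`. -/
def geodesicAverage (V : Torus → ℝ) (x : Torus) (ξ : Plane) : ℝ :=
  limUnder atTop (fun T : ℝ => T⁻¹ * ∫ s in (0 : ℝ)..T, V (geodesic x ξ s))

/-- `𝓒(V)`: the points `x₀` with `∂ₓ 𝓘(V)(x₀, ξ) = 0` for some `ξ ∈ Ω₁`. -/
def criticalSet (V : Torus → ℝ) : Set Torus :=
  {x₀ | ∃ ξ ∈ periodicDirections,
    HasFDerivAt (fun h : Plane => geodesicAverage V (x₀ + proj h) ξ) (0 : Plane →L[ℝ] ℝ) 0}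

/-- `m` is `δ_γ`, the normalized Lebesgue measure along the closed geodesic `γ`: the image of the
normalized Lebesgue measure on a period interval under a constant speed parametrization. -/
def IsNormalizedLebesgueAlong (γ : Set Torus) (m : Measure Torus) : Prop :=
  ∃ x : Torus, ∃ ξ ∈ periodicDirections, ∃ T : ℝ, IsPeriod ξ T ∧
    γ = Set.range (geodesic x ξ) ∧
    m = ((ENNReal.ofReal T)⁻¹ • (volume.restrict (Set.Ioc 0 T))).map (geodesic x ξ)

/-- `𝓝(V)`: the closed convex hull, for the weak topology of measures, of the measures `δ_γ` where
`γ ⊆ 𝓒(V)` is a closed geodesic. -/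
def criticalMeasures (V : Torus → ℝ) : Set (FiniteMeasure Torus) :=
  closure (convexHull ℝ≥0 {m : FiniteMeasure Torus |
    ∃ γ : Set Torus, γ ⊆ criticalSet V ∧ IsNormalizedLebesgueAlong γ (m : Measure Torus)})

/-! ### The semiclassical Schrödinger equation -/

/-- The operator `-(ħ²/2) Δ + ε² V` acting on smooth functions. -/
def schrodingerOp (ħ ε : ℝ) (V : Torus → ℝ) (φ : Torus → ℂ) (x : Torus) : ℂ :=
  -((ħ : ℂ) ^ 2 / 2) * torusLaplacian φ x + (ε : ℂ) ^ 2 * (V x : ℂ) * φ x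

/-- `v ∈ C(ℝ; L²(𝕋²))` is the (weak) solution of `i ħ ∂ₜ v = (-(ħ²/2) Δ + ε² V) v` with `v(0) = u`:
the equation is tested against all smooth functions on `𝕋²`; the operator is its own transpose. -/
structure IsSchrodingerSolution (ħ ε : ℝ) (V : Torus → ℝ) (u : L2Torus) (v : ℝ → L2Torus) :
    Prop where
  continuous : Continuous v
  initial : v 0 = u
  equation : ∀ φ : Torus → ℂ, SmoothOnTorus φ → ∀ t : ℝ,
    HasDerivAt (fun s : ℝ => Complex.I * (ħ : ℂ) * ∫ x : Torus, φ x * v s x)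
      (∫ x : Torus, schrodingerOp ħ ε V φ x * v t x) t

/-- The Fourier coefficient `∫ exp(-2 i π k·x) u(x) dx`. -/
def fourierCoefficient (u : L2Torus) (k : Fin 2 → ℤ) : ℂ :=
  ∫ x : Torus, UnitAddTorus.mFourier (-k) x * u x

/-- The norm `‖𝟏_S(-ħ²Δ) u‖_{L²}`. The spectral projector keeps the Fourier modes
`exp(2 i π k·x)` whose eigenvalue `4 π² ħ² |k|²` lies in `S`. -/
def spectralNorm (S : Set ℝ) (ħ : ℝ) (u : L2Torus) : ℝ :=
  Real.sqrt (∑' k : Fin 2 → ℤ,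
    S.indicator (fun _ => ‖fourierCoefficient u k‖ ^ 2)
      (4 * Real.pi ^ 2 * ħ ^ 2 * ∑ i, (k i : ℝ) ^ 2))

/-- A family of normalized initial data oscillating exactly at the frequency `1/ħ`. -/
structure IsAdmissibleData (u : ℝ → L2Torus) : Prop where
  norm_eq_one : ∀ ħ : ℝ, 0 < ħ → ‖u ħ‖ = 1
  high : Tendsto (fun R : ℝ => limsup (fun ħ : ℝ => spectralNorm (Set.Ici R) ħ (u ħ)) (𝓝[>] 0))
    atTop (𝓝 0)
  low : Tendsto (fun δ : ℝ => limsup (fun ħ : ℝ => spectralNorm (Set.Icc 0 δ) ħ (u ħ)) (𝓝[>] 0))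
    (𝓝[>] 0) (𝓝 0)

/-- `ν` is an accumulation point, as `ħ → 0⁺`, of the time-dependent probability measures
`|v_ħ(t τ_ħ, x)|² dx`: `ν` is an essentially bounded, weakly measurable family of finite measures
and, along some sequence `ħₙ → 0⁺`, there is convergence against all `θ(t) a(x)`
with `θ ∈ L¹(ℝ)` and `a ∈ C(𝕋²)`. -/
structure IsAccumulationPoint (τ : ℝ → ℝ) (v : ℝ → ℝ → L2Torus) (ν : ℝ → FiniteMeasure Torus) :
    Prop where
  measurable : ∀ a : C(Torus, ℝ),
    AEStronglyMeasurable (fun t : ℝ => ∫ x, a x ∂(ν t : Measure Torus)) volume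
  bounded : ∃ C : ℝ≥0, ∀ᵐ t : ℝ, (ν t).mass ≤ C
  limit : ∃ h : ℕ → ℝ, Tendsto h atTop (𝓝[>] 0) ∧
    ∀ θ : ℝ → ℝ, Integrable θ → ∀ a : C(Torus, ℝ),
      Tendsto (fun n : ℕ => ∫ t : ℝ, θ t * ∫ x : Torus, a x * ‖v (h n) (t * τ (h n)) x‖ ^ 2) atTop
        (𝓝 (∫ t : ℝ, θ t * ∫ x, a x ∂(ν t : Measure Torus)))

/-- `𝓝(τ, ε)`: the accumulation points of `|v_ħ(t τ_ħ, x)|² dx`, where `v_ħ` solves the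
Schrödinger equation with perturbation of size `ε_ħ²` and the initial data vary among the
admissible families. -/
def accumulationPoints (V : Torus → ℝ) (τ ε : ℝ → ℝ) : Set (ℝ → FiniteMeasure Torus) :=
  {ν | ∃ (u : ℝ → L2Torus) (v : ℝ → ℝ → L2Torus), IsAdmissibleData u ∧
    (∀ ħ : ℝ, 0 < ħ → IsSchrodingerSolution ħ (ε ħ) V (u ħ) (v ħ)) ∧
    IsAccumulationPoint τ v ν}

end TorusSchrodinger

end

open MeasureTheory Filter Topology
open scoped NNReal ENNReal ContDiff ComplexConjugate

noncomputable section

namespace TorusSchrodinger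

/-! Everything happens on the Fourier side. For a solution with coefficients `c j`, the Fourier
coefficient of index m of |v|² is ∑ⱼ cⱼ conj c_{j-m}, and the weighted sums `form b m` are the
matrix elements of the operators with symbol b(ξ) exp(-2iπ m·x). Averaged over a time window of
length ℓ, the commutator of such an operator with the Hamiltonian is O(ħ/ℓ)
(`norm_formAverage_commutator_le`), and the theorem is read off from this for well chosen symbols.

Every nonzero frequency is a multiple p • k of a unique k in `directions`, and the coefficients at
the p • k describe the image of ν under x ↦ k·x. The relevant variable is the momentum ζ = ħ k·j /
ε: for a symbol f(ζ), the kinetic commutator and the potential commutator both have size ħε, and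
both dominate the error ħ/ℓ because ℓε → ∞. Potential modes not collinear to k disappear
(`tendsto_transverse`): away from zero energy, a momentum nearly orthogonal to k has a large
component along any transverse m, and the fast motion averages these modes out. That the energy
stays away from zero at all times is `IsFourierSolution.low_energy_le`.

In the limit there is a positive measure μ on circle × [0, 1], the second variable s being the
compactification of ζ² (`exists_phase_measure`). With W the derivative, up to 2πi, of the potential
averaged along the geodesics orthogonal to k, it satisfies p ∫ e_{-p} ζf dμ + C ∫ e_{-p} W f' dμ = 0
for f = ζ/(r + ζ²) (`transport_equation`). Letting r vary isolates three parts of μ. As r → 0, the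
part over ζ = 0 is carried by {W = 0}. As r → ∞, the part over ζ = ∞ is equidistributed and has no
nonzero Fourier mode. For r = 1, the part over ζ ≠ 0 has an absolutely continuous projection, since
s μ has Fourier coefficients O(1/p). So the modes p • k, p ≠ 0, of ν are those of σ_k + ρ_k, with
σ_k critical and ρ_k absolutely continuous.

The regions of bounded ζ attached to different directions are asymptotically disjoint
(`eventually_sum_le`), so the total mass of all σ_k and ρ_k is at most 1. Comparing Fourier
coefficients, ν is the sum of the lifts of σ_k + ρ_k to the torus and of a multiple of dx
(`eq_sum_lift_add`). The lifts of the ρ_k are absolutely continuous; those of the σ_k are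
superpositions of measures δ_γ with γ critical, hence lie, once normalized, in the closed convex
hull (`sum_lift_mem_closure_convexHull`). Only σ_k can charge a level set of k·x, and closed
geodesics lie in such level sets, which gives the first claim.

All this concerns one measure and one sequence of windows. At a time t₀ that is a Lebesgue point of
every Fourier coefficient of ν(t), windows [t₀τ, (t₀ + η)τ] with η → 0 slowly enough that ητε → ∞
produce such a sequence (`exists_regime`). -/

/-! ### Sequences of Fourier coefficients -/

/-- Frequencies of functions on `𝕋²`. -/
abbrev Freq : Type := Fin 2 → ℤ

/-- The Hilbert space `ℓ²(ℤ²)`. -/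
abbrev SeqL2 : Type := lp (fun _ : Freq => ℂ) 2

theorem holderConjugate_two : (2 : ℝ≥0∞).toReal.HolderConjugate (2 : ℝ≥0∞).toReal := by
  rw [Real.holderConjugate_iff]; norm_num

theorem summable_norm_sq (c : SeqL2) : Summable fun j => ‖c j‖ ^ 2 := by
  have := (lp.hasSum_norm (p := 2) (by norm_num) c).summable
  simpa using this

theorem tsum_norm_sq (c : SeqL2) : ∑' j, ‖c j‖ ^ 2 = ‖c‖ ^ 2 := by
  have := (lp.hasSum_norm (p := 2) (by norm_num) c).tsum_eq
  simpa using this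

theorem norm_coord_le (c : SeqL2) (j : Freq) : ‖c j‖ ≤ ‖c‖ :=
  lp.norm_apply_le_norm (by norm_num) c j

/-- The element of `ℓ²` with given square summable coordinates. -/
def ofSummable (f : Freq → ℂ) (h : Summable fun j => ‖f j‖ ^ 2) : SeqL2 :=
  ⟨f, memℓp_gen (by simpa using h)⟩

@[simp] theorem ofSummable_apply (f : Freq → ℂ) (h : Summable fun j => ‖f j‖ ^ 2) (j : Freq) :
    ofSummable f h j = f j := rfl

theorem summable_shift (c : SeqL2) (m : Freq) : Summable fun j => ‖c (j - m)‖ ^ 2 :=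
  (Equiv.subRight m).summable_iff.mpr (summable_norm_sq c)

/-- Translation of the frequencies by `m`, that is multiplication by the character `e_m`. -/
def shift (m : Freq) : SeqL2 →ₗᵢ[ℂ] SeqL2 where
  toFun c := ofSummable (fun j => c (j - m)) (summable_shift c m)
  map_add' c d := by ext j; simp
  map_smul' a c := by ext j; simp
  norm_map' c := by
    have h : ‖ofSummable (fun j => c (j - m)) (summable_shift c m)‖ ^ 2 = ‖c‖ ^ 2 := by
      rw [← tsum_norm_sq, ← tsum_norm_sq]
      exact (Equiv.subRight m).tsum_eq (fun j => ‖c j‖ ^ 2)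
    exact (pow_left_inj₀ (norm_nonneg _) (norm_nonneg _) two_ne_zero).mp h

@[simp] theorem shift_apply (m : Freq) (c : SeqL2) (j : Freq) : shift m c j = c (j - m) := rfl

/-- Multiplication by the function with Fourier coefficients `w`. -/
def convOp (w : Freq → ℂ) : SeqL2 →L[ℂ] SeqL2 := ∑' l, w l • (shift l).toContinuousLinearMap

theorem summable_smul_shift {w : Freq → ℂ} (hw : Summable fun l => ‖w l‖) :
    Summable fun l => w l • (shift l).toContinuousLinearMap := by
  refine Summable.of_norm_bounded hw fun l => ?_
  rw [norm_smul]
  exact mul_le_of_le_one_right (norm_nonneg _) (shift l).norm_toContinuousLinearMap_le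

theorem hasSum_convOp {w : Freq → ℂ} (hw : Summable fun l => ‖w l‖) (c : SeqL2) :
    HasSum (fun l => w l • shift l c) (convOp w c) := by
  have h := (summable_smul_shift hw).hasSum.mapL (ContinuousLinearMap.apply ℂ SeqL2 c)
  exact h

theorem norm_convOp_le {w : Freq → ℂ} (hw : Summable fun l => ‖w l‖) (c : SeqL2) :
    ‖convOp w c‖ ≤ (∑' l, ‖w l‖) * ‖c‖ := by
  rw [← (hasSum_convOp hw c).tsum_eq, ← tsum_mul_right]
  refine tsum_of_norm_bounded (hw.mul_right _).hasSum fun l => ?_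
  rw [norm_smul, LinearIsometry.norm_map]

theorem hasSum_convOp_apply {w : Freq → ℂ} (hw : Summable fun l => ‖w l‖) (c : SeqL2) (j : Freq) :
    HasSum (fun l => w l * c (j - l)) (convOp w c j) :=
  (lp.evalCLM ℂ (fun _ : Freq => ℂ) 2 j).hasSum (hasSum_convOp hw c)

/-! ### Sesquilinear forms of pseudodifferential type -/

/-- The form `∑ⱼ bⱼ cⱼ conj d_{j-m}`. -/
def form (b : Freq → ℂ) (m : Freq) (c d : SeqL2) : ℂ := ∑' j, b j * (c j * conj (d (j - m)))

theorem summable_norm_mul_shift (m : Freq) (c d : SeqL2) :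
    Summable fun j => ‖c j‖ * ‖d (j - m)‖ :=
  lp.summable_mul holderConjugate_two c (shift m d)

theorem tsum_norm_mul_shift_le (m : Freq) (c d : SeqL2) :
    ∑' j, ‖c j‖ * ‖d (j - m)‖ ≤ ‖c‖ * ‖d‖ := by
  have := (lp.tsum_mul_le_mul_norm holderConjugate_two c (shift m d)).2
  rwa [LinearIsometry.norm_map] at this

theorem norm_form_term_le {b : Freq → ℂ} {B : ℝ} (hb : ∀ j, ‖b j‖ ≤ B) (m : Freq) (c d : SeqL2)
    (j : Freq) : ‖b j * (c j * conj (d (j - m)))‖ ≤ B * (‖c j‖ * ‖d (j - m)‖) := by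
  rw [norm_mul, norm_mul, RCLike.norm_conj]
  exact mul_le_mul_of_nonneg_right (hb j) (by positivity)

theorem summable_form {b : Freq → ℂ} {B : ℝ} (hb : ∀ j, ‖b j‖ ≤ B) (m : Freq) (c d : SeqL2) :
    Summable fun j => b j * (c j * conj (d (j - m))) :=
  Summable.of_norm_bounded ((summable_norm_mul_shift m c d).mul_left B)
    (norm_form_term_le hb m c d)

theorem norm_form_le {b : Freq → ℂ} {B : ℝ} (hb : ∀ j, ‖b j‖ ≤ B) (m : Freq) (c d : SeqL2) :
    ‖form b m c d‖ ≤ B * (‖c‖ * ‖d‖) := by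
  have hB : 0 ≤ B := (norm_nonneg _).trans (hb 0)
  refine (tsum_of_norm_bounded ((summable_norm_mul_shift m c d).mul_left B).hasSum
    (norm_form_term_le hb m c d)).trans ?_
  rw [tsum_mul_left]
  exact mul_le_mul_of_nonneg_left (tsum_norm_mul_shift_le m c d) hB

/-- The form as a bounded bilinear map in the second argument conjugated. -/
theorem form_sub_sub {b : Freq → ℂ} {B : ℝ} (hb : ∀ j, ‖b j‖ ≤ B) (m : Freq)
    (c d c' d' : SeqL2) :
    form b m c d - form b m c' d' = form b m (c - c') d + form b m c' (d - d') := by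
  simp only [form]
  rw [← (summable_form hb m c d).tsum_sub (summable_form hb m c' d'),
    ← (summable_form hb m (c - c') d).tsum_add (summable_form hb m c' (d - d'))]
  refine tsum_congr fun j => ?_
  simp only [lp.coeFn_sub, Pi.sub_apply, map_sub]
  ring

theorem continuous_form {X : Type*} [TopologicalSpace X] {b : Freq → ℂ} {B : ℝ}
    (hb : ∀ j, ‖b j‖ ≤ B) (m : Freq) {c d : X → SeqL2} (hc : Continuous c) (hd : Continuous d) :
    Continuous fun t => form b m (c t) (d t) := by
  rw [continuous_iff_continuousAt]
  intro t
  refine tendsto_iff_norm_sub_tendsto_zero.mpr ?_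
  have hlim : Tendsto (fun s => B * (‖c s - c t‖ * ‖d s‖) + B * (‖c t‖ * ‖d s - d t‖)) (𝓝 t)
      (𝓝 (B * (‖c t - c t‖ * ‖d t‖) + B * (‖c t‖ * ‖d t - d t‖))) := by
    have : Continuous fun s => B * (‖c s - c t‖ * ‖d s‖) + B * (‖c t‖ * ‖d s - d t‖) := by
      fun_prop
    exact this.tendsto t
  simp only [sub_self, norm_zero, zero_mul, mul_zero, add_zero] at hlim
  refine squeeze_zero (fun _ => norm_nonneg _) (fun s => ?_) hlim
  rw [form_sub_sub hb]
  exact (norm_add_le _ _).trans (add_le_add (norm_form_le hb _ _ _) (norm_form_le hb _ _ _))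

theorem form_symbol_add {b b' : Freq → ℂ} {B B' : ℝ} (hb : ∀ j, ‖b j‖ ≤ B)
    (hb' : ∀ j, ‖b' j‖ ≤ B') (m : Freq) (c d : SeqL2) :
    form (fun j => b j + b' j) m c d = form b m c d + form b' m c d := by
  simp only [form]
  rw [← (summable_form hb m c d).tsum_add (summable_form hb' m c d)]
  exact tsum_congr fun j => by ring

theorem form_symbol_sub {b b' : Freq → ℂ} {B B' : ℝ} (hb : ∀ j, ‖b j‖ ≤ B)
    (hb' : ∀ j, ‖b' j‖ ≤ B') (m : Freq) (c d : SeqL2) :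
    form (fun j => b j - b' j) m c d = form b m c d - form b' m c d := by
  simp only [form]
  rw [← (summable_form hb m c d).tsum_sub (summable_form hb' m c d)]
  exact tsum_congr fun j => by ring

theorem form_symbol_smul (a : ℂ) (b : Freq → ℂ) (m : Freq) (c d : SeqL2) :
    form (fun j => a * b j) m c d = a * form b m c d := by
  simp only [form]
  rw [← tsum_mul_left]
  exact tsum_congr fun j => by ring

/-- Reindexing moves a multiplication by a character into the symbol when it acts on the left, and
only into the shift when it acts on the right. The commutator with a potential therefore involves
only the differences b(j + l) - b(j). -/
theorem form_shift_left (b : Freq → ℂ) (m l : Freq) (c d : SeqL2) :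
    form b m (shift l c) d = form (fun j => b (j + l)) (m - l) c d := by
  simp only [form]
  rw [← (Equiv.addRight l).tsum_eq]
  refine tsum_congr fun j => ?_
  simp only [Equiv.coe_addRight, shift_apply]
  rw [add_sub_cancel_right, sub_sub_eq_add_sub]

theorem form_shift_right (b : Freq → ℂ) (m l : Freq) (c d : SeqL2) :
    form b m c (shift l d) = form b (m + l) c d := by
  simp only [form, shift_apply]
  exact tsum_congr fun j => by rw [sub_sub]

theorem form_hasSum_left {b : Freq → ℂ} {B : ℝ} (hb : ∀ j, ‖b j‖ ≤ B) (m : Freq) (d : SeqL2)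
    {ι : Type*} {x : ι → SeqL2} {s : SeqL2} (h : HasSum x s) :
    HasSum (fun i => form b m (x i) d) (form b m s d) := by
  let L : SeqL2 →ₗ[ℂ] ℂ :=
    { toFun := fun c => form b m c d
      map_add' := fun c c' => by
        have := form_sub_sub hb m (c + c') d c' d
        have h0 : form b m c' 0 = 0 := by simp [form]
        rw [sub_self, h0, add_sub_cancel_right, add_zero] at this
        rw [← this]; ring
      map_smul' := fun a c => by
        simp only [form, RingHom.id_apply, smul_eq_mul]
        rw [← tsum_mul_left]
        refine tsum_congr fun j => ?_
        simp only [lp.coeFn_smul, Pi.smul_apply, smul_eq_mul]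
        ring }
  exact (L.mkContinuous (B * ‖d‖) fun c => by
    have := norm_form_le hb m c d
    calc ‖L c‖ ≤ B * (‖c‖ * ‖d‖) := this
      _ = B * ‖d‖ * ‖c‖ := by ring).hasSum h

theorem form_hasSum_right {b : Freq → ℂ} {B : ℝ} (hb : ∀ j, ‖b j‖ ≤ B) (m : Freq) (c : SeqL2)
    {ι : Type*} {x : ι → SeqL2} {s : SeqL2} (h : HasSum x s) :
    HasSum (fun i => form b m c (x i)) (form b m c s) := by
  have hb' : ∀ j, ‖conj (b (j + m))‖ ≤ B := fun j => by rw [RCLike.norm_conj]; exact hb _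
  -- The form is antilinear in `d`; conjugating and reindexing by j ↦ j + m exchanges the two
  -- arguments and reduces to the linear case, with shift -m.
  have key : ∀ d : SeqL2, form b m c d = conj (form (fun j => conj (b (j + m))) (-m) d c) := by
    intro d
    simp only [form]
    rw [Complex.conj_tsum, ← (Equiv.addRight m).tsum_eq]
    refine tsum_congr fun j => ?_
    simp only [Equiv.coe_addRight, map_mul, Complex.conj_conj, sub_neg_eq_add,
      add_sub_cancel_right]
    ring
  simp only [key]
  exact (Complex.hasSum_conj' ).mpr (form_hasSum_left hb' (-m) c h)

/-- A form whose symbol is small outside a set carrying little mass is small. -/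
theorem norm_form_le_of_concentrated {b : Freq → ℂ} {B κ η : ℝ} {A : Set Freq}
    (hb : ∀ j, ‖b j‖ ≤ B) (hκ : ∀ j ∉ A, ‖b j‖ ≤ κ) (hκ0 : 0 ≤ κ) (hη : 0 ≤ η) (m : Freq)
    (c d : SeqL2) (hc : ∑' j, A.indicator (fun j => ‖c j‖ ^ 2) j ≤ η ^ 2) :
    ‖form b m c d‖ ≤ κ * (‖c‖ * ‖d‖) + B * (η * ‖d‖) := by
  classical
  have hB : 0 ≤ B := (norm_nonneg _).trans (hb 0)
  have hsum : Summable fun j => ‖A.indicator (fun j => c j) j‖ ^ 2 := by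
    refine Summable.of_nonneg_of_le (fun _ => by positivity) (fun j => ?_) (summable_norm_sq c)
    gcongr
    exact norm_indicator_le_norm_self _ _
  set cA : SeqL2 := ofSummable _ hsum with hcA
  have hcAn : ‖cA‖ ≤ η := by
    refine le_of_sq_le_sq ?_ hη
    rw [← tsum_norm_sq]
    refine le_trans (le_of_eq (tsum_congr fun j => ?_)) hc
    by_cases hj : j ∈ A <;> simp [hcA, hj]
  have hb1 : ∀ j, ‖Aᶜ.indicator b j‖ ≤ κ := fun j => by
    by_cases hj : j ∈ A
    · simp [hj, hκ0]
    · simpa [hj] using hκ j hj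
  have hb2 : ∀ j, ‖A.indicator b j‖ ≤ B := fun j =>
    (norm_indicator_le_norm_self _ _).trans (hb j)
  -- Off `A` the symbol is small; on `A` the symbol is only bounded, but the truncation of `c` is
  -- small.
  have hsplit : form b m c d = form (Aᶜ.indicator b) m c d + form b m cA d := by
    simp only [form]
    rw [← (summable_form hb1 m c d).tsum_add (summable_form hb m cA d)]
    refine tsum_congr fun j => ?_
    by_cases hj : j ∈ A <;> simp [hcA, hj]
  rw [hsplit]
  refine (norm_add_le _ _).trans (add_le_add (norm_form_le hb1 _ _ _) ?_)
  refine (norm_form_le hb _ _ _).trans ?_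
  gcongr

/-! ### The Schrödinger equation on the Fourier side -/

/-- The eigenvalue of `-(ħ²/2)Δ` on the character `e_j`. -/
def energy (ħ : ℝ) (j : Freq) : ℝ := 2 * Real.pi ^ 2 * ħ ^ 2 * ∑ i, (j i : ℝ) ^ 2

theorem energy_nonneg (ħ : ℝ) (j : Freq) : 0 ≤ energy ħ j := by
  unfold energy; positivity

/-- `ℓ²`-valued solutions of the Schrödinger equation, coordinate by coordinate. -/
structure IsFourierSolution (ħ ε : ℝ) (w : Freq → ℂ) (c : ℝ → SeqL2) : Prop where
  continuous : Continuous c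
  deriv : ∀ (j : Freq) (t : ℝ), HasDerivAt (fun s => c s j)
    (-(Complex.I / ħ) * ((energy ħ j : ℂ) * c t j + (ε : ℂ) ^ 2 * convOp w (c t) j)) t

/-- Fourier coefficients of real potentials. -/
structure IsRealSummable (w : Freq → ℂ) : Prop where
  summable : Summable fun l => ‖w l‖
  conj_eq : ∀ l, conj (w l) = w (-l)

theorem continuous_coord {c : ℝ → SeqL2} (hc : Continuous c) (j : Freq) :
    Continuous fun t => c t j :=
  (lp.evalCLM ℂ (fun _ : Freq => ℂ) 2 j).continuous.comp hc

/-- The commutator of a form with the potential. -/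
theorem hasSum_form_commutator {w : Freq → ℂ} (hw : IsRealSummable w) {b : Freq → ℂ} {B : ℝ}
    (hb : ∀ j, ‖b j‖ ≤ B) (m : Freq) (c : SeqL2) :
    HasSum (fun l => w l * form (fun j => b (j + l) - b j) (m - l) c c)
      (form b m (convOp w c) c - form b m c (convOp w c)) := by
  have h1 := form_hasSum_left hb m c (hasSum_convOp hw.summable c)
  have h2 := form_hasSum_right hb m c (hasSum_convOp hw.summable c)
  have h1' : HasSum (fun l => w l * form (fun j => b (j + l)) (m - l) c c)
      (form b m (convOp w c) c) := by
    refine h1.congr_fun ?_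
    intro l
    rw [← form_shift_left]
    simp only [form]
    rw [← tsum_mul_left]
    refine tsum_congr fun j => ?_
    simp only [lp.coeFn_smul, Pi.smul_apply, smul_eq_mul]
    ring
  have h2' : HasSum (fun l => w l * form b (m - l) c c) (form b m c (convOp w c)) := by
    -- Since the potential is real, conj (w (-l)) = w l: exchanging l and -l gives both sums the
    -- same coefficients and the same shifts m - l.
    rw [← (Equiv.neg Freq).hasSum_iff] at h2
    refine h2.congr_fun ?_
    intro l
    have : m - l = m + -l := sub_eq_add_neg _ _
    rw [this, ← form_shift_right]
    simp only [form, Function.comp_apply, Equiv.neg_apply]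
    rw [← tsum_mul_left]
    refine tsum_congr fun j => ?_
    simp only [lp.coeFn_smul, Pi.smul_apply, smul_eq_mul, map_mul, hw.conj_eq, neg_neg]
    ring
  refine (h1'.sub h2').congr_fun ?_
  intro l
  rw [form_symbol_sub (fun j => hb (j + l)) hb]
  ring

theorem norm_mul_conj_le (B : ℝ) (hB : 0 ≤ B) {x y z : ℂ} (hx : ‖x‖ ≤ B) :
    ‖x * (y * conj z)‖ ≤ B * (‖y‖ ^ 2 + ‖z‖ ^ 2) := by
  rw [norm_mul, norm_mul, RCLike.norm_conj]
  refine mul_le_mul hx ?_ (by positivity) hB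
  nlinarith [sq_nonneg (‖y‖ - ‖z‖), sq_nonneg (‖y‖), sq_nonneg (‖z‖)]

/-- Evolution of a form along a solution. -/
theorem form_evolution {ħ ε : ℝ} {w : Freq → ℂ} (hw : IsRealSummable w) {c : ℝ → SeqL2}
    (hc : IsFourierSolution ħ ε w c) {b : Freq → ℂ} {B B' : ℝ} (hb : ∀ j, ‖b j‖ ≤ B) (m : Freq)
    (hbE : ∀ j, ‖b j * ((energy ħ j - energy ħ (j - m) : ℝ) : ℂ)‖ ≤ B') (t₀ t₁ : ℝ) :
    form b m (c t₁) (c t₁) - form b m (c t₀) (c t₀) =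
      ∫ t in t₀..t₁, -(Complex.I / ħ) *
        (form (fun j => b j * ((energy ħ j - energy ħ (j - m) : ℝ) : ℂ)) m (c t) (c t) +
          (ε : ℂ) ^ 2 * ∑' l, w l * form (fun j => b (j + l) - b j) (m - l) (c t) (c t)) := by
  have hB : 0 ≤ B := (norm_nonneg _).trans (hb 0)
  have hB' : 0 ≤ B' := (norm_nonneg _).trans (hbE 0)
  set V := convOp w with hV
  -- The energy is unbounded, so `c` is differentiable only coordinate by coordinate. Each term of
  -- the form is differentiated and integrated separately, and the integrals are summed by dominated
  -- convergence.
  set F : Freq → ℝ → ℂ := fun j t => -(Complex.I / ħ) *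
    ((b j * ((energy ħ j - energy ħ (j - m) : ℝ) : ℂ)) * (c t j * conj (c t (j - m))) +
      (ε : ℂ) ^ 2 * (b j * (V (c t) j * conj (c t (j - m))) -
        b j * (c t j * conj (V (c t) (j - m))))) with hF
  have hcV : Continuous fun t => V (c t) := V.continuous.comp hc.continuous
  have hFcont : ∀ j, Continuous (F j) := fun j => by
    have h1 := continuous_coord hc.continuous j
    have h2 := continuous_coord hc.continuous (j - m)
    have h3 := continuous_coord hcV j
    have h4 := continuous_coord hcV (j - m)
    have hs : Continuous (fun z : ℂ => conj z) := Complex.continuous_conj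
    have h2' := hs.comp h2
    have h4' := hs.comp h4
    exact continuous_const.mul ((continuous_const.mul (h1.mul h2')).add (continuous_const.mul
      ((continuous_const.mul (h3.mul h2')).sub (continuous_const.mul (h1.mul h4')))))
  have hderiv : ∀ j t, HasDerivAt (fun s => b j * (c s j * conj (c s (j - m)))) (F j t) t := by
    intro j t
    have h1 := hc.deriv j t
    have h2 := (hc.deriv (j - m) t).star
    have := (h1.mul h2).const_mul (b j)
    refine this.congr_deriv ?_
    simp only [hF, hV, RCLike.star_def, map_mul, map_add, map_neg, map_div₀, Complex.conj_I,
      Complex.conj_ofReal, map_pow, Complex.ofReal_sub]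
    ring
  have hint : ∀ j, ∫ t in t₀..t₁, F j t =
      b j * (c t₁ j * conj (c t₁ (j - m))) - b j * (c t₀ j * conj (c t₀ (j - m))) := fun j =>
    intervalIntegral.integral_eq_sub_of_hasDerivAt (fun t _ => hderiv j t)
      ((hFcont j).intervalIntegrable _ _)
  set K : ℝ := ‖-(Complex.I / ħ : ℂ)‖ * (B' + ε ^ 2 * (B + B)) with hK
  have hsq : ∀ (d : SeqL2), HasSum (fun j => ‖d j‖ ^ 2) (‖d‖ ^ 2) := fun d => by
    rw [← tsum_norm_sq]; exact (summable_norm_sq d).hasSum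
  have hsqs : ∀ (d : SeqL2), HasSum (fun j => ‖d (j - m)‖ ^ 2) (‖d‖ ^ 2) := fun d =>
    (Equiv.subRight m).hasSum_iff.mpr (hsq d)
  -- Products of two coordinates are bounded by sums of squares, whose sum over `j` is a continuous
  -- function of time. The factor `B'` controls the symbol multiplied by the unbounded energy
  -- difference.
  set bound : Freq → ℝ → ℝ := fun j t =>
    K * (‖c t j‖ ^ 2 + ‖c t (j - m)‖ ^ 2 + ‖V (c t) j‖ ^ 2 + ‖V (c t) (j - m)‖ ^ 2) with hbound
  have hboundsum : ∀ t, HasSum (fun j => bound j t)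
      (K * (‖c t‖ ^ 2 + ‖c t‖ ^ 2 + ‖V (c t)‖ ^ 2 + ‖V (c t)‖ ^ 2)) := fun t =>
    ((((hsq _).add (hsqs _)).add (hsq _)).add (hsqs _)).mul_left K
  have key := intervalIntegral.hasSum_integral_of_dominated_convergence (μ := volume)
    (a := t₀) (b := t₁) (F := F) (f := fun t => -(Complex.I / ħ) *
        (form (fun j => b j * ((energy ħ j - energy ħ (j - m) : ℝ) : ℂ)) m (c t) (c t) +
          (ε : ℂ) ^ 2 * ∑' l, w l * form (fun j => b (j + l) - b j) (m - l) (c t) (c t)))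
    bound (fun j => (hFcont j).aestronglyMeasurable) ?_ ?_ ?_ ?_
  · simp only [hint] at key
    exact ((summable_form hb m _ _).hasSum.sub (summable_form hb m _ _).hasSum).unique key
  · refine fun j => Eventually.of_forall fun t _ => ?_
    simp only [hF, hbound, hK]
    rw [norm_mul, mul_assoc ‖-(Complex.I / ħ : ℂ)‖]
    refine mul_le_mul_of_nonneg_left ?_ (norm_nonneg _)
    refine (norm_add_le _ _).trans ?_
    have e1 := norm_mul_conj_le B' hB' (y := c t j) (z := c t (j - m)) (hbE j)
    have e2 := norm_mul_conj_le B hB (y := V (c t) j) (z := c t (j - m)) (hb j)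
    have e3 := norm_mul_conj_le B hB (y := c t j) (z := V (c t) (j - m)) (hb j)
    have e4 : ‖(ε : ℂ) ^ 2 * (b j * (V (c t) j * conj (c t (j - m))) -
        b j * (c t j * conj (V (c t) (j - m))))‖ ≤
        ε ^ 2 * (B * (‖V (c t) j‖ ^ 2 + ‖c t (j - m)‖ ^ 2) +
          B * (‖c t j‖ ^ 2 + ‖V (c t) (j - m)‖ ^ 2)) := by
      rw [norm_mul, norm_pow, Complex.norm_real, Real.norm_eq_abs, sq_abs]
      exact mul_le_mul_of_nonneg_left ((norm_sub_le _ _).trans (add_le_add e2 e3)) (sq_nonneg _)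
    refine (add_le_add e1 e4).trans ?_
    have p1 : 0 ≤ B' * (‖V (c t) j‖ ^ 2 + ‖V (c t) (j - m)‖ ^ 2) := by positivity
    have p2 : 0 ≤ ε ^ 2 * (B * (‖V (c t) j‖ ^ 2 + ‖V (c t) (j - m)‖ ^ 2 + ‖c t j‖ ^ 2 +
      ‖c t (j - m)‖ ^ 2)) := by positivity
    nlinarith [p1, p2]
  · exact Eventually.of_forall fun t _ => (hboundsum t).summable
  · have : (fun t => ∑' j, bound j t) = fun t =>
        K * (‖c t‖ ^ 2 + ‖c t‖ ^ 2 + ‖V (c t)‖ ^ 2 + ‖V (c t)‖ ^ 2) :=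
      funext fun t => (hboundsum t).tsum_eq
    rw [this]
    have h1 := hc.continuous
    exact Continuous.intervalIntegrable (by fun_prop) _ _
  · refine Eventually.of_forall fun t _ => ?_
    rw [(hasSum_form_commutator hw hb m (c t)).tsum_eq]
    exact ((summable_form hbE m _ _).hasSum.add (((summable_form hb m _ _).hasSum.sub
      (summable_form hb m _ _).hasSum).mul_left _)).mul_left _

theorem form_one_zero (c : SeqL2) : form (fun _ => 1) 0 c c = ((‖c‖ ^ 2 : ℝ) : ℂ) := by
  rw [← tsum_norm_sq, Complex.ofReal_tsum]
  refine tsum_congr fun j => ?_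
  rw [sub_zero, one_mul, Complex.mul_conj, Complex.normSq_eq_norm_sq]

/-- Conservation of the `L²` norm. -/
theorem IsFourierSolution.norm_eq {ħ ε : ℝ} {w : Freq → ℂ} (hw : IsRealSummable w)
    {c : ℝ → SeqL2} (hc : IsFourierSolution ħ ε w c) (s t : ℝ) : ‖c t‖ = ‖c s‖ := by
  -- For the symbol 1 and the shift 0, the energy difference and all the differences of the symbol
  -- vanish.
  have h := form_evolution hw hc (b := fun _ => 1) (B := 1) (B' := 0) (fun _ => by simp) 0
    (fun _ => by simp) s t
  have h0 : ∀ t, form (fun j => (1 : ℂ) * ((energy ħ j - energy ħ (j - 0) : ℝ) : ℂ)) 0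
      (c t) (c t) = 0 := fun t => by simp [form]
  have h1 : ∀ (l : Freq) t, form (fun j => (1 : ℂ) - 1) (0 - l) (c t) (c t) = 0 := fun l t => by
    simp [form]
  simp only [h0, h1, mul_zero, tsum_zero, add_zero, intervalIntegral.integral_zero,
    form_one_zero, sub_eq_zero, Complex.ofReal_inj] at h
  exact (pow_left_inj₀ (norm_nonneg _) (norm_nonneg _) two_ne_zero).mp h

/-! ### Persistence of the low frequency bound -/

section Regularization

variable {ħ ε : ℝ} {w : Freq → ℂ} {c : ℝ → SeqL2} {κ : ℝ}

/-- The average `∫₀^∞ exp(-s) c(t + κ s) ds` of a curve. -/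
def expAverage (κ : ℝ) (c : ℝ → SeqL2) (t : ℝ) : SeqL2 :=
  ∫ s in Set.Ioi (0 : ℝ), Real.exp (-s) • c (t + κ * s)

theorem integrableOn_exp_smul {E : Type*} [NormedAddCommGroup E] [NormedSpace ℝ E] {f : ℝ → E}
    (hf : Continuous f) {B : ℝ} (hB : ∀ t, ‖f t‖ ≤ B) (κ t : ℝ) :
    IntegrableOn (fun s => Real.exp (-s) • f (t + κ * s)) (Set.Ioi 0) := by
  have h : IntegrableOn (fun s : ℝ => B * Real.exp (-s)) (Set.Ioi 0) :=
    (integrableOn_exp_neg_Ioi 0).const_mul B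
  refine Integrable.mono' h (Continuous.aestronglyMeasurable (by fun_prop))
    (Eventually.of_forall fun s => ?_)
  rw [norm_smul, Real.norm_eq_abs, abs_of_pos (Real.exp_pos _), mul_comm]
  exact mul_le_mul_of_nonneg_right (hB _) (Real.exp_pos _).le

theorem continuous_expAverage (hc : Continuous c) {B : ℝ} (hB : ∀ t, ‖c t‖ ≤ B) :
    Continuous (expAverage κ c) := by
  refine continuous_of_dominated (bound := fun s => B * Real.exp (-s))
    (fun t => Continuous.aestronglyMeasurable (by fun_prop)) (fun t => Eventually.of_forall fun s => ?_)
    ((integrableOn_exp_neg_Ioi 0).const_mul B) (Eventually.of_forall fun s => by fun_prop)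
  rw [norm_smul, Real.norm_eq_abs, abs_of_pos (Real.exp_pos _), mul_comm]
  exact mul_le_mul_of_nonneg_right (hB _) (Real.exp_pos _).le

theorem norm_expAverage_le {B : ℝ} (hB : ∀ t, ‖c t‖ ≤ B) (t : ℝ) :
    ‖expAverage κ c t‖ ≤ B := by
  have h := norm_integral_le_of_norm_le (μ := volume.restrict (Set.Ioi (0 : ℝ)))
    (f := fun s => Real.exp (-s) • c (t + κ * s)) (g := fun s => B * Real.exp (-s))
    ((integrableOn_exp_neg_Ioi 0).const_mul B) (Eventually.of_forall fun s => by
      rw [norm_smul, Real.norm_eq_abs, abs_of_pos (Real.exp_pos _), mul_comm]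
      exact mul_le_mul_of_nonneg_right (hB _) (Real.exp_pos _).le)
  rwa [integral_const_mul, integral_exp_neg_Ioi_zero, mul_one] at h

/-- The generator of the evolution, coordinate by coordinate. -/
def generatorCoord (ħ ε : ℝ) (w : Freq → ℂ) (j : Freq) : SeqL2 →L[ℂ] ℂ :=
  (-(Complex.I / ħ) * (energy ħ j : ℂ)) • lp.evalCLM ℂ (fun _ : Freq => ℂ) 2 j +
    (-(Complex.I / ħ) * (ε : ℂ) ^ 2) • (lp.evalCLM ℂ (fun _ : Freq => ℂ) 2 j).comp (convOp w)

theorem generatorCoord_apply (j : Freq) (d : SeqL2) : generatorCoord ħ ε w j d =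
    -(Complex.I / ħ) * ((energy ħ j : ℂ) * d j + (ε : ℂ) ^ 2 * convOp w d j) := by
  change (-(Complex.I / ħ) * (energy ħ j : ℂ)) * d j +
    (-(Complex.I / ħ) * (ε : ℂ) ^ 2) * convOp w d j = _
  ring

theorem clm_expAverage (hc : Continuous c) {B : ℝ} (hB : ∀ t, ‖c t‖ ≤ B) (D : SeqL2 →L[ℂ] ℂ)
    (t : ℝ) : D (expAverage κ c t) = ∫ s in Set.Ioi (0 : ℝ), Real.exp (-s) • D (c (t + κ * s)) := by
  have := (D.restrictScalars ℝ).integral_comp_comm (integrableOn_exp_smul hc hB κ t)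
  simp only [ContinuousLinearMap.coe_restrictScalars', map_smul] at this
  rw [expAverage, ← this]

theorem IsFourierSolution.hasDerivAt (hc : IsFourierSolution ħ ε w c) (j : Freq) (t : ℝ) :
    HasDerivAt (fun s => c s j) (generatorCoord ħ ε w j (c t)) t := by
  rw [generatorCoord_apply]; exact hc.deriv j t

/-- Averages of solutions are solutions. -/
theorem IsFourierSolution.expAverage (hc : IsFourierSolution ħ ε w c) {B : ℝ}
    (hB : ∀ t, ‖c t‖ ≤ B) : IsFourierSolution ħ ε w (expAverage κ c) where
  continuous := continuous_expAverage hc.continuous hB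
  deriv j t := by
    rw [← generatorCoord_apply]
    set D := generatorCoord ħ ε w j with hD
    have hcoord : ∀ t, TorusSchrodinger.expAverage κ c t j =
        ∫ s in Set.Ioi (0 : ℝ), Real.exp (-s) • c (t + κ * s) j := fun t =>
      clm_expAverage hc.continuous hB (lp.evalCLM ℂ (fun _ : Freq => ℂ) 2 j) t
    simp only [hcoord]
    rw [clm_expAverage hc.continuous hB D t]
    have hDc : Continuous fun t => D (c t) := D.continuous.comp hc.continuous
    have hjc := continuous_coord hc.continuous j
    have hDB : ∀ t, ‖D (c t)‖ ≤ ‖D‖ * B := fun t =>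
      (D.le_opNorm _).trans (mul_le_mul_of_nonneg_left (hB t) (norm_nonneg _))
    have hjB : ∀ t, ‖c t j‖ ≤ B := fun t => (norm_coord_le _ _).trans (hB t)
    refine (hasDerivAt_integral_of_dominated_loc_of_deriv_le (μ := volume.restrict (Set.Ioi 0))
      (F := fun t s => Real.exp (-s) • c (t + κ * s) j)
      (F' := fun t s => Real.exp (-s) • D (c (t + κ * s)))
      (bound := fun s => ‖D‖ * B * Real.exp (-s)) (s := Set.univ) Filter.univ_mem
      (Eventually.of_forall fun t => Continuous.aestronglyMeasurable (by fun_prop))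
      (integrableOn_exp_smul hjc hjB κ t)
      (integrableOn_exp_smul hDc hDB κ t).aestronglyMeasurable
      (Eventually.of_forall fun s x _ => ?_) ((integrableOn_exp_neg_Ioi 0).const_mul _)
      (Eventually.of_forall fun s x _ => ?_)).2
    · rw [norm_smul, Real.norm_eq_abs, abs_of_pos (Real.exp_pos _), mul_comm]
      exact mul_le_mul_of_nonneg_right (hDB _) (Real.exp_pos _).le
    · exact ((hc.hasDerivAt j (x + κ * s)).comp_add_const x (κ * s)).const_smul (Real.exp (-s))

/-- Integration by parts in s. Writing G for the generator, the average z of the orbit satisfies z =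
c + κ G z, so z = (1 - κG)⁻¹ c: averaging in time realizes the resolvent of the full Hamiltonian
without any domain question. -/
theorem expAverage_coord (hc : IsFourierSolution ħ ε w c) {B : ℝ} (hB : ∀ t, ‖c t‖ ≤ B)
    (j : Freq) (t : ℝ) : expAverage κ c t j =
      c t j + κ * generatorCoord ħ ε w j (expAverage κ c t) := by
  set D := generatorCoord ħ ε w j with hD
  have hcoord : expAverage κ c t j = ∫ s in Set.Ioi (0 : ℝ), Real.exp (-s) • c (t + κ * s) j :=
    clm_expAverage hc.continuous hB (lp.evalCLM ℂ (fun _ : Freq => ℂ) 2 j) t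
  have hDc : Continuous fun t => D (c t) := D.continuous.comp hc.continuous
  have hjc := continuous_coord hc.continuous j
  have hDB : ∀ t, ‖D (c t)‖ ≤ ‖D‖ * B := fun t =>
    (D.le_opNorm _).trans (mul_le_mul_of_nonneg_left (hB t) (norm_nonneg _))
  have hjB : ∀ t, ‖c t j‖ ≤ B := fun t => (norm_coord_le _ _).trans (hB t)
  have hi1 := integrableOn_exp_smul hjc hjB κ t
  have hi2 := integrableOn_exp_smul hDc hDB κ t
  have hder : ∀ s ∈ Set.Ioi (0 : ℝ), HasDerivAt (fun s : ℝ => Real.exp (-s) • c (t + κ * s) j)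
      (-(Real.exp (-s) • c (t + κ * s) j) + (κ : ℂ) * (Real.exp (-s) • D (c (t + κ * s)))) s := by
    intro s _
    have h1 : HasDerivAt (fun s : ℝ => Real.exp (-s)) (-Real.exp (-s)) s := by
      have := (Real.hasDerivAt_exp (-s)).scomp s (hasDerivAt_neg s)
      simpa [Function.comp_def] using this
    have h2 : HasDerivAt (fun s : ℝ => c (t + κ * s) j) (κ • D (c (t + κ * s))) s := by
      have hin : HasDerivAt (fun s : ℝ => t + κ * s) κ s := by
        simpa using ((hasDerivAt_id s).const_mul κ).const_add t
      exact (hc.hasDerivAt j (t + κ * s)).scomp s hin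
    refine (h1.smul h2).congr_deriv ?_
    simp only [Complex.real_smul, Complex.ofReal_neg]
    ring
  have hlim : Tendsto (fun s : ℝ => Real.exp (-s) • c (t + κ * s) j) atTop (𝓝 0) := by
    refine squeeze_zero_norm (a := fun s : ℝ => Real.exp (-s) * B) (fun s => ?_) ?_
    · rw [norm_smul, Real.norm_eq_abs, abs_of_pos (Real.exp_pos _)]
      exact mul_le_mul_of_nonneg_left (hjB _) (Real.exp_pos _).le
    · have := (Real.tendsto_exp_neg_atTop_nhds_zero).mul_const B
      simpa using this
  have hcont : ContinuousWithinAt (fun s : ℝ => Real.exp (-s) • c (t + κ * s) j) (Set.Ici 0) 0 :=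
    Continuous.continuousWithinAt (by fun_prop)
  have hi1' : IntegrableOn (fun s => -(Real.exp (-s) • c (t + κ * s) j)) (Set.Ioi 0) := hi1.neg
  have := integral_Ioi_of_hasDerivAt_of_tendsto hcont hder
    (hi1'.add (hi2.const_mul (κ : ℂ))) hlim
  rw [integral_add hi1' (hi2.const_mul (κ : ℂ)), integral_neg, integral_const_mul] at this
  rw [hcoord, clm_expAverage hc.continuous hB D t]
  simp only [neg_zero, Real.exp_zero, mul_zero, add_zero, one_smul, zero_sub] at this
  linear_combination -this

end Regularization

/-- The resolvent symbol `1 / (1 + i E_j / δ)`. -/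
def resolventSymbol (ħ δ : ℝ) (j : Freq) : ℂ := (1 + Complex.I * (energy ħ j / δ : ℝ))⁻¹

theorem norm_sq_resolventSymbol (ħ δ : ℝ) (j : Freq) :
    ‖resolventSymbol ħ δ j‖ ^ 2 = (1 + (energy ħ j / δ) ^ 2)⁻¹ := by
  rw [resolventSymbol, norm_inv, inv_pow, ← Complex.normSq_eq_norm_sq, Complex.normSq_apply]
  simp
  ring

theorem norm_resolventSymbol_le (ħ δ : ℝ) (j : Freq) : ‖resolventSymbol ħ δ j‖ ≤ 1 := by
  have h : ‖resolventSymbol ħ δ j‖ ^ 2 ≤ 1 ^ 2 := by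
    rw [norm_sq_resolventSymbol, one_pow]
    exact inv_le_one_of_one_le₀ (by nlinarith [sq_nonneg (energy ħ j / δ)])
  exact le_of_sq_le_sq h zero_le_one

theorem summable_mul_sq {b : Freq → ℂ} (hb : ∀ j, ‖b j‖ ≤ 1) (c : SeqL2) :
    Summable fun j => ‖b j * c j‖ ^ 2 := by
  refine Summable.of_nonneg_of_le (fun _ => by positivity) (fun j => ?_) (summable_norm_sq c)
  rw [norm_mul]
  gcongr
  exact mul_le_of_le_one_left (norm_nonneg _) (hb j)

/-- Multiplication of a sequence by a symbol bounded by one. -/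
def mulSeq (b : Freq → ℂ) (hb : ∀ j, ‖b j‖ ≤ 1) (c : SeqL2) : SeqL2 :=
  ofSummable (fun j => b j * c j) (summable_mul_sq hb c)

theorem norm_mulSeq_le (b : Freq → ℂ) (hb : ∀ j, ‖b j‖ ≤ 1) (c : SeqL2) :
    ‖mulSeq b hb c‖ ≤ ‖c‖ := by
  refine le_of_sq_le_sq ?_ (norm_nonneg _)
  rw [← tsum_norm_sq, ← tsum_norm_sq]
  refine Summable.tsum_le_tsum (fun j => ?_) (summable_mul_sq hb c) (summable_norm_sq c)
  simp only [mulSeq, ofSummable_apply, norm_mul]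
  gcongr
  exact mul_le_of_le_one_left (norm_nonneg _) (hb j)

/-- A solution whose initial value has little mass at low energy keeps little mass at low energy
for all times. -/
theorem IsFourierSolution.low_energy_le {ħ ε : ℝ} {w : Freq → ℂ} (hw : IsRealSummable w)
    {c : ℝ → SeqL2} (hc : IsFourierSolution ħ ε w c) (hħ : 0 < ħ) (hn : ‖c 0‖ = 1)
    {δ δ' η : ℝ} (hδ : 0 < δ) (hδ' : 0 < δ') (hη : 0 ≤ η)
    (hlow : ∑' j, {j | energy ħ j ≤ δ'}.indicator (fun j => ‖c 0 j‖ ^ 2) j ≤ η ^ 2) (t : ℝ) :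
    ∑' j, {j | energy ħ j ≤ δ}.indicator (fun j => ‖c t j‖ ^ 2) j ≤
      2 * (η + δ / δ' + 2 * (ε ^ 2 * (∑' l, ‖w l‖) / δ)) ^ 2 := by
  have hcn : ∀ t, ‖c t‖ = 1 := fun t => (hc.norm_eq hw 0 t).trans hn
  have hB : ∀ t, ‖c t‖ ≤ 1 := fun t => (hcn t).le
  -- With this scale, z is the resolvent of the full Hamiltonian at scale δ applied to c. It is a
  -- solution, so its norm is conserved, and it differs from the free resolvent R c = (1 + iE/δ)⁻¹ c
  -- by O(ε²/δ). Thus the norm of R c is almost conserved, and R detects low energies: |R|² ≥ 1/2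
  -- where E ≤ δ, and |R| ≤ δ/δ' where E > δ'.
  set κ := ħ / δ with hκ
  set z := TorusSchrodinger.expAverage κ c with hz
  have hzs : IsFourierSolution ħ ε w z := hc.expAverage hB
  set W := ∑' l, ‖w l‖ with hW
  have hW0 : 0 ≤ W := tsum_nonneg fun _ => norm_nonneg _
  set R := resolventSymbol ħ δ with hR
  have hR1 : ∀ j, ‖R j‖ ≤ 1 := norm_resolventSymbol_le ħ δ
  have hzle : ∀ t, ‖z t‖ ≤ 1 := fun t => norm_expAverage_le hB t
  have hzform : ∀ t, z t = mulSeq R hR1 (c t) -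
      (Complex.I * (ε ^ 2 / δ : ℝ)) • mulSeq R hR1 (convOp w (z t)) := by
    intro t
    ext j
    have h := expAverage_coord (κ := κ) hc hB j t
    rw [generatorCoord_apply, ← hz] at h
    simp only [mulSeq, lp.coeFn_sub, Pi.sub_apply, ofSummable_apply, lp.coeFn_smul,
      Pi.smul_apply, smul_eq_mul]
    have hne : (1 + Complex.I * (energy ħ j / δ : ℝ) : ℂ) ≠ 0 := by
      intro h0
      have := congrArg Complex.re h0
      simp at this
    have hRj : R j = (1 + Complex.I * (energy ħ j / δ : ℝ) : ℂ)⁻¹ := rfl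
    have hħ' : (ħ : ℂ) ≠ 0 := by exact_mod_cast hħ.ne'
    have hδc : (δ : ℂ) ≠ 0 := by exact_mod_cast hδ.ne'
    have hk : (κ : ℂ) * (-(Complex.I / ħ)) = -(Complex.I / δ) := by
      rw [hκ]; push_cast; field_simp
    have h2 : (1 + Complex.I * (energy ħ j / δ : ℝ) : ℂ) * z t j =
        c t j - Complex.I * (ε ^ 2 / δ : ℝ) * convOp w (z t) j := by
      rw [← mul_assoc, hk] at h
      push_cast
      linear_combination h
    have h3 : z t j = R j * ((1 + Complex.I * (energy ħ j / δ : ℝ) : ℂ) * z t j) := by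
      rw [hRj, inv_mul_cancel_left₀ hne]
    rw [h3, h2]
    ring
  have hdiff : ∀ t, ‖mulSeq R hR1 (c t) - z t‖ ≤ ε ^ 2 * W / δ := by
    intro t
    have : mulSeq R hR1 (c t) - z t =
        (Complex.I * (ε ^ 2 / δ : ℝ)) • mulSeq R hR1 (convOp w (z t)) := by
      have h := hzform t
      rw [sub_eq_iff_eq_add]
      nth_rewrite 2 [h]
      abel
    rw [this, norm_smul, norm_mul, Complex.norm_I, one_mul, Complex.norm_real, Real.norm_eq_abs,
      abs_of_nonneg (by positivity)]
    have h1 : ‖mulSeq R hR1 (convOp w (z t))‖ ≤ W := by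
      refine (norm_mulSeq_le _ _ _).trans ((norm_convOp_le hw.summable _).trans ?_)
      exact mul_le_of_le_one_right hW0 (hzle t)
    calc ε ^ 2 / δ * ‖mulSeq R hR1 (convOp w (z t))‖ ≤ ε ^ 2 / δ * W := by gcongr
      _ = ε ^ 2 * W / δ := by ring
  -- Exact conservation holds for z only; replacing z by R c at times t and 0 costs the error twice.
  have hzc : ‖z t‖ = ‖z 0‖ := hzs.norm_eq hw 0 t
  have hyt : ‖mulSeq R hR1 (c t)‖ ≤ ‖mulSeq R hR1 (c 0)‖ + 2 * (ε ^ 2 * W / δ) := by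
    have h1 := norm_le_norm_add_norm_sub' (mulSeq R hR1 (c t)) (z t)
    have h2 := norm_le_norm_add_norm_sub (mulSeq R hR1 (c 0)) (z 0)
    linarith [hdiff t, hdiff 0]
  have hy0 : ‖mulSeq R hR1 (c 0)‖ ≤ η + δ / δ' := by
    refine le_of_sq_le_sq ?_ (by positivity)
    have hind : Summable fun j => {j | energy ħ j ≤ δ'}.indicator (fun j => ‖c 0 j‖ ^ 2) j :=
      (summable_norm_sq (c 0)).indicator _
    calc ‖mulSeq R hR1 (c 0)‖ ^ 2 = ∑' j, ‖mulSeq R hR1 (c 0) j‖ ^ 2 := (tsum_norm_sq _).symm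
      _ ≤ ∑' j, ({j | energy ħ j ≤ δ'}.indicator (fun j => ‖c 0 j‖ ^ 2) j +
            (δ / δ') ^ 2 * ‖c 0 j‖ ^ 2) := by
          refine Summable.tsum_le_tsum (fun j => ?_) (summable_norm_sq _)
            (hind.add ((summable_norm_sq (c 0)).mul_left _))
          simp only [mulSeq, ofSummable_apply, norm_mul, mul_pow]
          by_cases hj : energy ħ j ≤ δ'
          · rw [Set.indicator_of_mem (by exact hj)]
            have : ‖R j‖ ^ 2 ≤ 1 := pow_le_one₀ (norm_nonneg _) (hR1 j)
            nlinarith [sq_nonneg (‖c 0 j‖), sq_nonneg (δ / δ'),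
              mul_nonneg (sq_nonneg (δ / δ')) (sq_nonneg (‖c 0 j‖))]
          · rw [Set.indicator_of_notMem (by exact hj), zero_add]
            refine mul_le_mul_of_nonneg_right ?_ (sq_nonneg _)
            rw [hR, norm_sq_resolventSymbol]
            push Not at hj
            have hE : 0 < energy ħ j := hδ'.trans hj
            have : δ' / δ ≤ energy ħ j / δ := by gcongr
            have h4 : (δ' / δ) ^ 2 ≤ 1 + (energy ħ j / δ) ^ 2 := by
              have : (δ' / δ) ^ 2 ≤ (energy ħ j / δ) ^ 2 := by gcongr
              linarith
            calc (1 + (energy ħ j / δ) ^ 2)⁻¹ ≤ ((δ' / δ) ^ 2)⁻¹ := by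
                  exact inv_anti₀ (by positivity) h4
              _ = (δ / δ') ^ 2 := by rw [← inv_pow, inv_div]
      _ ≤ η ^ 2 + (δ / δ') ^ 2 := by
          rw [hind.tsum_add ((summable_norm_sq (c 0)).mul_left _), tsum_mul_left, tsum_norm_sq,
            hn]
          linarith
      _ ≤ (η + δ / δ') ^ 2 := by
          have : 0 ≤ η * (δ / δ') := by positivity
          nlinarith
  calc ∑' j, {j | energy ħ j ≤ δ}.indicator (fun j => ‖c t j‖ ^ 2) j
      ≤ ∑' j, 2 * ‖mulSeq R hR1 (c t) j‖ ^ 2 := by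
        refine Summable.tsum_le_tsum (fun j => ?_) ((summable_norm_sq (c t)).indicator _)
          ((summable_norm_sq _).mul_left 2)
        by_cases hj : energy ħ j ≤ δ
        · rw [Set.indicator_of_mem (by exact hj)]
          simp only [mulSeq, ofSummable_apply, norm_mul, mul_pow]
          have h5 : energy ħ j / δ ≤ 1 := (div_le_one hδ).mpr hj
          have h6 : 0 ≤ energy ħ j / δ := div_nonneg (energy_nonneg _ _) hδ.le
          -- This lower bound on {E ≤ δ} is the origin of the factor 2 in the conclusion.
          have h7 : (1 : ℝ) ≤ 2 * ‖R j‖ ^ 2 := by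
            rw [hR, norm_sq_resolventSymbol, ← div_eq_mul_inv, le_div_iff₀ (by positivity)]
            nlinarith
          nlinarith [sq_nonneg (‖c t j‖)]
        · rw [Set.indicator_of_notMem (by exact hj)]
          positivity
    _ = 2 * ‖mulSeq R hR1 (c t)‖ ^ 2 := by rw [tsum_mul_left, tsum_norm_sq]
    _ ≤ 2 * (η + δ / δ' + 2 * (ε ^ 2 * W / δ)) ^ 2 := by
        gcongr
        linarith

/-! ### Time averages of forms -/

/-- The average over the time interval `[a, a + ℓ]` of the form with symbol `b` and shift `m`. -/
def formAverage (a ℓ : ℝ) (c : ℝ → SeqL2) (b : Freq → ℂ) (m : Freq) : ℂ :=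
  (ℓ : ℂ)⁻¹ * ∫ t in a..(a + ℓ), form b m (c t) (c t)

section Averages

variable {a ℓ : ℝ} {c : ℝ → SeqL2}

theorem norm_average_le (hℓ : 0 < ℓ) {f : ℝ → ℂ} {C : ℝ} (hf : ∀ t, ‖f t‖ ≤ C) :
    ‖(ℓ : ℂ)⁻¹ * ∫ t in a..(a + ℓ), f t‖ ≤ C := by
  have h := intervalIntegral.norm_integral_le_of_norm_le_const (a := a) (b := a + ℓ)
    (fun t _ => hf t)
  rw [add_sub_cancel_left, abs_of_pos hℓ] at h
  rw [norm_mul, norm_inv, Complex.norm_real, Real.norm_eq_abs, abs_of_pos hℓ]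
  calc ℓ⁻¹ * _ ≤ ℓ⁻¹ * (C * ℓ) := by gcongr
    _ = C := by field_simp

theorem norm_formAverage_le (hℓ : 0 < ℓ) (hn : ∀ t, ‖c t‖ = 1) {b : Freq → ℂ} {B : ℝ}
    (hb : ∀ j, ‖b j‖ ≤ B) (m : Freq) : ‖formAverage a ℓ c b m‖ ≤ B := by
  refine norm_average_le hℓ fun t => (norm_form_le hb m _ _).trans ?_
  simp [hn]

theorem norm_formAverage_le_of_concentrated (hℓ : 0 < ℓ) (hn : ∀ t, ‖c t‖ = 1) {b : Freq → ℂ}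
    {B κ η : ℝ} {A : Set Freq} (hb : ∀ j, ‖b j‖ ≤ B) (hκ : ∀ j ∉ A, ‖b j‖ ≤ κ) (hκ0 : 0 ≤ κ)
    (hη : 0 ≤ η) (hA : ∀ t, ∑' j, A.indicator (fun j => ‖c t j‖ ^ 2) j ≤ η ^ 2) (m : Freq) :
    ‖formAverage a ℓ c b m‖ ≤ κ + B * η := by
  refine norm_average_le hℓ fun t => ?_
  have := norm_form_le_of_concentrated hb hκ hκ0 hη m (c t) (c t) (hA t)
  simpa [hn] using this

theorem intervalIntegrable_form (hc : Continuous c) {b : Freq → ℂ} {B : ℝ} (hb : ∀ j, ‖b j‖ ≤ B)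
    (m : Freq) (s t : ℝ) : IntervalIntegrable (fun t => form b m (c t) (c t)) volume s t :=
  (continuous_form hb m hc hc).intervalIntegrable _ _

theorem formAverage_add (hc : Continuous c) {b b' : Freq → ℂ} {B B' : ℝ} (hb : ∀ j, ‖b j‖ ≤ B)
    (hb' : ∀ j, ‖b' j‖ ≤ B') (m : Freq) : formAverage a ℓ c (fun j => b j + b' j) m =
      formAverage a ℓ c b m + formAverage a ℓ c b' m := by
  simp only [formAverage, form_symbol_add hb hb']
  rw [intervalIntegral.integral_add (intervalIntegrable_form hc hb m _ _)
    (intervalIntegrable_form hc hb' m _ _), mul_add]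

theorem formAverage_sub (hc : Continuous c) {b b' : Freq → ℂ} {B B' : ℝ} (hb : ∀ j, ‖b j‖ ≤ B)
    (hb' : ∀ j, ‖b' j‖ ≤ B') (m : Freq) : formAverage a ℓ c (fun j => b j - b' j) m =
      formAverage a ℓ c b m - formAverage a ℓ c b' m := by
  simp only [formAverage, form_symbol_sub hb hb']
  rw [intervalIntegral.integral_sub (intervalIntegrable_form hc hb m _ _)
    (intervalIntegrable_form hc hb' m _ _), mul_sub]

theorem formAverage_smul (z : ℂ) (b : Freq → ℂ) (m : Freq) :
    formAverage a ℓ c (fun j => z * b j) m = z * formAverage a ℓ c b m := by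
  simp only [formAverage, form_symbol_smul, intervalIntegral.integral_const_mul]
  ring

theorem formAverage_one_zero (hℓ : 0 < ℓ) (hn : ∀ t, ‖c t‖ = 1) :
    formAverage a ℓ c (fun _ => 1) 0 = 1 := by
  have : (ℓ : ℂ) ≠ 0 := by exact_mod_cast hℓ.ne'
  simp [formAverage, form_one_zero, hn, this]

/-- Approximate invariance of the averaged forms. -/
theorem norm_formAverage_commutator_le {ħ ε : ℝ} {w : Freq → ℂ} (hw : IsRealSummable w)
    (hc : IsFourierSolution ħ ε w c) (hħ : 0 < ħ) (hℓ : 0 < ℓ) (hn : ∀ t, ‖c t‖ = 1)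
    {b : Freq → ℂ} {B B' : ℝ} (hb : ∀ j, ‖b j‖ ≤ B) (m : Freq)
    (hbE : ∀ j, ‖b j * ((energy ħ j - energy ħ (j - m) : ℝ) : ℂ)‖ ≤ B') :
    ‖formAverage a ℓ c (fun j => b j * ((energy ħ j - energy ħ (j - m) : ℝ) : ℂ)) m +
      (ε : ℂ) ^ 2 * ∑' l, w l * formAverage a ℓ c (fun j => b (j + l) - b j) (m - l)‖ ≤
      2 * ħ * B / ℓ := by
  have hB : 0 ≤ B := (norm_nonneg _).trans (hb 0)
  have hbl : ∀ (l j : Freq), ‖b (j + l) - b j‖ ≤ 2 * B := fun l j => by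
    linarith [norm_sub_le (b (j + l)) (b j), hb (j + l), hb j]
  set G : ℝ → ℂ := fun t => ∑' l, w l * form (fun j => b (j + l) - b j) (m - l) (c t) (c t)
    with hG
  have hterm : ∀ l t, ‖w l * form (fun j => b (j + l) - b j) (m - l) (c t) (c t)‖ ≤
      ‖w l‖ * (2 * B) := fun l t => by
    rw [norm_mul]
    refine mul_le_mul_of_nonneg_left ?_ (norm_nonneg _)
    simpa [hn] using norm_form_le (hbl l) (m - l) (c t) (c t)
  have htc : ∀ l, Continuous fun t => w l * form (fun j => b (j + l) - b j) (m - l) (c t) (c t) :=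
    fun l => continuous_const.mul (continuous_form (hbl l) _ hc.continuous hc.continuous)
  have hGc : Continuous G := continuous_tsum htc (hw.summable.mul_right (2 * B)) hterm
  have hsum : HasSum (fun l => ∫ t in a..(a + ℓ),
      w l * form (fun j => b (j + l) - b j) (m - l) (c t) (c t)) (∫ t in a..(a + ℓ), G t) := by
    refine intervalIntegral.hasSum_integral_of_dominated_convergence
      (fun l _ => ‖w l‖ * (2 * B)) (fun l => (htc l).aestronglyMeasurable)
      (fun l => Eventually.of_forall fun t _ => hterm l t)
      (Eventually.of_forall fun t _ => hw.summable.mul_right (2 * B))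
      (Continuous.intervalIntegrable continuous_const _ _)
      (Eventually.of_forall fun t _ => ?_)
    exact (Summable.of_norm_bounded (hw.summable.mul_right (2 * B)) fun l => hterm l t).hasSum
  have hQ : (ℓ : ℂ)⁻¹ * ∫ t in a..(a + ℓ), G t =
      ∑' l, w l * formAverage a ℓ c (fun j => b (j + l) - b j) (m - l) := by
    rw [← hsum.tsum_eq, ← tsum_mul_left]
    refine tsum_congr fun l => ?_
    rw [intervalIntegral.integral_const_mul, formAverage]
    ring
  have hev := form_evolution hw hc hb m hbE a (a + ℓ)
  have hGi : IntervalIntegrable (fun t => (ε : ℂ) ^ 2 *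
      ∑' l, w l * form (fun j => b (j + l) - b j) (m - l) (c t) (c t)) volume a (a + ℓ) :=
    (continuous_const.mul hGc).intervalIntegrable _ _
  rw [intervalIntegral.integral_const_mul, intervalIntegral.integral_add
    (intervalIntegrable_form hc.continuous hbE m _ _) hGi,
    intervalIntegral.integral_const_mul] at hev
  simp only [hG] at hQ
  have hIħ : (Complex.I * ħ) * -(Complex.I / ħ) = 1 := by
    have : (ħ : ℂ) ≠ 0 := by exact_mod_cast hħ.ne'
    field_simp
    simp
  have hfin : formAverage a ℓ c (fun j => b j * ((energy ħ j - energy ħ (j - m) : ℝ) : ℂ)) m +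
      (ε : ℂ) ^ 2 * ∑' l, w l * formAverage a ℓ c (fun j => b (j + l) - b j) (m - l) =
      (ℓ : ℂ)⁻¹ * ((Complex.I * ħ) * (form b m (c (a + ℓ)) (c (a + ℓ)) - form b m (c a) (c a))) := by
    rw [hev, ← mul_assoc (Complex.I * ħ), hIħ, one_mul, mul_add, ← hQ, formAverage]
    ring
  rw [hfin, norm_mul, norm_mul, norm_mul, Complex.norm_I, norm_inv, Complex.norm_real,
    Complex.norm_real, Real.norm_eq_abs, Real.norm_eq_abs, abs_of_pos hℓ, abs_of_pos hħ, one_mul]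
  have h1 : ‖form b m (c (a + ℓ)) (c (a + ℓ)) - form b m (c a) (c a)‖ ≤ 2 * B := by
    have e1 := norm_form_le hb m (c (a + ℓ)) (c (a + ℓ))
    have e2 := norm_form_le hb m (c a) (c a)
    simp only [hn, mul_one] at e1 e2
    linarith [norm_sub_le (form b m (c (a + ℓ)) (c (a + ℓ))) (form b m (c a) (c a))]
  calc ℓ⁻¹ * (ħ * _) ≤ ℓ⁻¹ * (ħ * (2 * B)) := by gcongr
    _ = 2 * ħ * B / ℓ := by ring

end Averages

/-! ### Lattice geometry -/

/-- The scalar product of two frequencies. -/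
def dot (k j : Freq) : ℝ := ∑ i, (k i : ℝ) * (j i : ℝ)

theorem dot_add (k j l : Freq) : dot k (j + l) = dot k j + dot k l := by
  simp only [dot, Pi.add_apply, Int.cast_add, mul_add, Finset.sum_add_distrib]

theorem dot_sub (k j l : Freq) : dot k (j - l) = dot k j - dot k l := by
  simp only [dot, Pi.sub_apply, Int.cast_sub, mul_sub, Finset.sum_sub_distrib]

theorem dot_zsmul (k l : Freq) (p : ℤ) : dot k (p • l) = p * dot k l := by
  simp only [dot, Pi.smul_apply, smul_eq_mul, Int.cast_mul, Finset.mul_sum]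
  exact Finset.sum_congr rfl fun i _ => by ring

theorem zsmul_dot (k l : Freq) (p : ℤ) : dot (p • k) l = p * dot k l := by
  simp only [dot, Pi.smul_apply, smul_eq_mul, Int.cast_mul, Finset.mul_sum]
  exact Finset.sum_congr rfl fun i _ => by ring

/-- The energy is quadratic, so its differences are affine in j. For m = p • k the leading term is a
multiple of ħ ε times the rescaled momentum `zeta`. -/
theorem energy_sub (ħ : ℝ) (j m : Freq) : energy ħ j - energy ħ (j - m) =
    4 * Real.pi ^ 2 * ħ ^ 2 * (dot m j - dot m m / 2) := by
  simp only [energy, dot, Fin.sum_univ_two, Pi.sub_apply, Int.cast_sub]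
  ring

/-- The determinant of two frequencies. -/
def det (k m : Freq) : ℤ := k 0 * m 1 - k 1 * m 0

/-- Two independent linear forms control the frequency. -/
theorem exists_lower_bound {k m : Freq} (h : det k m ≠ 0) {δ : ℝ} (hδ : 0 < δ) :
    ∃ ρ : ℝ, 0 < ρ ∧ ∀ (ħ : ℝ) (j : Freq), δ < energy ħ j →
      ρ ≤ |ħ * dot k j| + |ħ * dot m j| := by
  set S : ℝ := 1 + |(k 0 : ℝ)| + |(k 1 : ℝ)| + |(m 0 : ℝ)| + |(m 1 : ℝ)| with hS
  have hS1 : 1 ≤ S := by rw [hS]; linarith [abs_nonneg (k 0 : ℝ), abs_nonneg (k 1 : ℝ), abs_nonneg (m 0 : ℝ), abs_nonneg (m 1 : ℝ)]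
  have hdet : (1 : ℝ) ≤ |(det k m : ℝ)| := by exact_mod_cast Int.one_le_abs h
  refine ⟨Real.sqrt (δ / (4 * Real.pi ^ 2 * S ^ 2)), Real.sqrt_pos.mpr (by positivity),
    fun ħ j hj => ?_⟩
  set X := ħ * dot k j with hX
  set Y := ħ * dot m j with hY
  have hk0 : |(k 0 : ℝ)| ≤ S := by rw [hS]; linarith [abs_nonneg (k 0 : ℝ), abs_nonneg (k 1 : ℝ), abs_nonneg (m 0 : ℝ), abs_nonneg (m 1 : ℝ)]
  have hk1 : |(k 1 : ℝ)| ≤ S := by rw [hS]; linarith [abs_nonneg (k 0 : ℝ), abs_nonneg (k 1 : ℝ), abs_nonneg (m 0 : ℝ), abs_nonneg (m 1 : ℝ)]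
  have hm0 : |(m 0 : ℝ)| ≤ S := by rw [hS]; linarith [abs_nonneg (k 0 : ℝ), abs_nonneg (k 1 : ℝ), abs_nonneg (m 0 : ℝ), abs_nonneg (m 1 : ℝ)]
  have hm1 : |(m 1 : ℝ)| ≤ S := by rw [hS]; linarith [abs_nonneg (k 0 : ℝ), abs_nonneg (k 1 : ℝ), abs_nonneg (m 0 : ℝ), abs_nonneg (m 1 : ℝ)]
  -- Cramer's rule: det k m times each component of ħj is a combination of X and Y with coefficients
  -- bounded by S, and a nonzero integer determinant has modulus at least 1. Summing the two
  -- components gives energy ≤ 4π² S² (|X| + |Y|)², hence the value of ρ.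
  have key : ∀ (ξ p q : ℝ), |p| ≤ S → |q| ≤ S → (det k m : ℝ) * ξ = p * X - q * Y →
      ξ ^ 2 ≤ S ^ 2 * (|X| + |Y|) ^ 2 := by
    intro ξ p q hp hq he
    have h1 : |ξ| ≤ S * (|X| + |Y|) := by
      calc |ξ| ≤ |(det k m : ℝ)| * |ξ| := le_mul_of_one_le_left (abs_nonneg _) hdet
        _ = |p * X - q * Y| := by rw [← abs_mul, he]
        _ ≤ |p| * |X| + |q| * |Y| := by
          rw [← abs_mul, ← abs_mul]; exact abs_sub _ _
        _ ≤ S * |X| + S * |Y| := by gcongr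
        _ = _ := by ring
    rw [← mul_pow, ← sq_abs]
    gcongr
  have h0 := key (ħ * j 0) (m 1) (k 1) hm1 hk1 (by
    simp only [hX, hY, dot, det, Fin.sum_univ_two]; push_cast; ring)
  have h1 := key (ħ * j 1) (-(m 0 : ℝ)) (-(k 0 : ℝ)) (by rwa [abs_neg]) (by rwa [abs_neg]) (by
    simp only [hX, hY, dot, det, Fin.sum_univ_two]; push_cast; ring)
  refine Real.sqrt_le_iff.mpr ⟨by positivity, ?_⟩
  rw [div_le_iff₀ (by positivity)]
  have hE : energy ħ j = 2 * Real.pi ^ 2 * ((ħ * j 0) ^ 2 + (ħ * j 1) ^ 2) := by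
    simp only [energy, Fin.sum_univ_two]; ring
  have hpi : 0 < 2 * Real.pi ^ 2 := by positivity
  have h2 := mul_le_mul_of_nonneg_left (add_le_add h0 h1) hpi.le
  nlinarith

/-! ### The asymptotic regime -/

/-- Fourier coefficients of smooth real potentials. -/
structure IsPotential (w : Freq → ℂ) : Prop extends IsRealSummable w where
  summable_dot : ∀ k, Summable fun l => ‖w l‖ * |dot k l|
  summable_dot_sq : ∀ k, Summable fun l => ‖w l‖ * dot k l ^ 2

/-- Sequences of normalized solutions on long time intervals `[a, a + ℓ]`, with uniformly little
mass at low energy. -/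
structure Regime (w : Freq → ℂ) (ħ ε a ℓ : ℕ → ℝ) (c : ℕ → ℝ → SeqL2) : Prop where
  potential : IsPotential w
  ħ_pos : ∀ n, 0 < ħ n
  ε_pos : ∀ n, 0 < ε n
  ℓ_pos : ∀ n, 0 < ℓ n
  sol : ∀ n, IsFourierSolution (ħ n) (ε n) w (c n)
  norm_eq : ∀ n t, ‖c n t‖ = 1
  tendsto_ratio : Tendsto (fun n => ħ n / ε n) atTop (𝓝 0)
  tendsto_ε : Tendsto ε atTop (𝓝 0)
  tendsto_length : Tendsto (fun n => (ℓ n * ε n)⁻¹) atTop (𝓝 0)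
  low : ∀ κ : ℝ, 0 < κ → ∃ δ : ℝ, 0 < δ ∧ ∀ᶠ n in atTop, ∀ t,
    ∑' j, {j | energy (ħ n) j ≤ δ}.indicator (fun j => ‖c n t j‖ ^ 2) j ≤ κ ^ 2

/-- The rescaled momentum in the direction `k`. -/
def zeta (ħ ε : ℝ) (k j : Freq) : ℝ := ħ * dot k j / ε

theorem zeta_add (ħ ε : ℝ) (k j l : Freq) : zeta ħ ε k (j + l) = zeta ħ ε k j + zeta ħ ε k l := by
  simp only [zeta, dot_add]; ring

/-- The function x/(δ² + x²) is a bounded Lipschitz substitute for 1/x. It serves to divide a symbol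
by the energy difference, which may vanish. -/
theorem rational_lipschitz {δ : ℝ} (hδ : 0 < δ) (x y : ℝ) :
    |x / (δ ^ 2 + x ^ 2) - y / (δ ^ 2 + y ^ 2)| ≤ |x - y| / δ ^ 2 := by
  have hx : 0 < δ ^ 2 + x ^ 2 := by positivity
  have hy : 0 < δ ^ 2 + y ^ 2 := by positivity
  have h : x / (δ ^ 2 + x ^ 2) - y / (δ ^ 2 + y ^ 2) =
      (x - y) * ((δ ^ 2 - x * y) / ((δ ^ 2 + x ^ 2) * (δ ^ 2 + y ^ 2))) := by
    field_simp; ring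
  rw [h, abs_mul, div_eq_mul_inv |x - y|]
  refine mul_le_mul_of_nonneg_left ?_ (abs_nonneg _)
  rw [abs_div, abs_of_pos (mul_pos hx hy), div_le_iff₀ (mul_pos hx hy), inv_mul_eq_div,
    le_div_iff₀ (by positivity)]
  have h1 : |δ ^ 2 - x * y| ≤ δ ^ 2 + (x ^ 2 + y ^ 2) / 2 := by
    rw [abs_le]
    constructor <;> nlinarith [sq_nonneg (x - y), sq_nonneg (x + y), sq_nonneg δ]
  have h2 := mul_le_mul_of_nonneg_right h1 (sq_nonneg δ)
  have h3 : 0 ≤ δ ^ 2 * x ^ 2 := by positivity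
  have h4 : 0 ≤ δ ^ 2 * y ^ 2 := by positivity
  have h5 : 0 ≤ x ^ 2 * y ^ 2 := by positivity
  nlinarith

theorem rational_bound {δ : ℝ} (hδ : 0 < δ) (x : ℝ) : |x / (δ ^ 2 + x ^ 2)| ≤ 1 / δ := by
  have hx : 0 < δ ^ 2 + x ^ 2 := by positivity
  rw [abs_div, abs_of_pos hx, div_le_div_iff₀ hx hδ]
  nlinarith [sq_nonneg (|x| - δ), sq_abs x, abs_nonneg x]

namespace Regime

variable {w : Freq → ℂ} {ħ ε a ℓ : ℕ → ℝ} {c : ℕ → ℝ → SeqL2}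

theorem tendsto_ħ (h : Regime w ħ ε a ℓ c) : Tendsto ħ atTop (𝓝 0) := by
  have := h.tendsto_ratio.mul h.tendsto_ε
  rw [mul_zero] at this
  exact this.congr fun n => div_mul_cancel₀ _ (h.ε_pos n).ne'

theorem tendsto_inv_length (h : Regime w ħ ε a ℓ c) :
    Tendsto (fun n => (ℓ n)⁻¹) atTop (𝓝 0) := by
  have := h.tendsto_length.mul h.tendsto_ε
  rw [mul_zero] at this
  refine this.congr fun n => ?_
  have := (h.ε_pos n).ne'
  have := (h.ℓ_pos n).ne'
  field_simp

set_option maxHeartbeats 1000000 in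
/-- Forms localized near the direction orthogonal to `k` have no asymptotic Fourier modes outside
of the line spanned by `k`. -/
theorem tendsto_transverse (h : Regime w ħ ε a ℓ c) {k m : Freq} (hkm : det k m ≠ 0)
    {f : ℝ → ℂ} {B K : ℝ} (hB : ∀ x, ‖f x‖ ≤ B) (hK : ∀ x y, ‖f x - f y‖ ≤ K * |x - y|)
    (hf : ∀ κ : ℝ, 0 < κ → ∃ Z, ∀ x, Z ≤ |x| → ‖f x‖ ≤ κ) :
    Tendsto (fun n => formAverage (a n) (ℓ n) (c n) (fun j => f (zeta (ħ n) (ε n) k j)) m)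
      atTop (𝓝 0) := by
  have hB0 : 0 ≤ B := (norm_nonneg _).trans (hB 0)
  have hK0 : 0 ≤ K := by
    have := (norm_nonneg _).trans (hK 1 0)
    simpa using this
  rw [Metric.tendsto_nhds]
  intro κ₀ hκ₀
  -- The final error is κ + Bκ from the remainder and κ from the main part; 3 + B leaves room for a
  -- strict inequality.
  set κ := κ₀ / (3 + B) with hκ
  have hκpos : 0 < κ := by positivity
  obtain ⟨δ₁, hδ₁, hlow⟩ := h.low κ hκpos
  obtain ⟨Z₀, hZ₀⟩ := hf κ hκpos
  set Z := max Z₀ 0 with hZ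
  obtain ⟨ρ, hρ, hgeo⟩ := exists_lower_bound hkm hδ₁
  -- With this δ, the remainder B δ²/(δ² + D²) is at most κ as soon as |D| ≥ ρ/2.
  obtain ⟨δ, hδ, hδκ⟩ : ∃ δ : ℝ, 0 < δ ∧ B * δ ^ 2 ≤ κ * (ρ / 2) ^ 2 := by
    refine ⟨Real.sqrt (κ * (ρ / 2) ^ 2 / (B + 1)), Real.sqrt_pos.mpr (by positivity), ?_⟩
    rw [Real.sq_sqrt (by positivity), ← mul_div_assoc, div_le_iff₀ (by positivity)]
    have : 0 ≤ κ * (ρ / 2) ^ 2 := by positivity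
    nlinarith
  set Mk := ∑' l, ‖w l‖ * |dot k l| with hMk
  set Mm := ∑' l, ‖w l‖ * |dot m l| with hMm
  have hlim : Tendsto (fun n => 2 * (B / δ) * (ℓ n)⁻¹ +
      (K / δ * Mk * ε n + B / δ ^ 2 * Mm * ε n ^ 2)) atTop (𝓝 0) := by
    have := (h.tendsto_inv_length.const_mul (2 * (B / δ))).add
      ((h.tendsto_ε.const_mul (K / δ * Mk)).add ((h.tendsto_ε.pow 2).const_mul (B / δ ^ 2 * Mm)))
    simpa using this
  have hsmall1 : ∀ᶠ n in atTop, ε n * Z ≤ ρ / 4 := by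
    have := h.tendsto_ε.mul_const Z
    rw [zero_mul] at this
    exact this.eventually_le_const (by positivity)
  have hsmall2 : ∀ᶠ n in atTop, ħ n * |dot m m / 2| ≤ ρ / 4 := by
    have := h.tendsto_ħ.mul_const |dot m m / 2|
    rw [zero_mul] at this
    exact this.eventually_le_const (by positivity)
  filter_upwards [hlow, hsmall1, hsmall2, hlim.eventually_le_const hκpos] with n hn1 hn2 hn3 hn4
  have hħ := h.ħ_pos n
  have hε := h.ε_pos n
  have hℓ := h.ℓ_pos n
  set F : Freq → ℂ := fun j => f (zeta (ħ n) (ε n) k j) with hF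
  set D : Freq → ℝ := fun j => ħ n * (dot m j - dot m m / 2) with hD
  set β : ℝ → ℝ := fun x => x / (δ ^ 2 + x ^ 2) with hβ
  -- The energy difference is 4π²ħ D, so that b times it is 4π²ħ F·Dβ(D), where Dβ(D) = D²/(δ² + D²)
  -- is close to 1 away from D = 0. The invariance of the averages applied to b controls the part
  -- F·Dβ(D) of F.
  set b : Freq → ℂ := fun j => F j * (β (D j) : ℂ) with hb
  have hDl : ∀ j l, D (j + l) - D j = ħ n * dot m l := fun j l => by
    simp only [hD, dot_add]; ring
  have hbB : ∀ j, ‖b j‖ ≤ B / δ := fun j => by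
    rw [hb, norm_mul, Complex.norm_real, Real.norm_eq_abs, div_eq_mul_one_div]
    exact mul_le_mul (hB _) (rational_bound hδ _) (abs_nonneg _) hB0
  have hDβ : ∀ x : ℝ, x * β x = x ^ 2 / (δ ^ 2 + x ^ 2) := fun x => by
    simp only [hβ]; ring
  have hDβ1 : ∀ x : ℝ, |x * β x| ≤ 1 := fun x => by
    rw [hDβ, abs_of_nonneg (by positivity), div_le_one (by positivity)]
    nlinarith [sq_nonneg δ]
  have hg : ∀ j, ‖F j * ((D j * β (D j) : ℝ) : ℂ)‖ ≤ B := fun j => by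
    rw [norm_mul, Complex.norm_real, Real.norm_eq_abs]
    exact (mul_le_mul (hB _) (hDβ1 _) (abs_nonneg _) hB0).trans (mul_one B).le
  have hbE : ∀ j, b j * ((energy (ħ n) j - energy (ħ n) (j - m) : ℝ) : ℂ) =
      ((4 * Real.pi ^ 2 * ħ n : ℝ) : ℂ) * (F j * ((D j * β (D j) : ℝ) : ℂ)) := fun j => by
    rw [energy_sub]
    simp only [hb, hD]
    push_cast
    ring
  have hcomm := norm_formAverage_commutator_le (a := a n) h.potential.toIsRealSummable (h.sol n) hħ hℓ
    (h.norm_eq n) hbB m (B' := 4 * Real.pi ^ 2 * ħ n * B) (fun j => by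
      rw [hbE, norm_mul, Complex.norm_real, Real.norm_eq_abs, abs_of_nonneg (by positivity)]
      exact mul_le_mul_of_nonneg_left (hg j) (by positivity))
  simp only [hbE, formAverage_smul] at hcomm
  set Q₁ := formAverage (a n) (ℓ n) (c n) (fun j => F j * ((D j * β (D j) : ℝ) : ℂ)) m with hQ₁
  have hdiff : ∀ l j, ‖b (j + l) - b j‖ ≤
      K / δ * (ħ n / ε n * |dot k l|) + B / δ ^ 2 * (ħ n * |dot m l|) := by
    intro l j
    have e : b (j + l) - b j = (F (j + l) - F j) * (β (D (j + l)) : ℂ) +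
        F j * ((β (D (j + l)) - β (D j) : ℝ) : ℂ) := by
      simp only [hb]; push_cast; ring
    have e1 : ‖F (j + l) - F j‖ ≤ K * (ħ n / ε n * |dot k l|) := by
      refine (hK _ _).trans (le_of_eq ?_)
      rw [zeta_add, add_sub_cancel_left, zeta, abs_div, abs_mul, abs_of_pos hħ, abs_of_pos hε]
      ring
    have e2 : |β (D (j + l))| ≤ 1 / δ := rational_bound hδ _
    have e3 : |β (D (j + l)) - β (D j)| ≤ ħ n * |dot m l| / δ ^ 2 := by
      refine (rational_lipschitz hδ _ _).trans (le_of_eq ?_)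
      rw [hDl, abs_mul, abs_of_pos hħ]
    rw [e]
    refine (norm_add_le _ _).trans ?_
    rw [norm_mul, norm_mul, Complex.norm_real, Complex.norm_real, Real.norm_eq_abs,
      Real.norm_eq_abs]
    refine add_le_add ?_ ?_
    · refine (mul_le_mul e1 e2 (abs_nonneg _) (by positivity)).trans (le_of_eq ?_)
      ring
    · refine (mul_le_mul (hB _) e3 (abs_nonneg _) hB0).trans (le_of_eq ?_)
      ring
  have hS : ‖∑' l, w l * formAverage (a n) (ℓ n) (c n) (fun j => b (j + l) - b j) (m - l)‖ ≤
      K / δ * (ħ n / ε n) * Mk + B / δ ^ 2 * ħ n * Mm := by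
    refine tsum_of_norm_bounded (g := fun l => K / δ * (ħ n / ε n) * (‖w l‖ * |dot k l|) +
      B / δ ^ 2 * ħ n * (‖w l‖ * |dot m l|)) ?_ fun l => ?_
    · exact ((h.potential.summable_dot k).hasSum.mul_left _).add
        ((h.potential.summable_dot m).hasSum.mul_left _)
    · rw [norm_mul]
      refine (mul_le_mul_of_nonneg_left (norm_formAverage_le hℓ (h.norm_eq n) (hdiff l) _)
        (norm_nonneg _)).trans (le_of_eq ?_)
      ring
  -- The boundary term and the potential term both contain a factor ħ: a shift of j by l moves ζ by
  -- O(ħ/ε) and D by O(ħ). It cancels the ħ of the energy difference, and what is left tends to 0.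
  have hQ₁le : ‖Q₁‖ ≤ κ := by
    refine le_trans ?_ hn4
    have h1 : ‖((4 * Real.pi ^ 2 * ħ n : ℝ) : ℂ) * Q₁‖ ≤ 2 * ħ n * (B / δ) / ℓ n +
        ε n ^ 2 * (K / δ * (ħ n / ε n) * Mk + B / δ ^ 2 * ħ n * Mm) := by
      have := norm_sub_le (((4 * Real.pi ^ 2 * ħ n : ℝ) : ℂ) * Q₁ + (ε n : ℂ) ^ 2 *
        ∑' l, w l * formAverage (a n) (ℓ n) (c n) (fun j => b (j + l) - b j) (m - l))
        ((ε n : ℂ) ^ 2 *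
        ∑' l, w l * formAverage (a n) (ℓ n) (c n) (fun j => b (j + l) - b j) (m - l))
      rw [add_sub_cancel_right] at this
      refine this.trans (add_le_add hcomm ?_)
      rw [norm_mul, norm_pow, Complex.norm_real, Real.norm_eq_abs, sq_abs]
      exact mul_le_mul_of_nonneg_left hS (sq_nonneg _)
    rw [norm_mul, Complex.norm_real, Real.norm_eq_abs, abs_of_nonneg (by positivity)] at h1
    have h2 : 2 * ħ n * (B / δ) / ℓ n +
        ε n ^ 2 * (K / δ * (ħ n / ε n) * Mk + B / δ ^ 2 * ħ n * Mm) =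
        ħ n * (2 * (B / δ) * (ℓ n)⁻¹ + (K / δ * Mk * ε n + B / δ ^ 2 * Mm * ε n ^ 2)) := by
      field_simp
    rw [h2] at h1
    have h3 : ħ n * ‖Q₁‖ ≤ 4 * Real.pi ^ 2 * ħ n * ‖Q₁‖ := by
      have : 1 ≤ 4 * Real.pi ^ 2 := by nlinarith [Real.pi_gt_three]
      nlinarith [mul_nonneg hħ.le (norm_nonneg Q₁)]
    exact le_of_mul_le_mul_left (h3.trans h1) hħ
  have hrem : ∀ j, ‖F j - F j * ((D j * β (D j) : ℝ) : ℂ)‖ ≤ 2 * B := fun j => by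
    linarith [norm_sub_le (F j) (F j * ((D j * β (D j) : ℝ) : ℂ)), hB (zeta (ħ n) (ε n) k j), hg j]
  have hremE : ∀ j, ‖F j - F j * ((D j * β (D j) : ℝ) : ℂ)‖ = ‖F j‖ * (δ ^ 2 / (δ ^ 2 + D j ^ 2)) := by
    intro j
    have e : F j - F j * ((D j * β (D j) : ℝ) : ℂ) = F j * ((δ ^ 2 / (δ ^ 2 + D j ^ 2) : ℝ) : ℂ) := by
      have : (δ ^ 2 / (δ ^ 2 + D j ^ 2) : ℝ) = 1 - D j * β (D j) := by
        rw [hDβ]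
        have : 0 < δ ^ 2 + D j ^ 2 := by positivity
        field_simp
        ring
      rw [this]; push_cast; ring
    rw [e, norm_mul, Complex.norm_real, Real.norm_eq_abs, abs_of_nonneg (by positivity)]
  have hrem' : ∀ j, ‖F j - F j * ((D j * β (D j) : ℝ) : ℂ)‖ ≤ B := fun j => by
    rw [hremE]
    have : δ ^ 2 / (δ ^ 2 + D j ^ 2) ≤ 1 := by
      rw [div_le_one (by positivity)]; nlinarith [sq_nonneg (D j)]
    exact (mul_le_mul (hB _) this (by positivity) hB0).trans (mul_one B).le
  -- Above the energy δ₁ there are two cases. Either |ζ| is large and f is small, or |ħ k·j| ≤ ρ/4,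
  -- and then |ħ m·j| ≥ 3ρ/4, so |D| ≥ ρ/2 after the correction by m·m/2.
  have hremκ : ∀ j ∉ {j | energy (ħ n) j ≤ δ₁},
      ‖F j - F j * ((D j * β (D j) : ℝ) : ℂ)‖ ≤ κ := by
    intro j hj
    simp only [Set.mem_ofPred_eq, not_le] at hj
    rw [hremE]
    by_cases hz : Z ≤ |zeta (ħ n) (ε n) k j|
    · have h1 : ‖F j‖ ≤ κ := hZ₀ _ ((le_max_left _ _).trans hz)
      have : δ ^ 2 / (δ ^ 2 + D j ^ 2) ≤ 1 := by
        rw [div_le_one (by positivity)]; nlinarith [sq_nonneg (D j)]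
      exact (mul_le_mul h1 this (by positivity) hκpos.le).trans (mul_one κ).le
    · push Not at hz
      have h1 : |ħ n * dot k j| ≤ ρ / 4 := by
        rw [zeta, abs_div, abs_of_pos hε, div_lt_iff₀ hε] at hz
        nlinarith
      have h2 := hgeo (ħ n) j hj
      have h3 : ρ / 2 ≤ |D j| := by
        have e : ħ n * dot m j = D j + ħ n * (dot m m / 2) := by simp only [hD]; ring
        have := abs_add_le (D j) (ħ n * (dot m m / 2))
        rw [← e, abs_mul (ħ n) (dot m m / 2), abs_of_pos hħ] at this
        linarith
      have h4 : (ρ / 2) ^ 2 ≤ D j ^ 2 := by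
        rw [← sq_abs (D j)]; gcongr
      have h5 : 0 < δ ^ 2 + D j ^ 2 := by positivity
      calc ‖F j‖ * (δ ^ 2 / (δ ^ 2 + D j ^ 2)) ≤ B * (δ ^ 2 / (δ ^ 2 + D j ^ 2)) := by
            gcongr; exact hB _
        _ = B * δ ^ 2 / (δ ^ 2 + D j ^ 2) := by ring
        _ ≤ κ := by
            rw [div_le_iff₀ h5]
            have : κ * (ρ / 2) ^ 2 ≤ κ * D j ^ 2 := by gcongr
            nlinarith [mul_nonneg hκpos.le (sq_nonneg δ)]
  have hQ₂ := norm_formAverage_le_of_concentrated (a := a n) hℓ (h.norm_eq n) hrem' hremκ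
    hκpos.le hκpos.le hn1 m
  rw [formAverage_sub (h.sol n).continuous (fun j => hB _) hg] at hQ₂
  rw [dist_zero_right]
  have h6 : ‖formAverage (a n) (ℓ n) (c n) F m‖ ≤ κ + B * κ + κ := by
    have := norm_add_le (formAverage (a n) (ℓ n) (c n) F m - Q₁) Q₁
    rw [sub_add_cancel] at this
    linarith
  have h7 : (3 + B) * κ = κ₀ := by
    rw [hκ]; field_simp
  calc ‖formAverage (a n) (ℓ n) (c n) F m‖ ≤ κ + B * κ + κ := h6
    _ < (3 + B) * κ := by linarith
    _ = κ₀ := h7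

set_option maxHeartbeats 1000000 in
/-- The asymptotic transport equation for the averaged forms. -/
theorem tendsto_invariance (h : Regime w ħ ε a ℓ c) (k : Freq) (p : ℤ)
    {f f' : ℝ → ℂ} {B B₁ B' C : ℝ} (hB : ∀ x, ‖f x‖ ≤ B) (hB₁ : ∀ x : ℝ, ‖(x : ℂ) * f x‖ ≤ B₁)
    (hB' : ∀ x, ‖f' x‖ ≤ B') (hT : ∀ x y : ℝ, ‖f (x + y) - f x - (y : ℂ) * f' x‖ ≤ C * y ^ 2) :
    Tendsto (fun n => (p : ℂ) * formAverage (a n) (ℓ n) (c n)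
        (fun j => (zeta (ħ n) (ε n) k j : ℂ) * f (zeta (ħ n) (ε n) k j)) (p • k) +
      ((4 * Real.pi ^ 2)⁻¹ : ℝ) * ∑' l, w l * (dot k l * formAverage (a n) (ℓ n) (c n)
        (fun j => f' (zeta (ħ n) (ε n) k j)) (p • k - l))) atTop (𝓝 0) := by
  have hB0 : 0 ≤ B := (norm_nonneg _).trans (hB 0)
  set M := ∑' l, ‖w l‖ * dot k l ^ 2 with hM
  set N : ℝ := |(p : ℝ) ^ 2 * dot k k / 2| with hN
  have hlim : Tendsto (fun n => 2 * B * (ℓ n * ε n)⁻¹ + (ħ n / ε n) * (N * B) +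
      (ħ n / ε n) * (C * M)) atTop (𝓝 0) := by
    have := ((h.tendsto_length.const_mul (2 * B)).add (h.tendsto_ratio.mul_const (N * B))).add
      (h.tendsto_ratio.mul_const (C * M))
    simpa using this
  refine squeeze_zero_norm (fun n => ?_) hlim
  have hħ := h.ħ_pos n
  have hε := h.ε_pos n
  have hℓ := h.ℓ_pos n
  set z : Freq → ℝ := zeta (ħ n) (ε n) k with hz
  set Q : (Freq → ℂ) → Freq → ℂ := formAverage (a n) (ℓ n) (c n) with hQ
  have hzd : ∀ j, ħ n * dot k j = ε n * z j := fun j => by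
    simp only [hz, zeta]; field_simp
  -- Along k the energy difference is 4π²ħε pζ up to a constant of order ħ². After division by ħε
  -- this constant is of order ħ/ε.
  have hbE : ∀ j, f (z j) * ((energy (ħ n) j - energy (ħ n) (j - p • k) : ℝ) : ℂ) =
      ((4 * Real.pi ^ 2 * ħ n * ε n * p : ℝ) : ℂ) * ((z j : ℂ) * f (z j)) -
      ((4 * Real.pi ^ 2 * ħ n ^ 2 * (p ^ 2 * dot k k / 2) : ℝ) : ℂ) * f (z j) := fun j => by
    have e : energy (ħ n) j - energy (ħ n) (j - p • k) =
        4 * Real.pi ^ 2 * ħ n * ε n * p * z j -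
          4 * Real.pi ^ 2 * ħ n ^ 2 * (p ^ 2 * dot k k / 2) := by
      rw [energy_sub, zsmul_dot, zsmul_dot, dot_zsmul]
      linear_combination (4 * Real.pi ^ 2 * ħ n * p) * hzd j
    rw [e]; push_cast; ring
  have hsm1 : ∀ (x : ℂ) j, ‖x * ((z j : ℂ) * f (z j))‖ ≤ ‖x‖ * B₁ := fun x j => by
    rw [norm_mul]; exact mul_le_mul_of_nonneg_left (hB₁ _) (norm_nonneg _)
  have hsm2 : ∀ (x : ℂ) j, ‖x * f (z j)‖ ≤ ‖x‖ * B := fun x j => by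
    rw [norm_mul]; exact mul_le_mul_of_nonneg_left (hB _) (norm_nonneg _)
  have hsm3 : ∀ (x : ℂ) j, ‖x * f' (z j)‖ ≤ ‖x‖ * B' := fun x j => by
    rw [norm_mul]; exact mul_le_mul_of_nonneg_left (hB' _) (norm_nonneg _)
  have hcomm := norm_formAverage_commutator_le (a := a n) h.potential.toIsRealSummable (h.sol n) hħ
    hℓ (h.norm_eq n) (b := fun j => f (z j)) (fun j => hB _) (p • k)
    (B' := ‖((4 * Real.pi ^ 2 * ħ n * ε n * p : ℝ) : ℂ)‖ * B₁ +
      ‖((4 * Real.pi ^ 2 * ħ n ^ 2 * (p ^ 2 * dot k k / 2) : ℝ) : ℂ)‖ * B) (fun j => by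
      rw [hbE]
      exact (norm_sub_le _ _).trans (add_le_add (hsm1 _ j) (hsm2 _ j)))
  simp only [hbE] at hcomm
  rw [formAverage_sub (h.sol n).continuous (hsm1 _) (hsm2 _), formAverage_smul,
    formAverage_smul] at hcomm
  set q : ℝ := ħ n / ε n with hq
  have hq0 : 0 < q := div_pos hħ hε
  have hzl : ∀ l, z l = q * dot k l := fun l => by simp only [hz, zeta, hq]; ring
  have hRb : ∀ l j, ‖f (z (j + l)) - f (z j) - ((q * dot k l : ℝ) : ℂ) * f' (z j)‖ ≤
      C * (q * dot k l) ^ 2 := fun l j => by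
    have := hT (z j) (z l)
    rw [← hzl, hz, zeta_add]
    exact this
  set R : Freq → ℂ := fun l =>
    Q (fun j => f (z (j + l)) - f (z j) - ((q * dot k l : ℝ) : ℂ) * f' (z j)) (p • k - l) with hR
  have hd : ∀ (l j : Freq), ‖f (z (j + l)) - f (z j)‖ ≤ B + B := fun l j =>
    (norm_sub_le _ _).trans (add_le_add (hB _) (hB _))
  -- Shifting j by l moves ζ by q (k·l). The difference of the symbol is thus its first order Taylor
  -- term plus a remainder of order q².
  have hQd : ∀ l, Q (fun j => f (z (j + l)) - f (z j)) (p • k - l) =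
      ((q * dot k l : ℝ) : ℂ) * Q (fun j => f' (z j)) (p • k - l) + R l := fun l => by
    simp only [hR, hQ]
    rw [formAverage_sub (h.sol n).continuous (hd l) (hsm3 _), formAverage_smul]
    ring
  have hRn : ∀ l, ‖w l * R l‖ ≤ C * q ^ 2 * (‖w l‖ * dot k l ^ 2) := fun l => by
    rw [norm_mul]
    refine (mul_le_mul_of_nonneg_left (norm_formAverage_le hℓ (h.norm_eq n) (hRb l) _)
      (norm_nonneg _)).trans (le_of_eq ?_)
    ring
  have hRs : Summable fun l => w l * R l :=
    Summable.of_norm_bounded ((h.potential.summable_dot_sq k).mul_left _) hRn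
  have hQf' : ∀ l, ‖w l * (dot k l * Q (fun j => f' (z j)) (p • k - l))‖ ≤
      B' * (‖w l‖ * |dot k l|) := fun l => by
    rw [norm_mul, norm_mul, Complex.norm_real, Real.norm_eq_abs]
    have := norm_formAverage_le (a := a n) hℓ (h.norm_eq n) (fun j => hB' (z j)) (p • k - l)
    calc ‖w l‖ * (|dot k l| * _) ≤ ‖w l‖ * (|dot k l| * B') := by gcongr
      _ = _ := by ring
  have hQs : Summable fun l => w l * (dot k l * Q (fun j => f' (z j)) (p • k - l)) :=
    Summable.of_norm_bounded ((h.potential.summable_dot k).mul_left _) hQf'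
  have hsum : ∑' l, w l * Q (fun j => f (z (j + l)) - f (z j)) (p • k - l) =
      q * ∑' l, w l * (dot k l * Q (fun j => f' (z j)) (p • k - l)) + ∑' l, w l * R l := by
    rw [← tsum_mul_left, ← (hQs.mul_left _).tsum_add hRs]
    refine tsum_congr fun l => ?_
    rw [hQd]; push_cast; ring
  rw [hsum] at hcomm
  set S := ∑' l, w l * (dot k l * Q (fun j => f' (z j)) (p • k - l)) with hS
  have hRle : ‖∑' l, w l * R l‖ ≤ C * q ^ 2 * M :=
    tsum_of_norm_bounded ((h.potential.summable_dot_sq k).hasSum.mul_left _) hRn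
  set Rs := ∑' l, w l * R l with hRsd
  set Q₁ := Q (fun j => (z j : ℂ) * f (z j)) (p • k) with hQ₁
  set Q₂ := Q (fun j => f (z j)) (p • k) with hQ₂
  have hQ₂le : ‖Q₂‖ ≤ B := norm_formAverage_le hℓ (h.norm_eq n) (fun j => hB _) _
  have hħc : (ħ n : ℂ) ≠ 0 := by exact_mod_cast hħ.ne'
  have hεc : (ε n : ℂ) ≠ 0 := by exact_mod_cast hε.ne'
  have hπc : (Real.pi : ℂ) ≠ 0 := by exact_mod_cast Real.pi_ne_zero
  set X := ((4 * Real.pi ^ 2 * ħ n * ε n * p : ℝ) : ℂ) * Q₁ -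
      ((4 * Real.pi ^ 2 * ħ n ^ 2 * (p ^ 2 * dot k k / 2) : ℝ) : ℂ) * Q₂ +
      (ε n : ℂ) ^ 2 * (q * S + Rs) with hX
  -- Division of the commutator identity by 4π²ħε. The boundary term becomes O(1/(ℓε)), the constant
  -- in the energy difference O(ħ/ε), and the Taylor remainder O(q²/q) = O(ħ/ε): these are exactly
  -- the quantities assumed to vanish in the limit.
  have hid : (p : ℂ) * Q₁ + ((4 * Real.pi ^ 2)⁻¹ : ℝ) * S =
      ((4 * Real.pi ^ 2 * ħ n * ε n)⁻¹ : ℝ) * X + ((q * (p ^ 2 * dot k k / 2) : ℝ) : ℂ) * Q₂ -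
        (((4 * Real.pi ^ 2)⁻¹ * q⁻¹ : ℝ) : ℂ) * Rs := by
    simp only [hX, hq]
    push_cast
    field_simp
    ring
  have hπ1 : (4 * Real.pi ^ 2)⁻¹ ≤ 1 :=
    inv_le_one_of_one_le₀ (by nlinarith [Real.pi_gt_three])
  have hπ0 : 0 < (4 * Real.pi ^ 2)⁻¹ := by positivity
  have n1 : ‖(((4 * Real.pi ^ 2 * ħ n * ε n)⁻¹ : ℝ) : ℂ) * X‖ ≤ 2 * B * (ℓ n * ε n)⁻¹ := by
    rw [norm_mul, Complex.norm_real, Real.norm_eq_abs, abs_of_pos (by positivity)]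
    calc (4 * Real.pi ^ 2 * ħ n * ε n)⁻¹ * ‖X‖ ≤
          (4 * Real.pi ^ 2 * ħ n * ε n)⁻¹ * (2 * ħ n * B / ℓ n) := by gcongr
      _ = (4 * Real.pi ^ 2)⁻¹ * (2 * B * (ℓ n * ε n)⁻¹) := by field_simp
      _ ≤ 1 * (2 * B * (ℓ n * ε n)⁻¹) := by gcongr
      _ = _ := one_mul _
  have n2 : ‖((q * (p ^ 2 * dot k k / 2) : ℝ) : ℂ) * Q₂‖ ≤ q * (N * B) := by
    rw [norm_mul, Complex.norm_real, Real.norm_eq_abs, abs_mul, abs_of_pos hq0, mul_assoc]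
    gcongr
  have n3 : ‖(((4 * Real.pi ^ 2)⁻¹ * q⁻¹ : ℝ) : ℂ) * Rs‖ ≤ q * (C * M) := by
    rw [norm_mul, Complex.norm_real, Real.norm_eq_abs, abs_of_pos (by positivity)]
    have h0 : 0 ≤ C * q ^ 2 * M := (norm_nonneg _).trans hRle
    calc (4 * Real.pi ^ 2)⁻¹ * q⁻¹ * ‖Rs‖ ≤ 1 * q⁻¹ * (C * q ^ 2 * M) := by gcongr
      _ = _ := by field_simp
  rw [hid]
  exact (norm_sub_le _ _).trans (add_le_add ((norm_add_le _ _).trans (add_le_add n1 n2)) n3)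

theorem formAverage_nonneg {a ℓ : ℝ} {c : ℝ → SeqL2} (hℓ : 0 < ℓ) (hc : Continuous c)
    {b : Freq → ℝ} {B : ℝ} (hb : ∀ j, ‖(b j : ℂ)‖ ≤ B) (hb0 : ∀ j, 0 ≤ b j) :
    0 ≤ (formAverage a ℓ c (fun j => (b j : ℂ)) 0).re := by
  have hre : ∀ t, 0 ≤ (form (fun j => (b j : ℂ)) 0 (c t) (c t)).re := fun t => by
    refine (Complex.hasSum_re (summable_form hb 0 (c t) (c t)).hasSum).nonneg fun j => ?_
    rw [sub_zero, Complex.mul_conj, ← Complex.ofReal_mul, Complex.ofReal_re]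
    exact mul_nonneg (hb0 j) (Complex.normSq_nonneg _)
  rw [formAverage, ← Complex.ofReal_inv, Complex.re_ofReal_mul]
  refine mul_nonneg (inv_nonneg.mpr hℓ.le) ?_
  have := Complex.reCLM.intervalIntegral_comp_comm (intervalIntegrable_form hc hb 0 a (a + ℓ))
  simp only [Complex.reCLM_apply] at this
  rw [← this]
  exact intervalIntegral.integral_nonneg (by linarith) fun t _ => hre t

set_option maxHeartbeats 1000000 in
/-- Localizations near distinct directions are asymptotically disjoint. -/
theorem eventually_sum_le (h : Regime w ħ ε a ℓ c) (F : Finset Freq)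
    (hF : ∀ k ∈ F, ∀ k' ∈ F, k ≠ k' → det k k' ≠ 0) {r : ℝ} (hr : 0 < r) {κ₀ : ℝ} (hκ₀ : 0 < κ₀) :
    ∀ᶠ n in atTop, ∑ k ∈ F, (formAverage (a n) (ℓ n) (c n)
      (fun j => ((r / (r + zeta (ħ n) (ε n) k j ^ 2) : ℝ) : ℂ)) 0).re ≤ 1 + κ₀ := by
  classical
  set N : ℝ := (F.card : ℝ) with hN
  have hN0 : 0 ≤ N := Nat.cast_nonneg _
  -- The excess over 1 costs κ outside low energies and Nκ on them.
  set κ := κ₀ / (1 + N) with hκ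
  have hκpos : 0 < κ := by positivity
  obtain ⟨δ, hδ, hlow⟩ := h.low κ hκpos
  obtain ⟨ρ, hρgeo, hρ⟩ : ∃ ρ : ℝ, (∀ k ∈ F, ∀ k' ∈ F, k ≠ k' → ∀ (ħ : ℝ) (j : Freq),
      δ < energy ħ j → ρ ≤ |ħ * dot k j| + |ħ * dot k' j|) ∧ 0 < ρ := by
    have : ∀ᶠ ρ in 𝓝[>] (0 : ℝ), ∀ k ∈ F, ∀ k' ∈ F, k ≠ k' → ∀ (ħ : ℝ) (j : Freq),
        δ < energy ħ j → ρ ≤ |ħ * dot k j| + |ħ * dot k' j| := by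
      rw [Filter.eventually_all_finset]
      intro k hk
      rw [Filter.eventually_all_finset]
      intro k' hk'
      by_cases hne : k = k'
      · simp [hne]
      obtain ⟨ρ, hρ, hρ'⟩ := exists_lower_bound (hF k hk k' hk' hne) hδ
      filter_upwards [Ioo_mem_nhdsGT hρ] with x hx _ ħ j hj
      exact hx.2.le.trans (hρ' ħ j hj)
    exact (this.and self_mem_nhdsWithin).exists
  have hsmall : ∀ᶠ n in atTop, N * (r * (2 * ε n / ρ) ^ 2) ≤ κ := by
    have : Tendsto (fun n => N * (r * (2 * ε n / ρ) ^ 2)) atTop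
        (𝓝 (N * (r * (2 * 0 / ρ) ^ 2))) :=
      ((((h.tendsto_ε.const_mul 2).div_const ρ).pow 2).const_mul r).const_mul N
    refine this.eventually_le_const ?_
    simpa using hκpos
  filter_upwards [hlow, hsmall] with n hn1 hn2
  have hε := h.ε_pos n
  have hℓ := h.ℓ_pos n
  set χ : Freq → Freq → ℝ := fun k j => r / (r + zeta (ħ n) (ε n) k j ^ 2) with hχ
  have hχ0 : ∀ k j, 0 ≤ χ k j := fun k j => by positivity
  have hχ1 : ∀ k j, χ k j ≤ 1 := fun k j => by
    rw [hχ, div_le_one (by positivity)]; nlinarith [sq_nonneg (zeta (ħ n) (ε n) k j)]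
  have hχn : ∀ k j, ‖(χ k j : ℂ)‖ ≤ 1 := fun k j => by
    rw [Complex.norm_real, Real.norm_eq_abs, abs_of_nonneg (hχ0 k j)]; exact hχ1 k j
  set b : Freq → ℝ := fun j => ∑ k ∈ F, χ k j with hb
  have hb0 : ∀ j, 0 ≤ b j := fun j => Finset.sum_nonneg fun k _ => hχ0 k j
  have hbN : ∀ j, b j ≤ N := fun j => by
    refine (Finset.sum_le_card_nsmul F _ 1 fun k _ => hχ1 k j).trans ?_
    simp [hN]
  have hbn : ∀ j, ‖(b j : ℂ)‖ ≤ N := fun j => by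
    rw [Complex.norm_real, Real.norm_eq_abs, abs_of_nonneg (hb0 j)]; exact hbN j
  have hQsum : ∑ k ∈ F, (formAverage (a n) (ℓ n) (c n) (fun j => (χ k j : ℂ)) 0).re =
      (formAverage (a n) (ℓ n) (c n) (fun j => (b j : ℂ)) 0).re := by
    have : ∀ G : Finset Freq, ∑ k ∈ G, formAverage (a n) (ℓ n) (c n) (fun j => (χ k j : ℂ)) 0 =
        formAverage (a n) (ℓ n) (c n) (fun j => ((∑ k ∈ G, χ k j : ℝ) : ℂ)) 0 := by
      intro G
      induction G using Finset.induction_on with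
      | empty => simp [formAverage, form]
      | insert k G hk ih =>
        rw [Finset.sum_insert hk, ih, ← formAverage_add (h.sol n).continuous (hχn k)
          (B' := (G.card : ℝ)) (fun j => by
            rw [Complex.norm_real, Real.norm_eq_abs,
              abs_of_nonneg (Finset.sum_nonneg fun k _ => hχ0 k j)]
            refine (Finset.sum_le_card_nsmul G _ 1 fun k _ => hχ1 k j).trans ?_
            simp)]
        congr 1
        funext j
        rw [Finset.sum_insert hk]
        push_cast
        rfl
    rw [← Complex.re_sum, this F]
  change ∑ k ∈ F, (formAverage (a n) (ℓ n) (c n) (fun j => (χ k j : ℂ)) 0).re ≤ _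
  rw [hQsum]
  -- The excess of the sum of cutoffs over 1. By `exists_lower_bound`, at energies above δ at most
  -- one k has |ħ k·j| < ρ/2, so at most one cutoff is not tiny and the excess is small there. The
  -- claim then follows from the positivity of 1 + e - b.
  set e : Freq → ℝ := fun j => max (b j - 1) 0 with he
  have he0 : ∀ j, 0 ≤ e j := fun j => le_max_right _ _
  have heN : ∀ j, ‖(e j : ℂ)‖ ≤ N := fun j => by
    rw [Complex.norm_real, Real.norm_eq_abs, abs_of_nonneg (he0 j)]
    exact max_le (by linarith [hbN j]) hN0
  have heκ : ∀ j ∉ {j | energy (ħ n) j ≤ δ}, ‖(e j : ℂ)‖ ≤ κ := by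
    intro j hj
    simp only [Set.mem_ofPred_eq, not_le] at hj
    rw [Complex.norm_real, Real.norm_eq_abs, abs_of_nonneg (he0 j)]
    refine max_le ?_ hκpos.le
    -- A macroscopic value of ħ k·j means |ζ| ≥ ρ/(2ε), which tends to infinity.
    have hfar : ∀ k, ρ / 2 ≤ |ħ n * dot k j| → χ k j ≤ r * (2 * ε n / ρ) ^ 2 := by
      intro k hk
      have h1 : ρ / (2 * ε n) ≤ |zeta (ħ n) (ε n) k j| := by
        rw [zeta, abs_div, abs_of_pos hε, ← div_div]
        gcongr
      have h2 : (ρ / (2 * ε n)) ^ 2 ≤ zeta (ħ n) (ε n) k j ^ 2 := by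
        rw [← sq_abs (zeta _ _ _ _)]; gcongr
      calc χ k j ≤ r / (ρ / (2 * ε n)) ^ 2 := by
            simp only [hχ]; gcongr; linarith
        _ = _ := by field_simp
    obtain ⟨k₀, hk₀⟩ : ∃ k₀, ∀ k ∈ F, k ≠ k₀ → ρ / 2 ≤ |ħ n * dot k j| := by
      by_cases hex : ∃ k₀ ∈ F, |ħ n * dot k₀ j| < ρ / 2
      · obtain ⟨k₀, hk₀, hlt⟩ := hex
        refine ⟨k₀, fun k hk hne => ?_⟩
        have := hρgeo k hk k₀ hk₀ hne (ħ n) j hj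
        linarith
      · push Not at hex
        -- Here every direction is far, and any value of k₀ would do.
        exact ⟨0, fun k hk _ => hex k hk⟩
    have hs0 : 0 ≤ r * (2 * ε n / ρ) ^ 2 := by positivity
    have hbj : b j ≤ ∑ k ∈ F, ((if k = k₀ then 1 else 0) + r * (2 * ε n / ρ) ^ 2) := by
      refine Finset.sum_le_sum fun k hk => ?_
      split_ifs with hkk
      · linarith [hχ1 k j]
      · linarith [hfar k (hk₀ k hk hkk)]
    rw [Finset.sum_add_distrib, Finset.sum_const, nsmul_eq_mul, Finset.sum_ite_eq'] at hbj
    have : (if k₀ ∈ F then (1 : ℝ) else 0) ≤ 1 := by split_ifs <;> norm_num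
    linarith
  have hQe := norm_formAverage_le_of_concentrated (a := a n) hℓ (h.norm_eq n) heN heκ hκpos.le
    hκpos.le hn1 0
  have hpos : ∀ j, 0 ≤ 1 + e j - b j := fun j => by
    have : b j - 1 ≤ e j := le_max_left _ _
    linarith
  have h1e : ∀ j, ‖(1 + e j : ℂ)‖ ≤ 1 + N := fun j => by
    refine (norm_add_le _ _).trans ?_
    rw [norm_one]
    linarith [heN j]
  have hposn : ∀ j, ‖((1 + e j - b j : ℝ) : ℂ)‖ ≤ 1 + N + N := fun j => by
    push_cast
    exact (norm_sub_le _ _).trans (add_le_add (h1e j) (hbn j))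
  have hfin := formAverage_nonneg (a := a n) hℓ (h.sol n).continuous hposn hpos
  push_cast at hfin
  rw [formAverage_sub (h.sol n).continuous h1e hbn, formAverage_add (h.sol n).continuous
    (B := 1) (fun _ => by simp) heN, formAverage_one_zero hℓ (h.norm_eq n), Complex.sub_re,
    Complex.add_re, Complex.one_re] at hfin
  have h3 := Complex.re_le_norm (formAverage (a n) (ℓ n) (c n) (fun j => (e j : ℂ)) 0)
  have h4 : (1 + N) * κ = κ₀ := by rw [hκ]; field_simp
  linarith

end Regime

/-! ### Limits of positive functionals -/

/-- Positivity and normalization give |T n f| ≤ ‖f‖, so limits along the ultrafilter exist for all f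
at once, with no diagonal extraction. Linearity and positivity pass to the limit, and the
Riesz–Markov–Kakutani theorem represents it by a measure. -/
theorem exists_limit_measure {X : Type*} [TopologicalSpace X] [CompactSpace X] [T2Space X]
    [MeasurableSpace X] [BorelSpace X] (U : Ultrafilter ℕ) (T : ℕ → C(X, ℝ) →ₗ[ℝ] ℝ)
    (hpos : ∀ n (f : C(X, ℝ)), (∀ x, 0 ≤ f x) → 0 ≤ T n f) (hone : ∀ n, T n 1 = 1) :
    ∃ μ : Measure X, IsFiniteMeasure μ ∧
      ∀ f : C(X, ℝ), Tendsto (fun n => T n f) U (𝓝 (∫ x, f x ∂μ)) := by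
  have hbound : ∀ n (f : C(X, ℝ)), T n f ∈ Set.Icc (-‖f‖) ‖f‖ := by
    intro n f
    have h1 := hpos n (‖f‖ • 1 - f) (fun x => by
      simpa using (abs_le.mp (f.norm_coe_le_norm x)).2)
    have h2 := hpos n (‖f‖ • 1 + f) (fun x => by
      have := (abs_le.mp (f.norm_coe_le_norm x)).1
      simp only [ContinuousMap.add_apply, ContinuousMap.smul_apply, ContinuousMap.one_apply,
        smul_eq_mul, mul_one]
      linarith)
    rw [map_sub, map_smul, hone, smul_eq_mul, mul_one] at h1
    rw [map_add, map_smul, hone, smul_eq_mul, mul_one] at h2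
    constructor <;> linarith
  have hlim : ∀ f : C(X, ℝ), ∃ y, Tendsto (fun n => T n f) U (𝓝 y) := by
    intro f
    obtain ⟨y, -, hy⟩ := (isCompact_Icc (a := -‖f‖) (b := ‖f‖)).ultrafilter_le_nhds
      (U.map fun n => T n f) (by
        rw [Filter.le_principal_iff]
        exact Filter.mem_map.mpr (Filter.univ_mem' fun n => hbound n f))
    exact ⟨y, hy⟩
  choose Λ hΛ using hlim
  let Λl : C(X, ℝ) →ₗ[ℝ] ℝ :=
    { toFun := Λ
      map_add' := fun f g => tendsto_nhds_unique (hΛ (f + g)) (by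
        simpa only [map_add] using (hΛ f).add (hΛ g))
      map_smul' := fun r f => tendsto_nhds_unique (hΛ (r • f)) (by
        simpa only [map_smul, RingHom.id_apply] using (hΛ f).const_smul r) }
  have hΛpos : ∀ f : C(X, ℝ), (∀ x, 0 ≤ f x) → 0 ≤ Λl f := fun f hf =>
    ge_of_tendsto' (hΛ f) fun n => hpos n f hf
  let Λc : CompactlySupportedContinuousMap X ℝ →ₗ[ℝ] ℝ :=
    { toFun := fun f => Λl f.toContinuousMap
      map_add' := fun f g => Λl.map_add f.toContinuousMap g.toContinuousMap
      map_smul' := fun r f => Λl.map_smul r f.toContinuousMap }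
  let Λp : CompactlySupportedContinuousMap X ℝ →ₚ[ℝ] ℝ :=
    PositiveLinearMap.mk₀ Λc fun f hf => hΛpos _ hf
  refine ⟨RealRMK.rieszMeasure Λp, inferInstance, fun f => ?_⟩
  have := RealRMK.integral_rieszMeasure Λp (CompactlySupportedContinuousMap.continuousMapEquiv f)
  have h2 : ∫ x, f x ∂(RealRMK.rieszMeasure Λp) = Λ f := this
  rw [h2]
  exact hΛ f

/-! ### Phase space distributions in a rational direction -/

/-- The phase space: positions transverse to the direction and a compactification of the squared
rescaled momentum. -/
abbrev Phase : Type := UnitAddCircle × unitInterval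

/-- Partial Fourier coefficients of a function on phase space. -/
def partialFourier (f : C(Phase, ℂ)) (p : ℤ) (s : unitInterval) : ℂ :=
  ∫ y, fourier (-p) y * f (y, s) ∂AddCircle.haarAddCircle

theorem integrable_circle (g : UnitAddCircle → ℂ) (hg : Continuous g) :
    Integrable g AddCircle.haarAddCircle :=
  hg.integrable_of_hasCompactSupport (HasCompactSupport.of_compactSpace g)

theorem integral_fourier (n : ℤ) :
    ∫ y : UnitAddCircle, fourier n y ∂AddCircle.haarAddCircle = if n = 0 then 1 else 0 := by
  have := orthonormal_iff_ite.mp (orthonormal_fourier (T := 1)) 0 n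
  simp only [ContinuousMap.inner_toLp] at this
  simpa [eq_comm] using this

theorem norm_fourier_apply (n : ℤ) (y : UnitAddCircle) : ‖(fourier n y : ℂ)‖ = 1 := by
  rw [fourier_apply]; exact Circle.norm_coe _

theorem norm_partialFourier_le (f : C(Phase, ℂ)) (p : ℤ) (s : unitInterval) :
    ‖partialFourier f p s‖ ≤ ‖f‖ := by
  have := norm_integral_le_of_norm_le_const (μ := (AddCircle.haarAddCircle : Measure UnitAddCircle))
    (f := fun y => (fourier (-p) y : ℂ) * f (y, s)) (C := ‖f‖) (Eventually.of_forall fun y => by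
      rw [norm_mul, norm_fourier_apply, one_mul]; exact f.norm_coe_le_norm _)
  rwa [probReal_univ, mul_one] at this

theorem partialFourier_add (f g : C(Phase, ℂ)) (p : ℤ) (s : unitInterval) :
    partialFourier (f + g) p s = partialFourier f p s + partialFourier g p s := by
  simp only [partialFourier, ContinuousMap.add_apply, mul_add]
  exact integral_add (integrable_circle _ (by fun_prop)) (integrable_circle _ (by fun_prop))

theorem partialFourier_smul (z : ℂ) (f : C(Phase, ℂ)) (p : ℤ) (s : unitInterval) :
    partialFourier (z • f) p s = z * partialFourier f p s := by
  simp only [partialFourier, ContinuousMap.smul_apply, smul_eq_mul]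
  rw [← integral_const_mul]
  exact integral_congr_ae (Eventually.of_forall fun y => by ring)

/-- The phase space distribution of a curve in `ℓ²`, with a window of length `L` in the direction
`k`. -/
def husimi (a ℓ : ℝ) (c : ℝ → SeqL2) (k : Freq) (σ : Freq → unitInterval) (L : ℕ)
    (f : C(Phase, ℂ)) : ℂ :=
  (L : ℂ)⁻¹ * ∑ x ∈ Finset.range L, ∑ y ∈ Finset.range L, formAverage a ℓ c
    (fun j => partialFourier f ((y : ℤ) - x) (σ (j - (x : ℤ) • k))) (((x : ℤ) - y) • k)

/-- A real function on phase space as a complex one. -/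
def complexify (f : C(Phase, ℝ)) : C(Phase, ℂ) := ⟨fun x => (f x : ℂ), by fun_prop⟩

/-- This is the source of positivity. Inserting the integral that defines the partial Fourier
coefficients turns the double sum over a window of frequencies into the integral of f against the
square of a trigonometric polynomial. The averaged forms alone do not depend positively on the phase
space symbol. -/
theorem quadratic_eq (f : C(Phase, ℝ)) (s : unitInterval) (L : ℕ) (v : ℕ → ℂ) :
    ∑ x ∈ Finset.range L, ∑ y ∈ Finset.range L,
      partialFourier (complexify f) ((y : ℤ) - x) s * (v x * conj (v y)) =
    ((∫ t, f (t, s) * Complex.normSq (∑ x ∈ Finset.range L, v x * fourier (x : ℤ) t)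
      ∂(AddCircle.haarAddCircle : Measure UnitAddCircle) : ℝ) : ℂ) := by
  have h1 : ∀ t : UnitAddCircle, ((f (t, s) *
      Complex.normSq (∑ x ∈ Finset.range L, v x * fourier (x : ℤ) t) : ℝ) : ℂ) =
      ∑ x ∈ Finset.range L, ∑ y ∈ Finset.range L,
        (fourier (-((y : ℤ) - x)) t * complexify f (t, s)) * (v x * conj (v y)) := by
    intro t
    push_cast
    rw [← Complex.mul_conj, map_sum, Finset.sum_mul_sum, Finset.mul_sum]
    refine Finset.sum_congr rfl fun x _ => ?_
    rw [Finset.mul_sum]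
    refine Finset.sum_congr rfl fun y _ => ?_
    rw [neg_sub, sub_eq_add_neg, fourier_add, fourier_neg, map_mul]
    simp only [complexify, ContinuousMap.coe_mk]
    ring
  rw [← integral_complex_ofReal]
  simp only [h1]
  rw [integral_finsetSum _ fun x _ => integrable_circle _ (by fun_prop)]
  refine Finset.sum_congr rfl fun x _ => ?_
  rw [integral_finsetSum _ fun y _ => integrable_circle _ (by fun_prop)]
  refine Finset.sum_congr rfl fun y _ => ?_
  rw [integral_mul_const]
  rfl

section Husimi

variable {a ℓ : ℝ} {c : ℝ → SeqL2} {k : Freq} {σ : Freq → unitInterval} {L : ℕ}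

/-- At each time, the phase space distribution is a sum of integrals of squares. -/
theorem hasSum_husimi_form (d : SeqL2) (f : C(Phase, ℝ)) :
    HasSum (fun j => ((∫ t, f (t, σ j) * Complex.normSq (∑ x ∈ Finset.range L,
        d (j + (x : ℤ) • k) * fourier (x : ℤ) t)
        ∂(AddCircle.haarAddCircle : Measure UnitAddCircle) : ℝ) : ℂ))
      (∑ x ∈ Finset.range L, ∑ y ∈ Finset.range L,
        form (fun j => partialFourier (complexify f) ((y : ℤ) - x) (σ (j - (x : ℤ) • k)))
          (((x : ℤ) - y) • k) d d) := by
  have h1 : ∀ x y : ℕ, HasSum (fun j => partialFourier (complexify f) ((y : ℤ) - x) (σ j) *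
      (d (j + (x : ℤ) • k) * conj (d (j + (y : ℤ) • k))))
      (form (fun j => partialFourier (complexify f) ((y : ℤ) - x) (σ (j - (x : ℤ) • k)))
          (((x : ℤ) - y) • k) d d) := by
    intro x y
    have := (summable_form (b := fun j => partialFourier (complexify f) ((y : ℤ) - x)
      (σ (j - (x : ℤ) • k))) (fun j => norm_partialFourier_le _ _ _) (((x : ℤ) - y) • k) d d).hasSum
    -- After this translation all pairs (x, y) evaluate the symbol at the same point σ j, as
    -- required to recognize a square.
    rw [← (Equiv.addRight ((x : ℤ) • k)).hasSum_iff] at this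
    refine this.congr_fun fun j => ?_
    simp only [Function.comp_apply, Equiv.coe_addRight, add_sub_cancel_right]
    have e : j + (x : ℤ) • k - ((x : ℤ) - y) • k = j + (y : ℤ) • k := by
      rw [sub_smul]; abel
    rw [e]
  have h2 := hasSum_sum (s := Finset.range L) fun x _ => hasSum_sum (s := Finset.range L)
    fun y _ => h1 x y
  refine h2.congr_fun fun j => ?_
  rw [← quadratic_eq]

theorem intervalIntegrable_husimi (hc : Continuous c) (f : C(Phase, ℂ)) (x y : ℕ) (s t : ℝ) :
    IntervalIntegrable (fun r => form (fun j => partialFourier f ((y : ℤ) - x)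
      (σ (j - (x : ℤ) • k))) (((x : ℤ) - y) • k) (c r) (c r)) volume s t :=
  intervalIntegrable_form hc (fun _ => norm_partialFourier_le f _ _) _ _ _

theorem husimi_eq (hc : Continuous c) (f : C(Phase, ℂ)) : husimi a ℓ c k σ L f =
    (L : ℂ)⁻¹ * ((ℓ : ℂ)⁻¹ * ∫ r in a..(a + ℓ), ∑ x ∈ Finset.range L, ∑ y ∈ Finset.range L,
      form (fun j => partialFourier f ((y : ℤ) - x) (σ (j - (x : ℤ) • k)))
        (((x : ℤ) - y) • k) (c r) (c r)) := by
  rw [husimi]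
  congr 1
  have hi := fun x y => intervalIntegrable_husimi (k := k) (σ := σ) hc f x y a (a + ℓ)
  rw [intervalIntegral.integral_finsetSum (fun x _ => ?_), Finset.mul_sum]
  · refine Finset.sum_congr rfl fun x _ => ?_
    rw [intervalIntegral.integral_finsetSum (fun y _ => hi x y), Finset.mul_sum]
    rfl
  · have := IntervalIntegrable.sum (Finset.range L) fun y _ => hi x y
    simpa only [Finset.sum_fn] using this

theorem husimi_real (hc : Continuous c) (hℓ : 0 < ℓ) (f : C(Phase, ℝ)) :
    (husimi a ℓ c k σ L (complexify f)).im = 0 ∧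
      ((∀ x, 0 ≤ f x) → 0 ≤ (husimi a ℓ c k σ L (complexify f)).re) := by
  set G : ℝ → ℂ := fun r => ∑ x ∈ Finset.range L, ∑ y ∈ Finset.range L,
      form (fun j => partialFourier (complexify f) ((y : ℤ) - x) (σ (j - (x : ℤ) • k)))
        (((x : ℤ) - y) • k) (c r) (c r) with hG
  have hGi : IntervalIntegrable G volume a (a + ℓ) := by
    have := IntervalIntegrable.sum (Finset.range L) fun x _ =>
      IntervalIntegrable.sum (Finset.range L) fun y _ =>
        intervalIntegrable_husimi (k := k) (σ := σ) hc (complexify f) x y a (a + ℓ)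
    simpa only [Finset.sum_fn] using this
  have hsum := fun r => hasSum_husimi_form (L := L) (k := k) (σ := σ) (c r) f
  have him : ∀ r, (G r).im = 0 := fun r =>
    (Complex.hasSum_im (hsum r)).unique (by simp [hasSum_zero])
  have hGre : ∀ r, G r = ((G r).re : ℂ) := fun r => Complex.ext rfl (by simpa using him r)
  have hint : ∫ r in a..(a + ℓ), G r = ((∫ r in a..(a + ℓ), (G r).re : ℝ) : ℂ) := by
    rw [← intervalIntegral.integral_ofReal]
    exact intervalIntegral.integral_congr fun r _ => hGre r
  have hval : husimi a ℓ c k σ L (complexify f) =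
      (((L : ℝ)⁻¹ * (ℓ⁻¹ * ∫ r in a..(a + ℓ), (G r).re) : ℝ) : ℂ) := by
    rw [husimi_eq hc, hint]; push_cast; rfl
  rw [hval]
  refine ⟨Complex.ofReal_im _, fun hf => ?_⟩
  rw [Complex.ofReal_re]
  refine mul_nonneg (by positivity) (mul_nonneg (inv_nonneg.mpr hℓ.le) ?_)
  refine intervalIntegral.integral_nonneg (by linarith) fun r _ => ?_
  refine (Complex.hasSum_re (hsum r)).nonneg fun j => ?_
  rw [Complex.ofReal_re]
  exact integral_nonneg fun t => mul_nonneg (hf _) (Complex.normSq_nonneg _)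

theorem husimi_add (hc : Continuous c) (f g : C(Phase, ℂ)) : husimi a ℓ c k σ L (f + g) =
    husimi a ℓ c k σ L f + husimi a ℓ c k σ L g := by
  simp only [husimi, ← mul_add, ← Finset.sum_add_distrib]
  congr 1
  refine Finset.sum_congr rfl fun x _ => Finset.sum_congr rfl fun y _ => ?_
  rw [← formAverage_add hc (fun j => norm_partialFourier_le f _ _)
    (fun j => norm_partialFourier_le g _ _)]
  simp only [partialFourier_add]

theorem husimi_smul (z : ℂ) (f : C(Phase, ℂ)) : husimi a ℓ c k σ L (z • f) =
    z * husimi a ℓ c k σ L f := by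
  simp only [husimi, partialFourier_smul, formAverage_smul, ← Finset.mul_sum]
  ring

/-- Elementary tensors on phase space. -/
def tensor (p : ℤ) (g : C(unitInterval, ℂ)) : C(Phase, ℂ) :=
  ⟨fun x => fourier (-p) x.1 * g x.2, by fun_prop⟩

theorem partialFourier_tensor (p q : ℤ) (g : C(unitInterval, ℂ)) (s : unitInterval) :
    partialFourier (tensor p g) q s = if q = -p then g s else 0 := by
  have : ∀ y : UnitAddCircle, (fourier (-q) y : ℂ) * tensor p g (y, s) = fourier (-q + -p) y * g s :=
    fun y => by
      rw [fourier_add]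
      simp only [tensor, ContinuousMap.coe_mk]
      ring
  simp only [partialFourier, this]
  rw [integral_mul_const, integral_fourier]
  have : -q + -p = 0 ↔ q = -p := by omega
  simp only [this, ite_mul, one_mul, zero_mul]

theorem formAverage_zero_symbol (m : Freq) : formAverage a ℓ c (fun _ => 0) m = 0 := by
  simp [formAverage, form]

/-- By orthogonality of the characters, only the pairs with y = x - p contribute. The condition
expresses that y remains in the window. -/
theorem husimi_tensor (p : ℤ) (g : C(unitInterval, ℂ)) : husimi a ℓ c k σ L (tensor p g) =
    (L : ℂ)⁻¹ * ∑ x ∈ Finset.range L, if 0 ≤ (x : ℤ) - p ∧ (x : ℤ) - p < L then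
      formAverage a ℓ c (fun j => g (σ (j - (x : ℤ) • k))) (p • k) else 0 := by
  rw [husimi]
  congr 1
  refine Finset.sum_congr rfl fun x hx => ?_
  have hterm : ∀ y : ℕ, formAverage a ℓ c (fun j => partialFourier (tensor p g) ((y : ℤ) - x)
      (σ (j - (x : ℤ) • k))) (((x : ℤ) - y) • k) = if (y : ℤ) = x - p then
        formAverage a ℓ c (fun j => g (σ (j - (x : ℤ) • k))) (p • k) else 0 := by
    intro y
    simp only [partialFourier_tensor]
    by_cases h : (y : ℤ) = x - p
    · simp [h]
    · have h1 : ¬ (y : ℤ) - x = -p := by omega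
      simp only [h, h1, if_false, formAverage_zero_symbol]
  simp only [hterm]
  split_ifs with hc
  · obtain ⟨q, hq⟩ := Int.eq_ofNat_of_zero_le hc.1
    rw [Finset.sum_eq_single q]
    · simp [hq]
    · intro y _ hy
      rw [if_neg]
      rw [hq]; exact_mod_cast hy
    · intro hn
      exfalso
      apply hn
      rw [Finset.mem_range]
      have := hc.2
      omega
  · refine Finset.sum_eq_zero fun y hy => ?_
    rw [if_neg]
    rintro he
    rw [Finset.mem_range] at hy
    apply hc
    omega

/-- The phase space distribution computes the forms up to an error. -/
theorem norm_husimi_tensor_sub_le (hc : Continuous c) (hℓ : 0 < ℓ) (hn : ∀ t, ‖c t‖ = 1)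
    (hL : 0 < L) (p : ℤ) (g : C(unitInterval, ℂ)) {η : ℝ}
    (hη : ∀ (x : ℕ) j, x < L → ‖g (σ (j - (x : ℤ) • k)) - g (σ j)‖ ≤ η) :
    ‖husimi a ℓ c k σ L (tensor p g) - formAverage a ℓ c (fun j => g (σ j)) (p • k)‖ ≤
      η + ‖g‖ * (|(p : ℝ)| * (L : ℝ)⁻¹) := by
  set Q := formAverage a ℓ c (fun j => g (σ j)) (p • k) with hQ
  set Qx : ℕ → ℂ := fun x => formAverage a ℓ c (fun j => g (σ (j - (x : ℤ) • k))) (p • k) with hQx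
  have hη0 : 0 ≤ η := (norm_nonneg _).trans (hη 0 0 hL)
  have hLc : (L : ℂ) ≠ 0 := by exact_mod_cast hL.ne'
  have hLr : (0 : ℝ) < L := by exact_mod_cast hL
  have hQn : ‖Q‖ ≤ ‖g‖ := norm_formAverage_le hℓ hn (fun j => g.norm_coe_le_norm _) _
  have hdiff : ∀ x, x < L → ‖Qx x - Q‖ ≤ η := fun x hx => by
    simp only [hQx, hQ]
    rw [← formAverage_sub hc (fun j => g.norm_coe_le_norm _) (fun j => g.norm_coe_le_norm _)]
    exact norm_formAverage_le hℓ hn (fun j => hη x j hx) _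
  have hrep : husimi a ℓ c k σ L (tensor p g) - Q = (L : ℂ)⁻¹ * ∑ x ∈ Finset.range L,
      ((if 0 ≤ (x : ℤ) - p ∧ (x : ℤ) - p < L then Qx x else 0) - Q) := by
    rw [Finset.sum_sub_distrib, Finset.sum_const, Finset.card_range, nsmul_eq_mul, mul_sub,
      inv_mul_cancel_left₀ hLc, husimi_tensor]
  rw [hrep, norm_mul, norm_inv, Complex.norm_natCast]
  -- Translation by p pushes at most |p| of the L positions out of the window.
  have hcount : ∑ x ∈ Finset.range L,
      (if 0 ≤ (x : ℤ) - p ∧ (x : ℤ) - p < L then (0 : ℝ) else 1) ≤ |(p : ℝ)| := by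
    have h1 : ∑ x ∈ Finset.range L,
        (if 0 ≤ (x : ℤ) - p ∧ (x : ℤ) - p < L then (0 : ℝ) else 1) =
        ((Finset.range L).filter fun x : ℕ => ¬ (0 ≤ (x : ℤ) - p ∧ (x : ℤ) - p < L)).card := by
      rw [Finset.card_filter]
      push_cast
      exact Finset.sum_congr rfl fun x _ => by split_ifs <;> simp_all
    rw [h1]
    have h2 : ((Finset.range L).filter fun x : ℕ => ¬ (0 ≤ (x : ℤ) - p ∧ (x : ℤ) - p < L)).card ≤
        p.natAbs := by
      rcases le_total 0 p with hp | hp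
      · refine (Finset.card_le_card (t := Finset.range p.natAbs) fun x hx => ?_).trans
          (Finset.card_range _).le
        simp only [Finset.mem_filter, Finset.mem_range] at hx ⊢
        omega
      · refine (Finset.card_le_card (t := Finset.Ico (L - p.natAbs) L) fun x hx => ?_).trans ?_
        · simp only [Finset.mem_filter, Finset.mem_range, Finset.mem_Ico] at hx ⊢
          omega
        · rw [Nat.card_Ico]; omega
    calc _ ≤ ((p.natAbs : ℕ) : ℝ) := by exact_mod_cast h2
      _ = |(p : ℝ)| := by rw [Nat.cast_natAbs, Int.cast_abs]
  have hsum : ‖∑ x ∈ Finset.range L,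
      ((if 0 ≤ (x : ℤ) - p ∧ (x : ℤ) - p < L then Qx x else 0) - Q)‖ ≤ L * η + ‖g‖ * |(p : ℝ)| := by
    refine (norm_sum_le _ _).trans ?_
    calc _ ≤ ∑ x ∈ Finset.range L, (η + ‖g‖ *
          (if 0 ≤ (x : ℤ) - p ∧ (x : ℤ) - p < L then (0 : ℝ) else 1)) := by
          refine Finset.sum_le_sum fun x hx => ?_
          split_ifs
          · simpa using hdiff x (Finset.mem_range.mp hx)
          · rw [zero_sub, norm_neg, mul_one]; linarith
      _ ≤ L * η + ‖g‖ * |(p : ℝ)| := by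
          rw [Finset.sum_add_distrib, ← Finset.mul_sum, Finset.sum_const, Finset.card_range,
            nsmul_eq_mul]
          gcongr
  calc (L : ℝ)⁻¹ * _ ≤ (L : ℝ)⁻¹ * (L * η + ‖g‖ * |(p : ℝ)|) := by gcongr
    _ = η + ‖g‖ * (|(p : ℝ)| * (L : ℝ)⁻¹) := by field_simp

end Husimi

/-- The compactified squared momentum. -/
def sigma (x : ℝ) : unitInterval :=
  ⟨x ^ 2 / (1 + x ^ 2), by positivity, by
    rw [div_le_one (by positivity)]; linarith⟩

/-- Since |x + y| ≤ (1 + x²)(1 + y²), the compactified variable moves no faster than the momentum.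
Hence it varies little over a window of L frequencies along k when Lħ/ε is small. -/
theorem dist_sigma_le (x y : ℝ) : dist (sigma x) (sigma y) ≤ |x - y| := by
  rw [Subtype.dist_eq, Real.dist_eq]
  simp only [sigma]
  have hx : 0 < 1 + x ^ 2 := by positivity
  have hy : 0 < 1 + y ^ 2 := by positivity
  have h : x ^ 2 / (1 + x ^ 2) - y ^ 2 / (1 + y ^ 2) =
      (x - y) * ((x + y) / ((1 + x ^ 2) * (1 + y ^ 2))) := by
    field_simp; ring
  rw [h, abs_mul]
  refine mul_le_of_le_one_right (abs_nonneg _) ?_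
  rw [abs_div, abs_of_pos (mul_pos hx hy), div_le_one (mul_pos hx hy)]
  rw [abs_le]
  constructor <;> nlinarith [sq_nonneg (x - 1), sq_nonneg (y - 1), sq_nonneg (x + 1),
    sq_nonneg (y + 1), mul_nonneg (sq_nonneg x) (sq_nonneg y)]

namespace Regime

variable {w : Freq → ℂ} {ħ ε a ℓ : ℕ → ℝ} {c : ℕ → ℝ → SeqL2}

/-- Existence of the limiting phase space measure in the direction `k`. -/
theorem exists_phase_measure (h : Regime w ħ ε a ℓ c) (k : Freq) (U : Ultrafilter ℕ)
    (hU : (U : Filter ℕ) ≤ atTop) :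
    ∃ μ : Measure Phase, IsFiniteMeasure μ ∧ ∀ (p : ℤ) (g : C(unitInterval, ℂ)),
      Tendsto (fun n => formAverage (a n) (ℓ n) (c n)
        (fun j => g (sigma (zeta (ħ n) (ε n) k j))) (p • k)) U
        (𝓝 (∫ x, fourier (-p) x.1 * g x.2 ∂μ)) := by
  set σ : ℕ → Freq → unitInterval := fun n j => sigma (zeta (ħ n) (ε n) k j) with hσ
  -- Any L with L → ∞ and Lħ/ε → 0 would do: the first makes the ends of the window negligible, the
  -- second makes the symbol almost constant on it. The square root of ε/ħ achieves both.
  set L : ℕ → ℕ := fun n => ⌈Real.sqrt (ε n / ħ n)⌉₊ with hL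
  have hq : ∀ n, 0 < ε n / ħ n := fun n => div_pos (h.ε_pos n) (h.ħ_pos n)
  have hLpos : ∀ n, 0 < L n := fun n => Nat.ceil_pos.mpr (Real.sqrt_pos.mpr (hq n))
  have hsq : Tendsto (fun n => Real.sqrt (ħ n / ε n)) atTop (𝓝 0) := by
    have := (Real.continuous_sqrt.tendsto 0).comp h.tendsto_ratio
    rwa [Real.sqrt_zero] at this
  have hLinv : Tendsto (fun n => ((L n : ℝ))⁻¹) atTop (𝓝 0) := by
    refine squeeze_zero (fun n => by positivity) (fun n => ?_) hsq
    have h1 : Real.sqrt (ε n / ħ n) ≤ L n := Nat.le_ceil _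
    have h2 : Real.sqrt (ħ n / ε n) = (Real.sqrt (ε n / ħ n))⁻¹ := by
      rw [← Real.sqrt_inv, inv_div]
    rw [h2]
    exact inv_anti₀ (Real.sqrt_pos.mpr (hq n)) h1
  have hLr : Tendsto (fun n => (L n : ℝ) * (ħ n / ε n * |dot k k|)) atTop (𝓝 0) := by
    have hlim : Tendsto (fun n => (Real.sqrt (ħ n / ε n) + ħ n / ε n) * |dot k k|) atTop (𝓝 0) := by
      have := (hsq.add h.tendsto_ratio).mul_const |dot k k|
      simpa using this
    have hr0 : ∀ n, 0 ≤ ħ n / ε n := fun n => (div_pos (h.ħ_pos n) (h.ε_pos n)).le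
    refine squeeze_zero (fun n => mul_nonneg (by positivity)
      (mul_nonneg (hr0 n) (abs_nonneg _))) (fun n => ?_) hlim
    have h1 : (L n : ℝ) ≤ Real.sqrt (ε n / ħ n) + 1 := (Nat.ceil_lt_add_one (Real.sqrt_nonneg _)).le
    have h2 : Real.sqrt (ε n / ħ n) * (ħ n / ε n) = Real.sqrt (ħ n / ε n) := by
      have e : Real.sqrt (ε n / ħ n) = (Real.sqrt (ħ n / ε n))⁻¹ := by
        rw [← Real.sqrt_inv, inv_div]
      have hs : 0 < Real.sqrt (ħ n / ε n) := Real.sqrt_pos.mpr (div_pos (h.ħ_pos n) (h.ε_pos n))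
      rw [e]
      nth_rewrite 2 [← Real.mul_self_sqrt (hr0 n)]
      field_simp
    calc (L n : ℝ) * (ħ n / ε n * |dot k k|) ≤
          (Real.sqrt (ε n / ħ n) + 1) * (ħ n / ε n * |dot k k|) :=
          mul_le_mul_of_nonneg_right h1 (mul_nonneg (hr0 n) (abs_nonneg _))
      _ = _ := by rw [← h2]; ring
  let T : ℕ → C(Phase, ℝ) →ₗ[ℝ] ℝ := fun n =>
    { toFun := fun f => (husimi (a n) (ℓ n) (c n) k (σ n) (L n) (complexify f)).re
      map_add' := fun f g => by
        have : complexify (f + g) = complexify f + complexify g := by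
          ext x; simp [complexify]
        rw [this, husimi_add (h.sol n).continuous, Complex.add_re]
      map_smul' := fun r f => by
        have : complexify (r • f) = (r : ℂ) • complexify f := by
          ext x; simp [complexify]
        rw [this, husimi_smul, Complex.re_ofReal_mul]
        rfl }
  have hT : ∀ n f, T n f = (husimi (a n) (ℓ n) (c n) k (σ n) (L n) (complexify f)).re :=
    fun n f => rfl
  have hone : ∀ n, T n 1 = 1 := by
    intro n
    have e : complexify 1 = tensor 0 1 := by
      ext x; simp [complexify, tensor]
    have hLc : (L n : ℂ) ≠ 0 := by exact_mod_cast (hLpos n).ne'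
    rw [hT, e, husimi_tensor]
    have : ∀ x ∈ Finset.range (L n), (if 0 ≤ (x : ℤ) - 0 ∧ (x : ℤ) - 0 < L n then
        formAverage (a n) (ℓ n) (c n) (fun j => (1 : C(unitInterval, ℂ)) (σ n (j - (x : ℤ) • k)))
          ((0 : ℤ) • k) else 0) = 1 := by
      intro x hx
      rw [Finset.mem_range] at hx
      rw [if_pos (by omega), zero_smul]
      exact formAverage_one_zero (h.ℓ_pos n) (h.norm_eq n)
    rw [Finset.sum_congr rfl this]
    simp [hLc]
  obtain ⟨μ, hμ, hlim⟩ := exists_limit_measure U T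
    (fun n f hf => (husimi_real (h.sol n).continuous (h.ℓ_pos n) f).2 hf) hone
  refine ⟨μ, hμ, fun p g => ?_⟩
  -- The limiting functional is defined on real functions, so the complex tensor is split into its
  -- real and imaginary parts.
  set F := tensor p g with hF
  set u : C(Phase, ℝ) := ⟨fun x => (F x).re, by fun_prop⟩ with hu
  set v : C(Phase, ℝ) := ⟨fun x => (F x).im, by fun_prop⟩ with hv
  have hFuv : F = complexify u + Complex.I • complexify v := by
    ext x
    simp only [hu, hv, complexify, ContinuousMap.coe_mk, ContinuousMap.add_apply,
      ContinuousMap.smul_apply, smul_eq_mul]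
    rw [mul_comm]
    exact (Complex.re_add_im (F x)).symm
  have hH : ∀ n, husimi (a n) (ℓ n) (c n) k (σ n) (L n) F = T n u + T n v * Complex.I := by
    intro n
    rw [hFuv, husimi_add (h.sol n).continuous, husimi_smul]
    have e : ∀ f, husimi (a n) (ℓ n) (c n) k (σ n) (L n) (complexify f) = (T n f : ℂ) := fun f =>
      Complex.ext rfl (by
        simpa using (husimi_real (k := k) (σ := σ n) (L := L n) (a := a n)
          (h.sol n).continuous (h.ℓ_pos n) f).1)
    rw [e, e, mul_comm]
  have hFi : Integrable F μ := F.continuous.integrable_of_hasCompactSupport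
    (HasCompactSupport.of_compactSpace F)
  have hIF : ∫ x, F x ∂μ = (∫ x, u x ∂μ : ℝ) + (∫ x, v x ∂μ : ℝ) * Complex.I := by
    have := integral_re_add_im hFi
    simpa [hu, hv] using this.symm
  have hlimH : Tendsto (fun n => husimi (a n) (ℓ n) (c n) k (σ n) (L n) F) U
      (𝓝 (∫ x, F x ∂μ)) := by
    simp only [hH, hIF]
    exact ((Complex.continuous_ofReal.tendsto _).comp (hlim u)).add
      (((Complex.continuous_ofReal.tendsto _).comp (hlim v)).mul_const _)
  have hdiff : Tendsto (fun n => husimi (a n) (ℓ n) (c n) k (σ n) (L n) F -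
      formAverage (a n) (ℓ n) (c n) (fun j => g (σ n j)) (p • k)) atTop (𝓝 0) := by
    rw [Metric.tendsto_nhds]
    intro κ hκ
    obtain ⟨η, hη, hgη⟩ := Metric.uniformContinuous_iff.mp
      (CompactSpace.uniformContinuous_of_continuous g.continuous) (κ / 2) (half_pos hκ)
    have hlim2 : Tendsto (fun n => ‖g‖ * (|(p : ℝ)| * (L n : ℝ)⁻¹)) atTop (𝓝 0) := by
      simpa using (hLinv.const_mul |(p : ℝ)|).const_mul ‖g‖
    filter_upwards [hLr.eventually_lt_const hη, hlim2.eventually_lt_const (half_pos hκ)]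
      with n hn1 hn2
    rw [dist_zero_right]
    have := norm_husimi_tensor_sub_le (a := a n) (k := k) (σ := σ n) (h.sol n).continuous
      (h.ℓ_pos n) (h.norm_eq n) (hLpos n) p g (η := κ / 2) (fun x j hx => by
        rw [← dist_eq_norm]
        refine (hgη (lt_of_le_of_lt ?_ hn1)).le
        refine (dist_sigma_le _ _).trans ?_
        have e : zeta (ħ n) (ε n) k (j - (x : ℤ) • k) - zeta (ħ n) (ε n) k j =
            -(x * (ħ n / ε n * dot k k)) := by
          simp only [zeta, dot_sub, dot_zsmul]
          push_cast
          ring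
        have hr0 : 0 ≤ ħ n / ε n := (div_pos (h.ħ_pos n) (h.ε_pos n)).le
        rw [e, abs_neg, abs_mul, abs_mul, abs_of_nonneg hr0, Nat.abs_cast]
        have : (x : ℝ) ≤ L n := by exact_mod_cast hx.le
        gcongr)
    linarith
  have := hlimH.sub (hdiff.mono_left hU)
  simp only [sub_sub_cancel, sub_zero] at this
  exact this

end Regime

/-! ### Rational symbols -/

/-- The resolvent `1/(x + iρ)`. -/
def resolvent (ρ x : ℝ) : ℂ := ((x : ℂ) + ρ * Complex.I)⁻¹

section Resolvent

variable {ρ : ℝ}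

theorem resolvent_denom_ne (hρ : 0 < ρ) (x : ℝ) : ((x : ℂ) + ρ * Complex.I) ≠ 0 := by
  intro h
  have := congrArg Complex.im h
  simp at this
  exact hρ.ne' this

theorem norm_sq_resolvent (x : ℝ) : ‖resolvent ρ x‖ ^ 2 = (ρ ^ 2 + x ^ 2)⁻¹ := by
  rw [resolvent, norm_inv, inv_pow, ← Complex.normSq_eq_norm_sq, Complex.normSq_apply]
  simp
  ring

theorem norm_resolvent_le (hρ : 0 < ρ) (x : ℝ) : ‖resolvent ρ x‖ ≤ ρ⁻¹ := by
  refine le_of_sq_le_sq ?_ (by positivity)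
  rw [norm_sq_resolvent, inv_pow]
  exact inv_anti₀ (by positivity) (by nlinarith [sq_nonneg x])

theorem resolvent_re (x : ℝ) : (resolvent ρ x).re = x / (ρ ^ 2 + x ^ 2) := by
  rw [resolvent, Complex.inv_re, Complex.normSq_apply]
  simp
  ring

theorem resolvent_sq_re (x : ℝ) :
    (resolvent ρ x ^ 2).re = -((ρ ^ 2 - x ^ 2) / (ρ ^ 2 + x ^ 2) ^ 2) := by
  have hD : Complex.normSq ((x : ℂ) + ρ * Complex.I) = ρ ^ 2 + x ^ 2 := by
    rw [Complex.normSq_apply]; simp; ring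
  rw [sq, Complex.mul_re, resolvent, Complex.inv_re, Complex.inv_im, hD]
  generalize ρ ^ 2 + x ^ 2 = D
  simp
  ring

theorem resolvent_sub (hρ : 0 < ρ) (x y : ℝ) :
    resolvent ρ x - resolvent ρ y = (y - x) * (resolvent ρ x * resolvent ρ y) := by
  have hx := resolvent_denom_ne hρ x
  have hy := resolvent_denom_ne hρ y
  simp only [resolvent]
  field_simp
  ring

/-- The momentum symbol `x / (r + x²)`. -/
def momentumSymbol (r x : ℝ) : ℝ := x / (r + x ^ 2)

/-- Its derivative. -/
def momentumSymbolDeriv (r x : ℝ) : ℝ := (r - x ^ 2) / (r + x ^ 2) ^ 2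

/-- With R(x) = 1/(x + iρ), the symbol is Re R and its derivative is -Re R². The resolvent identity
gives the Taylor remainder exactly, as the real part of y² R(x)² R(x + y). -/
theorem momentumSymbol_taylor (hρ : 0 < ρ) (x y : ℝ) :
    |momentumSymbol (ρ ^ 2) (x + y) - momentumSymbol (ρ ^ 2) x -
      y * momentumSymbolDeriv (ρ ^ 2) x| ≤ (ρ⁻¹) ^ 3 * y ^ 2 := by
  have h : momentumSymbol (ρ ^ 2) (x + y) - momentumSymbol (ρ ^ 2) x -
      y * momentumSymbolDeriv (ρ ^ 2) x =
      (resolvent ρ (x + y) - resolvent ρ x + y * resolvent ρ x ^ 2).re := by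
    rw [Complex.add_re, Complex.sub_re, Complex.re_ofReal_mul, resolvent_re, resolvent_re,
      resolvent_sq_re]
    simp only [momentumSymbol, momentumSymbolDeriv]
    ring
  have h2 : resolvent ρ (x + y) - resolvent ρ x + y * resolvent ρ x ^ 2 =
      y ^ 2 * (resolvent ρ x ^ 2 * resolvent ρ (x + y)) := by
    have e := resolvent_sub hρ (x + y) x
    push_cast at e
    linear_combination (1 - (y : ℂ) * resolvent ρ x) * e
  rw [h, h2]
  refine (Complex.abs_re_le_norm _).trans ?_
  rw [norm_mul, norm_mul, norm_pow, norm_pow, Complex.norm_real, Real.norm_eq_abs, sq_abs]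
  have h1 := norm_resolvent_le hρ x
  have h3 := norm_resolvent_le hρ (x + y)
  calc y ^ 2 * (‖resolvent ρ x‖ ^ 2 * ‖resolvent ρ (x + y)‖) ≤
        y ^ 2 * ((ρ⁻¹) ^ 2 * ρ⁻¹) := by gcongr
    _ = _ := by ring

theorem abs_momentumSymbol_le (hρ : 0 < ρ) (x : ℝ) : |momentumSymbol (ρ ^ 2) x| ≤ ρ⁻¹ := by
  rw [momentumSymbol, ← resolvent_re]
  exact (Complex.abs_re_le_norm _).trans (norm_resolvent_le hρ x)

theorem abs_mul_momentumSymbol_le (hρ : 0 < ρ) (x : ℝ) :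
    |x * momentumSymbol (ρ ^ 2) x| ≤ 1 := by
  have e : x * momentumSymbol (ρ ^ 2) x = x ^ 2 / (ρ ^ 2 + x ^ 2) := by
    simp only [momentumSymbol]; ring
  rw [e, abs_of_nonneg (by positivity), div_le_one (by positivity)]
  nlinarith [sq_nonneg ρ]

theorem abs_momentumSymbolDeriv_le' (x : ℝ) :
    |momentumSymbolDeriv (ρ ^ 2) x| ≤ (ρ ^ 2 + x ^ 2)⁻¹ := by
  have := Complex.abs_re_le_norm (resolvent ρ x ^ 2)
  rwa [resolvent_sq_re, abs_neg, norm_pow, norm_sq_resolvent] at this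

theorem abs_momentumSymbolDeriv_le (hρ : 0 < ρ) (x : ℝ) :
    |momentumSymbolDeriv (ρ ^ 2) x| ≤ (ρ⁻¹) ^ 2 := by
  refine (abs_momentumSymbolDeriv_le' x).trans ?_
  rw [inv_pow]
  exact inv_anti₀ (by positivity) (by nlinarith [sq_nonneg x])

theorem momentumSymbolDeriv_lipschitz (hρ : 0 < ρ) (x y : ℝ) :
    |momentumSymbolDeriv (ρ ^ 2) x - momentumSymbolDeriv (ρ ^ 2) y| ≤
      2 * (ρ⁻¹) ^ 3 * |x - y| := by
  have h : momentumSymbolDeriv (ρ ^ 2) x - momentumSymbolDeriv (ρ ^ 2) y =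
      -((resolvent ρ x ^ 2 - resolvent ρ y ^ 2).re) := by
    rw [Complex.sub_re, resolvent_sq_re, resolvent_sq_re]
    simp only [momentumSymbolDeriv]
    ring
  have h2 : resolvent ρ x ^ 2 - resolvent ρ y ^ 2 =
      (y - x) * (resolvent ρ x * resolvent ρ y) * (resolvent ρ x + resolvent ρ y) := by
    rw [← resolvent_sub hρ]; ring
  rw [h, abs_neg]
  refine (Complex.abs_re_le_norm _).trans ?_
  rw [h2, norm_mul, norm_mul, norm_mul, ← Complex.ofReal_sub, Complex.norm_real, Real.norm_eq_abs,
    abs_sub_comm y x]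
  have h1 := norm_resolvent_le hρ x
  have h3 := norm_resolvent_le hρ y
  have h4 : ‖resolvent ρ x + resolvent ρ y‖ ≤ ρ⁻¹ + ρ⁻¹ := (norm_add_le _ _).trans (add_le_add h1 h3)
  calc |x - y| * (‖resolvent ρ x‖ * ‖resolvent ρ y‖) * ‖resolvent ρ x + resolvent ρ y‖ ≤
        |x - y| * (ρ⁻¹ * ρ⁻¹) * (ρ⁻¹ + ρ⁻¹) := by gcongr
    _ = _ := by ring

theorem momentumSymbolDeriv_small (hρ : 0 < ρ) {κ : ℝ} (hκ : 0 < κ) :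
    ∃ Z, ∀ x, Z ≤ |x| → |momentumSymbolDeriv (ρ ^ 2) x| ≤ κ := by
  refine ⟨1 + κ⁻¹, fun x hx => (abs_momentumSymbolDeriv_le' x).trans ?_⟩
  have hk : 0 < κ⁻¹ := inv_pos.mpr hκ
  rw [inv_le_comm₀ (by positivity) hκ, ← sq_abs x]
  nlinarith [sq_nonneg ρ]

end Resolvent

/-- `x²/(r + x²)` in terms of the compactified squared momentum. -/
def kineticSymbol (r s : ℝ) : ℝ := s / (r * (1 - s) + s)

/-- The derivative of the momentum symbol in terms of the compactified squared momentum. -/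
def forceSymbol (r s : ℝ) : ℝ := (r * (1 - s) - s) * (1 - s) / (r * (1 - s) + s) ^ 2

theorem symbol_denom_pos {r s : ℝ} (hr : 0 < r) (hs : s ∈ unitInterval) :
    0 < r * (1 - s) + s := by
  rcases hs.1.eq_or_lt with h | h
  · rw [← h]; linarith
  · have := mul_nonneg hr.le (sub_nonneg.mpr hs.2)
    linarith

theorem kineticSymbol_sigma {r : ℝ} (hr : 0 < r) (x : ℝ) :
    kineticSymbol r (sigma x) = x * momentumSymbol r x := by
  simp only [kineticSymbol, sigma, momentumSymbol]
  have h1 : (1 : ℝ) + x ^ 2 ≠ 0 := by positivity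
  have h2 : r + x ^ 2 ≠ 0 := by positivity
  have h3 : (1 : ℝ) - x ^ 2 / (1 + x ^ 2) = 1 / (1 + x ^ 2) := by field_simp; ring
  rw [h3]
  have h4 : r * (1 / (1 + x ^ 2)) + x ^ 2 / (1 + x ^ 2) = (r + x ^ 2) / (1 + x ^ 2) := by
    field_simp
  rw [h4]
  field_simp

theorem forceSymbol_sigma {r : ℝ} (hr : 0 < r) (x : ℝ) :
    forceSymbol r (sigma x) = momentumSymbolDeriv r x := by
  simp only [forceSymbol, sigma, momentumSymbolDeriv]
  have h1 : (1 : ℝ) + x ^ 2 ≠ 0 := by positivity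
  have h2 : r + x ^ 2 ≠ 0 := by positivity
  have h3 : (1 : ℝ) - x ^ 2 / (1 + x ^ 2) = 1 / (1 + x ^ 2) := by field_simp; ring
  rw [h3]
  have h4 : r * (1 / (1 + x ^ 2)) + x ^ 2 / (1 + x ^ 2) = (r + x ^ 2) / (1 + x ^ 2) := by
    field_simp
  rw [h4]
  field_simp

/-- The kinetic symbol as a continuous function. -/
def kineticMap (r : ℝ) (hr : 0 < r) : C(unitInterval, ℂ) :=
  ⟨fun s => (kineticSymbol r s : ℂ), by
    refine Complex.continuous_ofReal.comp (Continuous.div (by fun_prop) (by fun_prop) fun s => ?_)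
    exact (symbol_denom_pos hr s.2).ne'⟩

/-- The force symbol as a continuous function. -/
def forceMap (r : ℝ) (hr : 0 < r) : C(unitInterval, ℂ) :=
  ⟨fun s => (forceSymbol r s : ℂ), by
    refine Complex.continuous_ofReal.comp (Continuous.div (by fun_prop) (by fun_prop) fun s => ?_)
    exact pow_ne_zero _ (symbol_denom_pos hr s.2).ne'⟩

theorem abs_kineticSymbol_le {r s : ℝ} (hr : 0 < r) (hs : s ∈ unitInterval) :
    |kineticSymbol r s| ≤ 1 := by
  have h := symbol_denom_pos hr hs
  rw [kineticSymbol, abs_of_nonneg (div_nonneg hs.1 h.le), div_le_one h]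
  have := mul_nonneg hr.le (sub_nonneg.mpr hs.2)
  linarith

theorem abs_forceSymbol_le {r s : ℝ} (hr : 0 < r) (hs : s ∈ unitInterval) :
    |forceSymbol r s| ≤ r⁻¹ := by
  have h := symbol_denom_pos hr hs
  have h0 := mul_nonneg hr.le (sub_nonneg.mpr hs.2)
  have h1 : |r * (1 - s) - s| ≤ r * (1 - s) + s := by
    rw [abs_le]; constructor <;> linarith [hs.1]
  rw [forceSymbol, abs_div, abs_mul, abs_of_nonneg (sub_nonneg.mpr hs.2),
    abs_of_pos (pow_pos h 2), div_le_iff₀ (pow_pos h 2)]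
  have h2 : 1 - s ≤ r⁻¹ * (r * (1 - s) + s) := by
    have : r⁻¹ * (r * (1 - s) + s) = (1 - s) + r⁻¹ * s := by field_simp
    rw [this]
    have := mul_nonneg (inv_nonneg.mpr hr.le) hs.1
    linarith
  calc |r * (1 - s) - s| * (1 - s) ≤ (r * (1 - s) + s) * (r⁻¹ * (r * (1 - s) + s)) :=
        mul_le_mul h1 h2 (sub_nonneg.mpr hs.2) h.le
    _ = _ := by ring

/-! ### The limiting transport equation -/

/-- A frequency that generates all the frequencies collinear to it. -/
structure IsPrimitive (k : Freq) : Prop where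
  ne_zero : k ≠ 0
  exists_eq : ∀ l, det k l = 0 → ∃ p : ℤ, l = p • k

theorem IsPrimitive.dot_pos {k : Freq} (hk : IsPrimitive k) : 0 < dot k k := by
  have hne : k 0 ≠ 0 ∨ k 1 ≠ 0 := by
    by_contra! h
    exact hk.ne_zero (by ext i; fin_cases i <;> simp [h])
  simp only [dot, Fin.sum_univ_two]
  rcases hne with h | h
  · have : (k 0 : ℝ) ≠ 0 := by exact_mod_cast h
    have := mul_self_pos.mpr this
    nlinarith [mul_self_nonneg (k 1 : ℝ)]
  · have : (k 1 : ℝ) ≠ 0 := by exact_mod_cast h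
    have := mul_self_pos.mpr this
    nlinarith [mul_self_nonneg (k 0 : ℝ)]

theorem IsPrimitive.injective {k : Freq} (hk : IsPrimitive k) :
    Function.Injective fun p : ℤ => p • k := smul_left_injective ℤ hk.ne_zero

theorem det_zsmul_sub (k l : Freq) (p : ℤ) : det k (p • k - l) = -det k l := by
  simp only [det, Pi.sub_apply, Pi.smul_apply, smul_eq_mul]; ring

/-- The derivative, up to the factor `2πi`, of the average of the potential along the direction
orthogonal to `k`. -/
def averageDeriv (w : Freq → ℂ) (k : Freq) : C(UnitAddCircle, ℂ) :=
  ∑' q : ℤ, ((q : ℂ) * w (q • k)) • fourier q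

theorem IsPotential.summable_line {w : Freq → ℂ} (hw : IsPotential w) {k : Freq}
    (hk : IsPrimitive k) : Summable fun q : ℤ => ‖(q : ℂ) * w (q • k)‖ := by
  have h := ((hw.summable_dot k).comp_injective hk.injective).mul_left (dot k k)⁻¹
  refine h.congr fun q => ?_
  have := hk.dot_pos
  simp only [Function.comp_apply, dot_zsmul, norm_mul, abs_mul, abs_of_pos this,
    Complex.norm_intCast]
  field_simp

theorem IsPotential.summable_averageDeriv {w : Freq → ℂ} (hw : IsPotential w) {k : Freq}
    (hk : IsPrimitive k) :
    Summable fun q : ℤ => ((q : ℂ) * w (q • k)) • (fourier q : C(UnitAddCircle, ℂ)) := by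
  refine Summable.of_norm_bounded (hw.summable_line hk) fun q => ?_
  rw [norm_smul, fourier_norm, mul_one]

theorem integrable_phase {μ : Measure Phase} [IsFiniteMeasure μ] {F : Phase → ℂ}
    (hF : Continuous F) : Integrable F μ :=
  hF.integrable_of_hasCompactSupport (HasCompactSupport.of_compactSpace F)

/-- The Fourier series of `averageDeriv` converges absolutely, so it can be integrated term by term:
multiplication by it is a convolution of Fourier coefficients. In this form the collinear potential
modes l = q • k appear in the limit of the commutator. -/
theorem hasSum_integral_averageDeriv {w : Freq → ℂ} (hw : IsPotential w) {k : Freq}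
    (hk : IsPrimitive k) (μ : Measure Phase) [IsFiniteMeasure μ] (p : ℤ)
    (g : C(unitInterval, ℂ)) :
    HasSum (fun q : ℤ => ((q : ℂ) * w (q • k)) * ∫ x, fourier (-(p - q)) x.1 * g x.2 ∂μ)
      (∫ x, fourier (-p) x.1 * (averageDeriv w k x.1 * g x.2) ∂μ) := by
  have hF : ∀ q : ℤ, Integrable (fun x : Phase =>
      ((q : ℂ) * w (q • k)) * (fourier (-(p - q)) x.1 * g x.2)) μ := fun q =>
    integrable_phase (by fun_prop)
  have hbd : ∀ (q : ℤ) (x : Phase),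
      ‖((q : ℂ) * w (q • k)) * (fourier (-(p - q)) x.1 * g x.2)‖ ≤
        ‖(q : ℂ) * w (q • k)‖ * ‖g‖ := fun q x => by
    rw [norm_mul, norm_mul _ (g x.2), norm_fourier_apply, one_mul]
    exact mul_le_mul_of_nonneg_left (g.norm_coe_le_norm _) (norm_nonneg _)
  have hs : Summable fun q : ℤ => ∫ x, ‖((q : ℂ) * w (q • k)) *
      (fourier (-(p - q)) x.1 * g x.2)‖ ∂μ := by
    refine Summable.of_nonneg_of_le (fun q => integral_nonneg fun x => norm_nonneg _)
      (fun q => ?_) (((hw.summable_line hk).mul_right ‖g‖).mul_right (μ.real Set.univ))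
    have := integral_mono (μ := μ) (hF q).norm (integrable_const (‖(q : ℂ) * w (q • k)‖ * ‖g‖))
      (hbd q)
    rw [integral_const, smul_eq_mul, mul_comm (μ.real _)] at this
    exact this
  have h := hasSum_integral_of_summable_integral_norm hF hs
  simp only [integral_const_mul] at h
  have key : ∫ x, fourier (-p) x.1 * (averageDeriv w k x.1 * g x.2) ∂μ =
      ∫ x, ∑' q : ℤ, ((q : ℂ) * w (q • k)) * (fourier (-(p - q)) x.1 * g x.2) ∂μ := ?_
  · rw [key]; exact h
  refine integral_congr_ae (Eventually.of_forall fun x => ?_)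
  have h1 := (hw.summable_averageDeriv hk).hasSum
  have h2 := ((ContinuousMap.evalCLM ℂ x.1).hasSum h1).mul_left (fourier (-p) x.1 * g x.2)
  have h3 := h2.tsum_eq
  simp only
  change ∑' q : ℤ, fourier (-p) x.1 * g x.2 * (((q : ℂ) * w (q • k)) * fourier q x.1) =
    fourier (-p) x.1 * g x.2 * averageDeriv w k x.1 at h3
  calc fourier (-p) x.1 * (averageDeriv w k x.1 * g x.2) =
        fourier (-p) x.1 * g x.2 * averageDeriv w k x.1 := by ring
    _ = _ := h3.symm
    _ = _ := tsum_congr fun q => by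
        rw [show -(p - q) = -p + q by ring, fourier_add]; ring

namespace Regime

variable {w : Freq → ℂ} {ħ ε a ℓ : ℕ → ℝ} {c : ℕ → ℝ → SeqL2}

/-- The transport equation satisfied by the limiting phase space measures. -/
theorem transport_equation (h : Regime w ħ ε a ℓ c) {k : Freq} (hk : IsPrimitive k)
    (U : Ultrafilter ℕ) (hU : (U : Filter ℕ) ≤ atTop) (μ : Measure Phase) [IsFiniteMeasure μ]
    (hμ : ∀ (p : ℤ) (g : C(unitInterval, ℂ)),
      Tendsto (fun n => formAverage (a n) (ℓ n) (c n)
        (fun j => g (sigma (zeta (ħ n) (ε n) k j))) (p • k)) U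
        (𝓝 (∫ x, fourier (-p) x.1 * g x.2 ∂μ))) (p : ℤ) (r : ℝ) (hr : 0 < r) :
    (p : ℂ) * ∫ x, fourier (-p) x.1 * kineticMap r hr x.2 ∂μ +
      ((dot k k / (4 * Real.pi ^ 2) : ℝ) : ℂ) *
        ∫ x, fourier (-p) x.1 * (averageDeriv w k x.1 * forceMap r hr x.2) ∂μ = 0 := by
  obtain ⟨ρ, hρ, rfl⟩ : ∃ ρ : ℝ, 0 < ρ ∧ r = ρ ^ 2 :=
    ⟨Real.sqrt r, Real.sqrt_pos.mpr hr, (Real.sq_sqrt hr.le).symm⟩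
  -- The symbol f(x) = x/(r + x²) is chosen because x f(x) and f'(x) are even and have limits at
  -- infinity: both are continuous functions of the compactified squared momentum.
  have hinv := h.tendsto_invariance k p (f := fun x => (momentumSymbol (ρ ^ 2) x : ℂ))
    (f' := fun x => (momentumSymbolDeriv (ρ ^ 2) x : ℂ)) (B := ρ⁻¹) (B₁ := 1) (B' := (ρ⁻¹) ^ 2)
    (C := (ρ⁻¹) ^ 3)
    (fun x => by
      rw [Complex.norm_real, Real.norm_eq_abs]; exact abs_momentumSymbol_le hρ x)
    (fun x => by
      rw [← Complex.ofReal_mul, Complex.norm_real, Real.norm_eq_abs]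
      exact abs_mul_momentumSymbol_le hρ x)
    (fun x => by
      rw [Complex.norm_real, Real.norm_eq_abs]; exact abs_momentumSymbolDeriv_le hρ x)
    (fun x y => by
      rw [← Complex.ofReal_sub, ← Complex.ofReal_mul, ← Complex.ofReal_sub, Complex.norm_real,
        Real.norm_eq_abs]
      exact momentumSymbol_taylor hρ x y)
  have h1 : Tendsto (fun n => formAverage (a n) (ℓ n) (c n)
      (fun j => (zeta (ħ n) (ε n) k j : ℂ) *
        (momentumSymbol (ρ ^ 2) (zeta (ħ n) (ε n) k j) : ℂ)) (p • k)) U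
      (𝓝 (∫ x, fourier (-p) x.1 * kineticMap (ρ ^ 2) hr x.2 ∂μ)) := by
    refine (hμ p (kineticMap (ρ ^ 2) hr)).congr fun n => ?_
    congr 1
    funext j
    simp only [kineticMap, ContinuousMap.coe_mk, kineticSymbol_sigma hr, Complex.ofReal_mul]
  have h2 : ∀ q : ℤ, Tendsto (fun n => formAverage (a n) (ℓ n) (c n)
      (fun j => (momentumSymbolDeriv (ρ ^ 2) (zeta (ħ n) (ε n) k j) : ℂ)) (q • k)) U
      (𝓝 (∫ x, fourier (-q) x.1 * forceMap (ρ ^ 2) hr x.2 ∂μ)) := fun q => by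
    refine (hμ q (forceMap (ρ ^ 2) hr)).congr fun n => ?_
    congr 1
    funext j
    simp only [forceMap, ContinuousMap.coe_mk, forceSymbol_sigma hr]
  -- Potential modes not collinear to k have no effect in the limit; this uses the decay of f' at
  -- infinity.
  have h3 : ∀ m : Freq, det k m ≠ 0 → Tendsto (fun n => formAverage (a n) (ℓ n) (c n)
      (fun j => (momentumSymbolDeriv (ρ ^ 2) (zeta (ħ n) (ε n) k j) : ℂ)) m) U (𝓝 0) :=
    fun m hm => (h.tendsto_transverse hm (f := fun x => (momentumSymbolDeriv (ρ ^ 2) x : ℂ))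
      (B := (ρ⁻¹) ^ 2) (K := 2 * (ρ⁻¹) ^ 3)
      (fun x => by
        rw [Complex.norm_real, Real.norm_eq_abs]; exact abs_momentumSymbolDeriv_le hρ x)
      (fun x y => by
        rw [← Complex.ofReal_sub, Complex.norm_real, Real.norm_eq_abs]
        exact momentumSymbolDeriv_lipschitz hρ x y)
      (fun κ hκ => by
        obtain ⟨Z, hZ⟩ := momentumSymbolDeriv_small hρ hκ
        exact ⟨Z, fun x hx => by
          rw [Complex.norm_real, Real.norm_eq_abs]; exact hZ x hx⟩)).mono_left hU
  classical
  -- Only l = q • k survives. As p ↦ p • k is injective, the chosen integer is this q.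
  set lim : Freq → ℂ := fun l => if hl : ∃ q : ℤ, l = q • k then
    ((hl.choose : ℂ) * dot k k) * w l *
      ∫ x, fourier (-(p - hl.choose)) x.1 * forceMap (ρ ^ 2) hr x.2 ∂μ else 0 with hlimdef
  have h4 : Tendsto (fun n => ∑' l, w l * (dot k l * formAverage (a n) (ℓ n) (c n)
      (fun j => (momentumSymbolDeriv (ρ ^ 2) (zeta (ħ n) (ε n) k j) : ℂ)) (p • k - l))) U
      (𝓝 (∑' l, lim l)) := by
    refine tendsto_tsum_of_dominated_convergence
      (bound := fun l => (‖w l‖ * |dot k l|) * (ρ⁻¹) ^ 2)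
      ((h.potential.summable_dot k).mul_right _) (fun l => ?_) (Eventually.of_forall fun n l => ?_)
    · by_cases hl : ∃ q : ℤ, l = q • k
      · have he : lim l = w l * (dot k l *
            ∫ x, fourier (-(p - hl.choose)) x.1 * forceMap (ρ ^ 2) hr x.2 ∂μ) := by
          have hsp := hl.choose_spec
          have : dot k l = hl.choose * dot k k := by
            conv_lhs => rw [hsp]
            exact dot_zsmul _ _ _
          simp only [hlimdef, dif_pos hl, this]
          push_cast
          ring
        rw [he]
        refine Tendsto.const_mul _ (Tendsto.const_mul _ ?_)
        have : p • k - l = (p - hl.choose) • k := by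
          conv_lhs => rw [hl.choose_spec]
          rw [sub_smul]
        rw [this]
        exact h2 _
      · have hdet : det k l ≠ 0 := fun h0 => hl (hk.exists_eq l h0)
        have he : lim l = w l * (dot k l * 0) := by
          simp only [hlimdef, dif_neg hl]; ring
        rw [he]
        refine Tendsto.const_mul _ (Tendsto.const_mul _ (h3 _ ?_))
        rw [det_zsmul_sub]
        exact neg_ne_zero.mpr hdet
    · rw [norm_mul, norm_mul, Complex.norm_real, Real.norm_eq_abs, mul_assoc]
      refine mul_le_mul_of_nonneg_left (mul_le_mul_of_nonneg_left ?_ (abs_nonneg _)) (norm_nonneg _)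
      exact norm_formAverage_le (h.ℓ_pos n) (h.norm_eq n) (fun j => by
        rw [Complex.norm_real, Real.norm_eq_abs]; exact abs_momentumSymbolDeriv_le hρ _) _
  have h5 : ∑' l, lim l = dot k k *
      ∫ x, fourier (-p) x.1 * (averageDeriv w k x.1 * forceMap (ρ ^ 2) hr x.2) ∂μ := by
    rw [← (hasSum_integral_averageDeriv h.potential hk μ p (forceMap (ρ ^ 2) hr)).tsum_eq,
      ← tsum_mul_left, ← hk.injective.tsum_eq (f := lim)]
    · refine tsum_congr fun q => ?_
      have hq : ∃ q' : ℤ, q • k = q' • k := ⟨q, rfl⟩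
      have hch : hq.choose = q := (hk.injective hq.choose_spec).symm
      simp only [hlimdef, dif_pos hq, hch]
      ring
    · intro l hl
      by_contra hn
      apply hl
      simp only [hlimdef]
      rw [dif_neg]
      rintro ⟨q, rfl⟩
      exact hn ⟨q, rfl⟩
  have h6 := (h1.const_mul (p : ℂ)).add (h4.const_mul (((4 * Real.pi ^ 2)⁻¹ : ℝ) : ℂ))
  have h7 := tendsto_nhds_unique h6 (hinv.mono_left hU)
  rw [h5] at h7
  rw [← h7]
  push_cast
  ring

end Regime

/-! ### Measures on the circle and their Fourier coefficients -/

section Circle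

theorem integrable_circle' {σ : Measure UnitAddCircle} [IsFiniteMeasure σ] {g : UnitAddCircle → ℂ}
    (hg : Continuous g) : Integrable g σ :=
  hg.integrable_of_hasCompactSupport (HasCompactSupport.of_compactSpace g)

/-- Integration of continuous functions against a density. -/
def integralCLM (σ : Measure UnitAddCircle) [IsFiniteMeasure σ] (φ : C(UnitAddCircle, ℂ)) :
    C(UnitAddCircle, ℂ) →L[ℂ] ℂ :=
  LinearMap.mkContinuous
    { toFun := fun ψ => ∫ y, ψ y * φ y ∂σ
      map_add' := fun ψ ψ' => by
        simp only [ContinuousMap.add_apply, add_mul]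
        exact integral_add (integrable_circle' (by fun_prop)) (integrable_circle' (by fun_prop))
      map_smul' := fun z ψ => by
        simp only [ContinuousMap.smul_apply, smul_eq_mul, mul_assoc, RingHom.id_apply]
        exact integral_const_mul _ _ }
    (‖φ‖ * σ.real Set.univ) fun ψ => by
      refine (norm_integral_le_of_norm_le_const (C := ‖ψ‖ * ‖φ‖)
        (Eventually.of_forall fun y => ?_)).trans (le_of_eq (by ring))
      rw [norm_mul]
      exact mul_le_mul (ψ.norm_coe_le_norm y) (φ.norm_coe_le_norm y) (norm_nonneg _) (norm_nonneg _)

theorem integralCLM_apply (σ : Measure UnitAddCircle) [IsFiniteMeasure σ]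
    (φ ψ : C(UnitAddCircle, ℂ)) : integralCLM σ φ ψ = ∫ y, ψ y * φ y ∂σ := rfl

/-- Continuous linear maps agreeing on the characters are equal. -/
theorem clm_ext_fourier {A B : C(UnitAddCircle, ℂ) →L[ℂ] ℂ}
    (h : ∀ p : ℤ, A (fourier p) = B (fourier p)) : A = B := by
  refine ContinuousLinearMap.ext_on (s := Set.range fourier) ?_ ?_
  · rw [Submodule.dense_iff_topologicalClosure_eq_top]
    exact span_fourier_closure_eq_top
  · rintro _ ⟨p, rfl⟩
    exact h p

/-- By density of trigonometric polynomials the functional ψ ↦ ∫ ψφ dσ vanishes; taking ψ = conj φ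
gives ∫ |φ|² dσ = 0. -/
theorem ae_eq_zero_of_fourier {σ : Measure UnitAddCircle} [IsFiniteMeasure σ]
    {φ : C(UnitAddCircle, ℂ)} (h : ∀ p : ℤ, ∫ y, fourier p y * φ y ∂σ = 0) :
    σ {y | φ y ≠ 0} = 0 := by
  have h0 : integralCLM σ φ = 0 := clm_ext_fourier fun p => by
    rw [integralCLM_apply, h]; rfl
  have h1 : ∫ y, star φ y * φ y ∂σ = 0 := by
    rw [← integralCLM_apply, h0]; rfl
  have h2 : ∀ y, star φ y * φ y = ((Complex.normSq (φ y) : ℝ) : ℂ) := fun y =>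
    Complex.normSq_eq_conj_mul_self.symm
  simp only [h2] at h1
  rw [integral_complex_ofReal, Complex.ofReal_eq_zero, integral_eq_zero_iff_of_nonneg] at h1
  · have h3 : ∀ᵐ y ∂σ, φ y = 0 := by
      filter_upwards [h1] with y hy
      simpa using hy
    exact ae_iff.mp h3
  · exact fun y => Complex.normSq_nonneg _
  · exact (Complex.continuous_normSq.comp φ.continuous).integrable_of_hasCompactSupport
      (HasCompactSupport.of_compactSpace _)

/-- A measure whose Fourier coefficients decay like `1/p` is absolutely continuous. -/
theorem absolutelyContinuous_of_fourier {σ : Measure UnitAddCircle} [IsFiniteMeasure σ] {D : ℝ}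
    (h : ∀ p : ℤ, |(p : ℝ)| * ‖∫ y, fourier p y ∂σ‖ ≤ D) : σ ≪ AddCircle.haarAddCircle := by
  -- Decay like 1/p makes the coefficients square summable, so they are those of some f in L². The
  -- conjugate is there because the inner product is antilinear in its first argument.
  set b : ℤ → ℂ := fun p => conj (∫ y, fourier p y ∂σ) with hb
  have hbs : Summable fun p => ‖b p‖ ^ 2 := by
    have hs : Summable fun p : ℤ => D ^ 2 * (1 / (p : ℝ) ^ 2) :=
      (Real.summable_one_div_int_pow.mpr one_lt_two).mul_left _
    refine Summable.of_norm_bounded_eventually hs ?_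
    have : ∀ᶠ p : ℤ in cofinite, p ≠ 0 := by
      rw [Filter.eventually_cofinite]
      simp
    filter_upwards [this] with p hp
    have hp' : (0 : ℝ) < |(p : ℝ)| := abs_pos.mpr (by exact_mod_cast hp)
    have h1 := h p
    rw [Real.norm_eq_abs, abs_of_nonneg (by positivity), hb, RCLike.norm_conj, ← sq_abs (p : ℝ),
      mul_one_div, le_div_iff₀ (by positivity), ← mul_pow, mul_comm]
    gcongr
  let B : lp (fun _ : ℤ => ℂ) 2 := ⟨b, memℓp_gen (by simpa using hbs)⟩
  set f : Lp ℂ 2 (AddCircle.haarAddCircle : Measure UnitAddCircle) := fourierBasis.repr.symm B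
    with hf
  set A : C(UnitAddCircle, ℂ) →L[ℂ] ℂ := (innerSL ℂ f).comp
    (ContinuousMap.toLp 2 (AddCircle.haarAddCircle : Measure UnitAddCircle) ℂ) with hA
  -- Integration against σ and the inner product with f agree on characters, hence on all continuous
  -- functions.
  have hAσ : integralCLM σ 1 = A := clm_ext_fourier fun p => by
    have h1 : A (fourier p) = inner ℂ f (fourierBasis p) := by
      rw [coe_fourierBasis]; rfl
    have h2 : inner ℂ (fourierBasis p) f = b p := by
      rw [← HilbertBasis.repr_apply_apply, hf, LinearIsometryEquiv.apply_symm_apply]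
    rw [h1, ← inner_conj_symm, h2, hb, Complex.conj_conj, integralCLM_apply]
    simp
  have hbound : ∀ φ : C(UnitAddCircle, ℂ), ‖∫ y, φ y ∂σ‖ ≤ ‖f‖ *
      ‖ContinuousMap.toLp (E := ℂ) 2 (AddCircle.haarAddCircle : Measure UnitAddCircle) ℂ φ‖ := by
    intro φ
    have h1 : ∫ y, φ y ∂σ = A φ := by
      rw [← hAσ, integralCLM_apply]; simp
    rw [h1]
    exact norm_inner_le_norm (𝕜 := ℂ) f _
  -- Cauchy–Schwarz for a Urysohn function between a compact subset of O and O bounds σ(O) by ‖f‖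
  -- |O|^{1/2}. Absolute continuity follows by outer regularity of Haar measure.
  have hcomp : ∀ O : Set UnitAddCircle, IsOpen O → σ O ≤ ENNReal.ofReal (‖f‖ *
      Real.sqrt ((AddCircle.haarAddCircle : Measure UnitAddCircle).real O)) := by
    intro O hO
    rw [hO.measure_eq_iSup_isCompact]
    refine iSup₂_le fun K hKO => iSup_le fun hK => ?_
    obtain ⟨φ, hφ0, hφ1, hφI⟩ := exists_continuous_zero_one_of_isClosed hO.isClosed_compl
      hK.isClosed (Set.disjoint_left.mpr fun x hx hxK => hx (hKO hxK))
    set ψ : C(UnitAddCircle, ℂ) := ⟨fun y => (φ y : ℂ), by fun_prop⟩ with hψ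
    have h1 : σ.real K ≤ ∫ y, φ y ∂σ := by
      rw [← integral_indicator_one hK.measurableSet]
      refine integral_mono ((integrable_const (1 : ℝ)).indicator hK.measurableSet)
        (φ.continuous.integrable_of_hasCompactSupport (HasCompactSupport.of_compactSpace φ))
        fun y => ?_
      by_cases hy : y ∈ K
      · simp [hy, hφ1 hy]
      · simp [hy, (hφI y).1]
    have h2 : ∫ y, φ y ∂σ ≤ ‖∫ y, ψ y ∂σ‖ := by
      simp only [hψ, ContinuousMap.coe_mk]
      rw [integral_complex_ofReal, Complex.norm_real]
      exact le_abs_self _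
    have h3 : ‖ContinuousMap.toLp (E := ℂ) 2 (AddCircle.haarAddCircle : Measure UnitAddCircle) ℂ ψ‖ ≤
        Real.sqrt ((AddCircle.haarAddCircle : Measure UnitAddCircle).real O) := by
      refine Real.le_sqrt_of_sq_le ?_
      rw [@norm_sq_eq_re_inner ℂ, ContinuousMap.inner_toLp]
      have h4 : ∀ y, ψ y * conj (ψ y) = ((φ y ^ 2 : ℝ) : ℂ) := fun y => by
        simp only [hψ, ContinuousMap.coe_mk, Complex.conj_ofReal]; push_cast; ring
      simp only [h4]
      rw [integral_complex_ofReal]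
      simp only [RCLike.re_to_complex, Complex.ofReal_re]
      rw [← integral_indicator_one hO.measurableSet]
      refine integral_mono ((φ.continuous.pow 2).integrable_of_hasCompactSupport
        (HasCompactSupport.of_compactSpace _))
        ((integrable_const (1 : ℝ)).indicator hO.measurableSet) fun y => ?_
      by_cases hy : y ∈ O
      · simp only [Set.indicator_of_mem hy, Pi.one_apply]
        exact pow_le_one₀ (hφI y).1 (hφI y).2
      · have : φ y = 0 := hφ0 hy
        simp [hy, this]
    have h5 : σ.real K ≤ ‖f‖ *
        Real.sqrt ((AddCircle.haarAddCircle : Measure UnitAddCircle).real O) :=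
      (h1.trans h2).trans ((hbound ψ).trans (mul_le_mul_of_nonneg_left h3 (norm_nonneg _)))
    rw [← ofReal_measureReal (measure_ne_top σ K)]
    exact ENNReal.ofReal_le_ofReal h5
  intro N hN
  by_contra hne
  have hpos : 0 < σ N := pos_iff_ne_zero.mpr hne
  set t := σ.real N with ht
  have htpos : 0 < t := ENNReal.toReal_pos hne (measure_ne_top _ _)
  -- Chosen so that ‖f‖ √η ≤ t/2, which contradicts σ(N) = t > 0.
  set η : ℝ := (t / (2 * (‖f‖ + 1))) ^ 2 with hη
  have hηpos : 0 < η := by positivity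
  obtain ⟨O, hNO, hO, hOη⟩ := Set.exists_isOpen_lt_of_lt N (ENNReal.ofReal η)
    (by rw [hN]; exact ENNReal.ofReal_pos.mpr hηpos)
  have h6 : (AddCircle.haarAddCircle : Measure UnitAddCircle).real O ≤ η :=
    ENNReal.toReal_le_of_le_ofReal hηpos.le hOη.le
  have h7 : σ N ≤ ENNReal.ofReal (t / 2) := by
    refine (measure_mono hNO).trans ((hcomp O hO).trans (ENNReal.ofReal_le_ofReal ?_))
    calc ‖f‖ * Real.sqrt _ ≤ ‖f‖ * Real.sqrt η := by gcongr
      _ = ‖f‖ * (t / (2 * (‖f‖ + 1))) := by rw [hη, Real.sqrt_sq (by positivity)]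
      _ ≤ (‖f‖ + 1) * (t / (2 * (‖f‖ + 1))) := by gcongr; linarith
      _ = t / 2 := by field_simp
  have h8 : t ≤ t / 2 := ENNReal.toReal_le_of_le_ofReal (by positivity) h7
  linarith

end Circle

/-! ### Consequences of the transport equation -/

/-- The part of the position marginal of `μ` carried by `S`. -/
def marginalOn (μ : Measure Phase) (S : Set unitInterval) : Measure UnitAddCircle :=
  (μ.restrict (Prod.snd ⁻¹' S)).map Prod.fst

section Transport

variable {μ : Measure Phase} [IsFiniteMeasure μ]

instance (S : Set unitInterval) : IsFiniteMeasure (marginalOn μ S) := by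
  unfold marginalOn; infer_instance

omit [IsFiniteMeasure μ] in
theorem integral_marginalOn {S : Set unitInterval} (hS : MeasurableSet S) (g : C(UnitAddCircle, ℂ)) :
    ∫ y, g y ∂(marginalOn μ S) = ∫ x, g x.1 * S.indicator 1 x.2 ∂μ := by
  rw [marginalOn, integral_map measurable_fst.aemeasurable
    g.continuous.aestronglyMeasurable, ← integral_indicator (measurable_snd hS)]
  refine integral_congr_ae (Eventually.of_forall fun x => ?_)
  by_cases hx : x.2 ∈ S
  · have : x ∈ (Prod.snd ⁻¹' S : Set Phase) := hx
    simp [hx, this]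
  · have : x ∉ (Prod.snd ⁻¹' S : Set Phase) := hx
    simp [hx, this]

/-- Bounded symbols converging pointwise to the indicator of S isolate the part of μ lying over S,
by dominated convergence. It is applied to S = {0}, zero momentum, and S = {1}, infinite momentum.
-/
theorem tendsto_integral_symbol {g : ℕ → C(unitInterval, ℂ)} {S : Set unitInterval}
    (φ : C(UnitAddCircle, ℂ)) (hg : ∀ n s, ‖g n s‖ ≤ 1)
    (hlim : ∀ s, Tendsto (fun n => g n s) atTop (𝓝 (S.indicator 1 s))) (hS : MeasurableSet S) :
    Tendsto (fun n => ∫ x, φ x.1 * g n x.2 ∂μ) atTop (𝓝 (∫ y, φ y ∂(marginalOn μ S))) := by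
  rw [integral_marginalOn hS]
  refine tendsto_integral_of_dominated_convergence (fun _ => ‖φ‖) (fun n => ?_)
    (integrable_const _) (fun n => Eventually.of_forall fun x => ?_)
    (Eventually.of_forall fun x => ?_)
  · exact (integrable_phase (by fun_prop)).aestronglyMeasurable
  · rw [norm_mul]
    exact (mul_le_of_le_one_right (norm_nonneg _) (hg n x.2)).trans (φ.norm_coe_le_norm _)
  · exact (hlim x.2).const_mul _

/-- As r → ∞, s/(r(1 - s) + s) equals 1 at s = 1 and tends to 0 elsewhere. -/
theorem tendsto_kineticMap (s : unitInterval) :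
    Tendsto (fun n : ℕ => kineticMap (n + 1) n.cast_add_one_pos s) atTop
      (𝓝 (({1} : Set unitInterval).indicator 1 s)) := by
  by_cases hs : s = 1
  · subst hs
    simp [kineticMap, kineticSymbol]
  · have hs1 : (s : ℝ) < 1 := lt_of_le_of_ne s.2.2 fun h => hs (Subtype.ext h)
    rw [Set.indicator_of_notMem (by simpa using hs)]
    have h0 : (0 : ℂ) = ((0 : ℝ) : ℂ) := by simp
    rw [h0]
    refine (Complex.continuous_ofReal.tendsto _).comp ?_
    have h1 : Tendsto (fun n : ℕ => ((n : ℝ) + 1) * (1 - (s : ℝ)) + s) atTop atTop :=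
      tendsto_atTop_add_const_right _ _ ((tendsto_natCast_atTop_atTop.atTop_add
        tendsto_const_nhds).atTop_mul_const (sub_pos.mpr hs1))
    exact h1.const_div_atTop _

/-- As r → 0, r times the force symbol equals 1 at s = 0. For s > 0 the force symbol is continuous
in r at r = 0, so the product tends to 0. -/
theorem tendsto_forceMap (s : unitInterval) :
    Tendsto (fun n : ℕ => (((n : ℝ) + 1)⁻¹ : ℂ) *
      forceMap ((n : ℝ) + 1)⁻¹ (inv_pos.mpr n.cast_add_one_pos) s) atTop
      (𝓝 (({0} : Set unitInterval).indicator 1 s)) := by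
  have hr : Tendsto (fun n : ℕ => ((n : ℝ) + 1)⁻¹) atTop (𝓝 0) :=
    tendsto_inv_atTop_zero.comp (tendsto_natCast_atTop_atTop.atTop_add tendsto_const_nhds)
  by_cases hs : s = 0
  · subst hs
    refine tendsto_const_nhds.congr fun n => ?_
    have : ((n : ℝ) + 1 : ℂ) ≠ 0 := by exact_mod_cast (n.cast_add_one_pos (α := ℝ)).ne'
    simp [forceMap, forceSymbol]
    field_simp
  · have hs0 : (0 : ℝ) < s := lt_of_le_of_ne s.2.1 fun h => hs (Subtype.ext h.symm)
    rw [Set.indicator_of_notMem (by simpa using hs)]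
    have h0 : (0 : ℂ) = ((0 : ℝ) : ℂ) := by simp
    have h1 : Tendsto (fun r : ℝ => r * forceSymbol r s) (𝓝 0) (𝓝 (0 * forceSymbol 0 s)) := by
      have : ContinuousAt (fun r : ℝ => r * forceSymbol r s) 0 := by
        unfold forceSymbol
        refine ContinuousAt.mul continuousAt_id (ContinuousAt.div (by fun_prop) (by fun_prop) ?_)
        simp [hs0.ne']
      exact this.tendsto
    rw [zero_mul] at h1
    rw [h0]
    refine ((Complex.continuous_ofReal.tendsto _).comp (h1.comp hr)).congr fun n => ?_
    simp [forceMap]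

variable {W : C(UnitAddCircle, ℂ)} {C : ℂ}
  (htr : ∀ (p : ℤ) (r : ℝ) (hr : 0 < r), (p : ℂ) * ∫ x, fourier (-p) x.1 * kineticMap r hr x.2 ∂μ +
    C * ∫ x, fourier (-p) x.1 * (W x.1 * forceMap r hr x.2) ∂μ = 0)

theorem norm_kineticMap_le {r : ℝ} (hr : 0 < r) (s : unitInterval) : ‖kineticMap r hr s‖ ≤ 1 := by
  simp only [kineticMap, ContinuousMap.coe_mk, Complex.norm_real]
  exact abs_kineticSymbol_le hr s.2

theorem norm_forceMap_le {r : ℝ} (hr : 0 < r) (s : unitInterval) : ‖forceMap r hr s‖ ≤ r⁻¹ := by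
  simp only [forceMap, ContinuousMap.coe_mk, Complex.norm_real]
  exact abs_forceSymbol_le hr s.2

theorem norm_integral_phase_le {F : Phase → ℂ} {B : ℝ} (hF : ∀ x, ‖F x‖ ≤ B) :
    ‖∫ x, F x ∂μ‖ ≤ B * μ.real Set.univ :=
  norm_integral_le_of_norm_le_const (Eventually.of_forall hF)

include htr

/-- Multiply the transport equation by r and let r → 0: the kinetic term is O(r) and the force term
isolates s = 0. All Fourier coefficients of W against the marginal vanish. -/
theorem marginalOn_zero_critical (hC : C ≠ 0) : marginalOn μ {0} {y | W y ≠ 0} = 0 := by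
  refine ae_eq_zero_of_fourier fun p => ?_
  obtain ⟨p, rfl⟩ : ∃ q, p = -q := ⟨-p, by simp⟩
  have h1 := tendsto_integral_symbol (μ := μ) (S := {0})
    (g := fun n : ℕ => (((n : ℝ) + 1)⁻¹ : ℂ) •
      forceMap ((n : ℝ) + 1)⁻¹ (inv_pos.mpr n.cast_add_one_pos))
    ((fourier (-p) : C(UnitAddCircle, ℂ)) * W) (fun n s => by
      rw [ContinuousMap.smul_apply, norm_smul]
      have h := norm_forceMap_le (inv_pos.mpr (n.cast_add_one_pos (α := ℝ))) s
      rw [inv_inv] at h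
      have h2 : ‖(((n : ℝ) + 1)⁻¹ : ℂ)‖ = ((n : ℝ) + 1)⁻¹ := by
        rw [← Complex.ofReal_one, ← Complex.ofReal_add, ← Complex.ofReal_inv, Complex.norm_real,
          Real.norm_eq_abs, abs_of_nonneg (by positivity)]
      rw [h2]
      calc ((n : ℝ) + 1)⁻¹ * _ ≤ ((n : ℝ) + 1)⁻¹ * ((n : ℝ) + 1) := by gcongr
        _ = 1 := inv_mul_cancel₀ n.cast_add_one_pos.ne')
    tendsto_forceMap (measurableSet_singleton _)
  have hr : Tendsto (fun n : ℕ => ((n : ℝ) + 1)⁻¹) atTop (𝓝 0) :=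
    tendsto_inv_atTop_zero.comp (tendsto_natCast_atTop_atTop.atTop_add tendsto_const_nhds)
  have h2 : Tendsto (fun n : ℕ => ∫ x, ((fourier (-p) : C(UnitAddCircle, ℂ)) * W) x.1 *
      ((((n : ℝ) + 1)⁻¹ : ℂ) •
        forceMap ((n : ℝ) + 1)⁻¹ (inv_pos.mpr n.cast_add_one_pos)) x.2 ∂μ) atTop (𝓝 0) := by
    refine squeeze_zero_norm (a := fun n : ℕ => ((n : ℝ) + 1)⁻¹ *
      (‖C‖⁻¹ * (|(p : ℝ)| * μ.real Set.univ))) (fun n => ?_) (by simpa using hr.mul_const _)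
    have h3 := htr p _ (inv_pos.mpr (n.cast_add_one_pos (α := ℝ)))
    have h4 : ∫ x, ((fourier (-p) : C(UnitAddCircle, ℂ)) * W) x.1 *
      ((((n : ℝ) + 1)⁻¹ : ℂ) •
        forceMap ((n : ℝ) + 1)⁻¹ (inv_pos.mpr n.cast_add_one_pos)) x.2 ∂μ =
        (((n : ℝ) + 1)⁻¹ : ℂ) * ∫ x, fourier (-p) x.1 * (W x.1 *
          forceMap ((n : ℝ) + 1)⁻¹ (inv_pos.mpr n.cast_add_one_pos) x.2) ∂μ := by
      rw [← integral_const_mul]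
      refine integral_congr_ae (Eventually.of_forall fun x => ?_)
      simp only [ContinuousMap.mul_apply, ContinuousMap.smul_apply, smul_eq_mul]
      ring
    have h5 := norm_integral_phase_le (μ := μ) (F := fun x => fourier (-p) x.1 *
      kineticMap ((n : ℝ) + 1)⁻¹ (inv_pos.mpr n.cast_add_one_pos) x.2) (B := 1) fun x => by
        rw [norm_mul, norm_fourier_apply, one_mul]; exact norm_kineticMap_le _ _
    rw [h4, eq_neg_of_add_eq_zero_right h3 |> fun h => (eq_inv_mul_iff_mul_eq₀ hC).mpr h, norm_mul,
      norm_mul, norm_neg, norm_mul, norm_inv, norm_inv, Complex.norm_intCast]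
    have h6 : ‖((n : ℝ) + 1 : ℂ)‖ = (n : ℝ) + 1 := by
      rw [← Complex.ofReal_one, ← Complex.ofReal_add, Complex.norm_real,
          Real.norm_eq_abs, abs_of_nonneg (by positivity)]
    rw [h6]
    rw [one_mul] at h5
    gcongr
  simpa using tendsto_nhds_unique h1 h2

/-- Let r → ∞ in the transport equation: the force term is O(1/r) and the kinetic term isolates s =
1. The part at infinite momentum is therefore equidistributed. -/
theorem marginalOn_one_fourier (p : ℤ) (hp : p ≠ 0) :
    ∫ y, fourier (-p) y ∂(marginalOn μ {1}) = 0 := by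
  have h1 := tendsto_integral_symbol (μ := μ) (S := {1})
    (g := fun n : ℕ => kineticMap (n + 1) n.cast_add_one_pos) (fourier (-p))
    (fun n s => norm_kineticMap_le _ s) tendsto_kineticMap (measurableSet_singleton _)
  have hr : Tendsto (fun n : ℕ => ((n : ℝ) + 1)⁻¹) atTop (𝓝 0) :=
    tendsto_inv_atTop_zero.comp (tendsto_natCast_atTop_atTop.atTop_add tendsto_const_nhds)
  refine tendsto_nhds_unique h1 (squeeze_zero_norm (a := fun n : ℕ => |(p : ℝ)|⁻¹ * (‖C‖ *
    (‖W‖ * ((n : ℝ) + 1)⁻¹ * μ.real Set.univ))) (fun n => ?_) ?_)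
  · have h3 := htr p _ (n.cast_add_one_pos (α := ℝ))
    have h5 := norm_integral_phase_le (μ := μ) (F := fun x => fourier (-p) x.1 *
      (W x.1 * forceMap ((n : ℝ) + 1) n.cast_add_one_pos x.2)) (B := ‖W‖ * ((n : ℝ) + 1)⁻¹)
      fun x => by
        rw [norm_mul, norm_fourier_apply, one_mul, norm_mul]
        exact mul_le_mul (W.norm_coe_le_norm _) (norm_forceMap_le _ _) (norm_nonneg _)
          (norm_nonneg _)
    have hp' : (p : ℂ) ≠ 0 := by exact_mod_cast hp
    rw [eq_neg_of_add_eq_zero_left h3 |> fun h => (eq_inv_mul_iff_mul_eq₀ hp').mpr h, norm_mul,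
      norm_neg, norm_mul, norm_inv, Complex.norm_intCast]
    gcongr
  · have := ((hr.const_mul ‖W‖).mul_const (μ.real Set.univ)).const_mul ‖C‖
    simpa using this.const_mul (|(p : ℝ)|⁻¹)

/-- For r = 1 the kinetic symbol is s itself and the force term is bounded uniformly in p, so the
projection of s μ has Fourier coefficients O(1/|p|) and is absolutely continuous. Off s = 0 the
measures μ and s μ have the same null sets. -/
theorem marginalOn_compl_absolutelyContinuous :
    marginalOn μ {0}ᶜ ≪ (AddCircle.haarAddCircle : Measure UnitAddCircle) := by
  set q : Phase → ℝ≥0∞ := fun x => ENNReal.ofReal x.2 with hq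
  have hqm : Measurable q := by fun_prop
  have hqt : ∀ᵐ x ∂μ, q x < ⊤ := Eventually.of_forall fun x => ENNReal.ofReal_lt_top
  have hfin : IsFiniteMeasure (μ.withDensity q) := by
    refine isFiniteMeasure_withDensity (ne_of_lt ?_)
    calc ∫⁻ x, q x ∂μ ≤ ∫⁻ _, 1 ∂μ := lintegral_mono fun x => by
          simpa [hq] using ENNReal.ofReal_le_ofReal x.2.2.2
      _ < ⊤ := by simp
  set lam := (μ.withDensity q).map Prod.fst with hlam
  have h1 : lam ≪ (AddCircle.haarAddCircle : Measure UnitAddCircle) := by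
    refine absolutelyContinuous_of_fourier (D := ‖C‖ * (‖W‖ * μ.real Set.univ)) fun p => ?_
    obtain ⟨p, rfl⟩ : ∃ q, p = -q := ⟨-p, by simp⟩
    have h2 : ∫ y, fourier (-p) y ∂lam = ∫ x, fourier (-p) x.1 * kineticMap 1 one_pos x.2 ∂μ := by
      rw [hlam, integral_map measurable_fst.aemeasurable
        (fourier (-p)).continuous.aestronglyMeasurable,
        integral_withDensity_eq_integral_toReal_smul hqm hqt]
      refine integral_congr_ae (Eventually.of_forall fun x => ?_)
      have : (x.2 : ℝ) = (kineticSymbol 1 x.2) := by simp [kineticSymbol]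
      simp only [hq, ENNReal.toReal_ofReal x.2.2.1, kineticMap, ContinuousMap.coe_mk, ← this]
      rw [Complex.real_smul, mul_comm]
    have h3 := htr p 1 one_pos
    have h5 := norm_integral_phase_le (μ := μ) (F := fun x => fourier (-p) x.1 *
      (W x.1 * forceMap 1 one_pos x.2)) (B := ‖W‖) fun x => by
        rw [norm_mul, norm_fourier_apply, one_mul, norm_mul]
        have := norm_forceMap_le one_pos x.2
        rw [inv_one] at this
        exact (mul_le_of_le_one_right (norm_nonneg _) this).trans (W.norm_coe_le_norm _)
    rw [h2, Int.cast_neg, abs_neg, ← Complex.norm_intCast, ← norm_mul, eq_neg_of_add_eq_zero_left h3,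
      norm_neg, norm_mul]
    gcongr
  refine Measure.AbsolutelyContinuous.trans ?_ h1
  refine Measure.AbsolutelyContinuous.map ?_ measurable_fst
  refine Measure.AbsolutelyContinuous.mk fun s hs hs0 => ?_
  rw [Measure.restrict_apply hs]
  rw [withDensity_apply_eq_zero hqm] at hs0
  refine measure_mono_null (fun x hx => ?_) hs0
  refine ⟨?_, hx.1⟩
  have hx2 : x.2 ≠ 0 := hx.2
  have : (0 : ℝ) < x.2 := lt_of_le_of_ne x.2.2.1 fun h => hx2 (Subtype.ext h.symm)
  simpa [hq] using this

end Transport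

/-! ### Decomposition of the limit in each direction and control of the masses -/

namespace Regime

variable {w : Freq → ℂ} {ħ ε a ℓ : ℕ → ℝ} {c : ℕ → ℝ → SeqL2}

/-- In a primitive direction, the limit splits into a part carried by the critical set of the
averaged potential, an absolutely continuous part, and an equidistributed part. -/
theorem exists_direction_measures (h : Regime w ħ ε a ℓ c) {k : Freq} (hk : IsPrimitive k)
    (U : Ultrafilter ℕ) (hU : (U : Filter ℕ) ≤ atTop) :
    ∃ σ ρ : Measure UnitAddCircle, IsFiniteMeasure σ ∧ IsFiniteMeasure ρ ∧
      σ {y | averageDeriv w k y ≠ 0} = 0 ∧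
      ρ ≪ (AddCircle.haarAddCircle : Measure UnitAddCircle) ∧
      (∀ p : ℤ, p ≠ 0 → Tendsto (fun n => formAverage (a n) (ℓ n) (c n) (fun _ => 1) (p • k)) U
        (𝓝 (∫ y, fourier (-p) y ∂σ + ∫ y, fourier (-p) y ∂ρ))) ∧
      ∀ η : ℝ, 0 < η → ∀ᶠ m : ℕ in atTop, ∀ᶠ n in (U : Filter ℕ),
        σ.real Set.univ + ρ.real Set.univ - η ≤ (formAverage (a n) (ℓ n) (c n)
          (fun j => ((((m : ℝ) + 1) / ((m + 1) + zeta (ħ n) (ε n) k j ^ 2) : ℝ) : ℂ)) 0).re := by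
  obtain ⟨μ, hfin, hμ⟩ := h.exists_phase_measure k U hU
  have htr := h.transport_equation hk U hU μ hμ
  have hC : ((dot k k / (4 * Real.pi ^ 2) : ℝ) : ℂ) ≠ 0 := by
    have := hk.dot_pos
    exact_mod_cast (by positivity : dot k k / (4 * Real.pi ^ 2) ≠ 0)
  have hm1 : MeasurableSet ({0}ᶜ \ {1} : Set unitInterval) :=
    (measurableSet_singleton _).compl.diff (measurableSet_singleton _)
  have hsplit : ∀ φ : C(UnitAddCircle, ℂ), ∫ x, φ x.1 ∂μ = ∫ y, φ y ∂(marginalOn μ {0}) +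
      ∫ y, φ y ∂(marginalOn μ ({0}ᶜ \ {1})) + ∫ y, φ y ∂(marginalOn μ {1}) := by
    intro φ
    have hint : ∀ S : Set unitInterval, MeasurableSet S →
        Integrable (fun x : Phase => φ x.1 * S.indicator 1 x.2) μ := fun S hS => by
      refine Integrable.mono' (integrable_const ‖φ‖) ?_ (Eventually.of_forall fun x => ?_)
      · exact ((φ.continuous.measurable.comp measurable_fst).mul
          ((measurable_one.indicator hS).comp measurable_snd)).aestronglyMeasurable
      · rw [norm_mul]
        refine (mul_le_of_le_one_right (norm_nonneg _) ?_).trans (φ.norm_coe_le_norm _)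
        by_cases hx : x.2 ∈ S <;> simp [hx]
    rw [integral_marginalOn (measurableSet_singleton _), integral_marginalOn hm1,
      integral_marginalOn (measurableSet_singleton _),
      ← integral_add (hint _ (measurableSet_singleton _)) (hint _ hm1),
      ← integral_add (f := fun x : Phase => φ x.1 * ({0} : Set unitInterval).indicator 1 x.2 +
          φ x.1 * ({0}ᶜ \ {1} : Set unitInterval).indicator 1 x.2)
        ((hint _ (measurableSet_singleton _)).add (hint _ hm1))
        (hint _ (measurableSet_singleton _))]
    refine integral_congr_ae (Eventually.of_forall fun x => ?_)
    by_cases h0 : x.2 = 0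
    · simp [h0]
    · by_cases h1 : x.2 = 1 <;> simp [h0, h1]
  refine ⟨marginalOn μ {0}, marginalOn μ ({0}ᶜ \ {1}), inferInstance, inferInstance,
    marginalOn_zero_critical htr hC, ?_, fun p hp => ?_, fun η hη => ?_⟩
  · refine Measure.AbsolutelyContinuous.trans ?_ (marginalOn_compl_absolutelyContinuous htr)
    refine Measure.AbsolutelyContinuous.map ?_ measurable_fst
    exact (Measure.restrict_mono (Set.preimage_mono Set.sdiff_subset) le_rfl).absolutelyContinuous
  · have h1 := hμ p 1
    simp only [ContinuousMap.one_apply, mul_one] at h1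
    rw [hsplit, marginalOn_one_fourier htr p hp, add_zero] at h1
    exact h1
  -- Together σ and ρ carry the mass of μ at finite momentum s < 1. It is the limit as r → ∞ of the
  -- integral of 1 minus the kinetic symbol, that is of r/(r + ζ²), the cutoff of
  -- `eventually_sum_le`.
  · have hmass : ((marginalOn μ {0}).real Set.univ : ℝ) +
        (marginalOn μ ({0}ᶜ \ {1})).real Set.univ =
        μ.real Set.univ - (marginalOn μ {1}).real Set.univ := by
      have := hsplit 1
      simp only [ContinuousMap.one_apply, integral_const, Complex.real_smul, mul_one]
        at this
      have h2 : μ.real Set.univ = (marginalOn μ {0}).real Set.univ +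
        (marginalOn μ ({0}ᶜ \ {1})).real Set.univ + (marginalOn μ {1}).real Set.univ := by
        exact_mod_cast this
      linarith
    have h1 := tendsto_integral_symbol (μ := μ) (S := {1})
      (g := fun n : ℕ => kineticMap (n + 1) n.cast_add_one_pos) 1
      (fun n s => norm_kineticMap_le _ s) tendsto_kineticMap (measurableSet_singleton _)
    have h2 : Tendsto (fun m : ℕ => (∫ x, (1 - kineticMap (m + 1) m.cast_add_one_pos) x.2 ∂μ).re)
        atTop (𝓝 ((marginalOn μ {0}).real Set.univ +
        (marginalOn μ ({0}ᶜ \ {1})).real Set.univ)) := by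
      have h3 := (Complex.continuous_re.tendsto _).comp (h1.const_sub (μ.real Set.univ : ℂ))
      have h4 : ((μ.real Set.univ : ℂ) - ∫ y, (1 : C(UnitAddCircle, ℂ)) y ∂(marginalOn μ {1})).re =
          (marginalOn μ {0}).real Set.univ + (marginalOn μ ({0}ᶜ \ {1})).real Set.univ := by
        rw [hmass]; simp
      rw [h4] at h3
      refine h3.congr fun m => ?_
      simp only [Function.comp_apply, ContinuousMap.one_apply, one_mul, ContinuousMap.sub_apply]
      rw [integral_sub (integrable_const _) (integrable_phase (by fun_prop))]
      simp
    have h5 := h2.eventually_const_lt (sub_lt_self _ hη)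
    filter_upwards [h5] with m hm
    have h6 := (Complex.continuous_re.tendsto _).comp
      (hμ 0 (1 - kineticMap (m + 1) m.cast_add_one_pos))
    simp only [neg_zero, fourier_zero, one_mul, zero_smul] at h6
    filter_upwards [h6.eventually_const_lt hm] with n hn
    refine hn.le.trans (le_of_eq ?_)
    simp only [Function.comp_apply]
    congr 2
    funext j
    have hr : (0 : ℝ) < (m : ℝ) + 1 := m.cast_add_one_pos
    simp only [ContinuousMap.sub_apply, ContinuousMap.one_apply, kineticMap, ContinuousMap.coe_mk]
    rw [kineticSymbol_sigma hr, momentumSymbol, ← Complex.ofReal_one, ← Complex.ofReal_sub]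
    congr 1
    have : (m : ℝ) + 1 + zeta (ħ n) (ε n) k j ^ 2 ≠ 0 := by positivity
    field_simp
    ring

/-- The structure of the limits of the quadratic forms. -/
theorem exists_direction_family (h : Regime w ħ ε a ℓ c) {K : Set Freq}
    (hK : ∀ k ∈ K, IsPrimitive k) (hdet : ∀ k ∈ K, ∀ k' ∈ K, k ≠ k' → det k k' ≠ 0)
    {N : Freq → ℂ} (hN : ∀ m, Tendsto (fun n => formAverage (a n) (ℓ n) (c n) (fun _ => 1) m) atTop
      (𝓝 (N m))) :
    ∃ σ ρ : K → Measure UnitAddCircle, (∀ k, IsFiniteMeasure (σ k)) ∧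
      (∀ k, IsFiniteMeasure (ρ k)) ∧
      (∀ k, σ k {y | averageDeriv w k y ≠ 0} = 0) ∧
      (∀ k, ρ k ≪ (AddCircle.haarAddCircle : Measure UnitAddCircle)) ∧
      (∀ (k : K) (p : ℤ), p ≠ 0 →
        N (p • (k : Freq)) = ∫ y, fourier (-p) y ∂(σ k) + ∫ y, fourier (-p) y ∂(ρ k)) ∧
      ∀ F : Finset K, ∑ k ∈ F, ((σ k).real Set.univ + (ρ k).real Set.univ) ≤ 1 := by
  classical
  -- One ultrafilter serves all directions, so that the estimates for finitely many of them hold at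
  -- a common index n.
  set U : Ultrafilter ℕ := hyperfilter ℕ
  have hU : (U : Filter ℕ) ≤ atTop := Nat.hyperfilter_le_atTop
  choose σ ρ hσ hρ hcrit hac hlim hmass using fun k : K =>
    h.exists_direction_measures (hK k k.2) U hU
  refine ⟨σ, ρ, hσ, hρ, hcrit, hac, fun k p hp =>
    tendsto_nhds_unique ((hN _).mono_left hU) (hlim k p hp), fun F => ?_⟩
  refine le_of_forall_pos_le_add fun η hη => ?_
  set M : ℝ := (F.card : ℝ) with hM
  have hM0 : 0 ≤ M := Nat.cast_nonneg _
  -- Each of the M directions loses η', and the disjointness estimate loses η' once more.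
  set η' := η / (1 + M) with hη'
  have hη'0 : 0 < η' := by positivity
  have h1 : ∀ᶠ m : ℕ in atTop, ∀ k ∈ F, ∀ᶠ n in (U : Filter ℕ),
      (σ k).real Set.univ + (ρ k).real Set.univ - η' ≤ (formAverage (a n) (ℓ n) (c n)
        (fun j => ((((m : ℝ) + 1) / ((m + 1) + zeta (ħ n) (ε n) k j ^ 2) : ℝ) : ℂ)) 0).re :=
    (Finset.eventually_all F).mpr fun k _ => hmass k η' hη'0
  obtain ⟨m, hm⟩ := h1.exists
  have h2 := (h.eventually_sum_le (F.image Subtype.val) (fun k hk k' hk' hkk' => by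
    simp only [Finset.mem_image] at hk hk'
    obtain ⟨x, -, rfl⟩ := hk
    obtain ⟨y, -, rfl⟩ := hk'
    exact hdet x x.2 y y.2 hkk') (r := (m : ℝ) + 1) m.cast_add_one_pos hη'0).filter_mono hU
  have h3 : ∀ᶠ n in (U : Filter ℕ), ∀ k ∈ F,
      (σ k).real Set.univ + (ρ k).real Set.univ - η' ≤ (formAverage (a n) (ℓ n) (c n)
        (fun j => ((((m : ℝ) + 1) / ((m + 1) + zeta (ħ n) (ε n) k j ^ 2) : ℝ) : ℂ)) 0).re :=
    (Finset.eventually_all F).mpr hm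
  obtain ⟨n, hn2, hn3⟩ := (h2.and h3).exists
  rw [Finset.sum_image (fun x _ y _ hxy => Subtype.ext hxy)] at hn2
  have h4 := Finset.sum_le_sum hn3
  rw [Finset.sum_sub_distrib, Finset.sum_const, nsmul_eq_mul] at h4
  have h5 : (F.card : ℝ) * η' + η' = η := by rw [hη', ← hM]; field_simp; ring
  linarith

end Regime

/-! ### Primitive frequencies -/

/-- Representatives of the directions of the nonzero frequencies. -/
def directions : Set Freq := {k | IsCoprime (k 0) (k 1) ∧ (0 < k 0 ∨ (k 0 = 0 ∧ 0 < k 1))}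

theorem isPrimitive_of_isCoprime {k : Freq} (hk : IsCoprime (k 0) (k 1)) : IsPrimitive k := by
  obtain ⟨u, v, huv⟩ := hk
  refine ⟨?_, fun l hl => ⟨u * l 0 + v * l 1, ?_⟩⟩
  · rintro rfl
    simp at huv
  · simp only [det] at hl
    ext i
    fin_cases i
    · simp only [Fin.zero_eta, Pi.smul_apply, smul_eq_mul]
      linear_combination (-l 0) * huv - v * hl
    · simp only [Fin.mk_one, Pi.smul_apply, smul_eq_mul]
      linear_combination (-l 1) * huv + u * hl

/-- Collinear primitive vectors are equal or opposite, and the sign normalization in `directions`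
excludes the second case. -/
theorem det_ne_zero_of_mem_directions {k k' : Freq} (hk : k ∈ directions) (hk' : k' ∈ directions)
    (hne : k ≠ k') : det k k' ≠ 0 := by
  intro h0
  obtain ⟨p, hp⟩ := (isPrimitive_of_isCoprime hk.1).exists_eq k' h0
  have h0' : det k' k = 0 := by
    simp only [det] at h0 ⊢; linarith
  obtain ⟨q, hq⟩ := (isPrimitive_of_isCoprime hk'.1).exists_eq k h0'
  have hpq : p * q = 1 := by
    have h1 : (p * q) • k = (1 : ℤ) • k := by
      conv_rhs => rw [one_smul, hq, hp]
      rw [smul_smul, mul_comm]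
    exact (isPrimitive_of_isCoprime hk.1).injective h1
  rcases Int.isUnit_iff.mp (IsUnit.of_mul_eq_one q hpq) with rfl | rfl
  · exact hne (by rw [hp, one_smul])
  · have h1 : k' 0 = -k 0 := by rw [hp]; simp
    have h2 : k' 1 = -k 1 := by rw [hp]; simp
    rcases hk.2 with h | h <;> rcases hk'.2 with h' | h' <;> omega

/-- Divide by the greatest common divisor, then choose the sign. -/
theorem exists_direction {m : Freq} (hm : m ≠ 0) :
    ∃ k ∈ directions, ∃ p : ℤ, p ≠ 0 ∧ m = p • k := by
  have hne : m 0 ≠ 0 ∨ m 1 ≠ 0 := by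
    by_contra! h
    exact hm (by ext i; fin_cases i <;> simp [h])
  obtain ⟨g, a, b, hg, hab, ha, hb⟩ : ∃ g a b : ℤ, g ≠ 0 ∧ IsCoprime a b ∧ m 0 = g * a ∧
      m 1 = g * b := by
    have hpos : 0 < Int.gcd (m 0) (m 1) := by
      rw [Int.gcd_pos_iff]; exact hne
    obtain ⟨a, b, hab, ha, hb⟩ := Int.exists_gcd_one hpos
    exact ⟨Int.gcd (m 0) (m 1), a, b, by exact_mod_cast hpos.ne', Int.isCoprime_iff_gcd_eq_one.mpr hab,
      by rw [mul_comm]; exact ha, by rw [mul_comm]; exact hb⟩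
  by_cases hpos : 0 < a ∨ (a = 0 ∧ 0 < b)
  · refine ⟨![a, b], ⟨by simpa using hab, by simpa using hpos⟩, g, hg, ?_⟩
    ext i; fin_cases i <;> simp [ha, hb]
  · refine ⟨![-a, -b], ⟨by simpa using hab.neg_neg, ?_⟩, -g, by simpa using hg, ?_⟩
    · have hb0 : ¬(a = 0 ∧ b = 0) := by
        rintro ⟨rfl, rfl⟩; simp at ha hb; omega
      simp; omega
    · ext i; fin_cases i <;> simp [ha, hb]

/-- A Bezout vector for `k`. -/
def bezout (k : Freq) : Freq := by
  classical
  exact if h : ∃ q : Freq, q 0 * k 0 + q 1 * k 1 = 1 then h.choose else 0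

theorem bezout_spec {k : Freq} (hk : k ∈ directions) :
    bezout k 0 * k 0 + bezout k 1 * k 1 = 1 := by
  obtain ⟨u, v, huv⟩ := hk.1
  have h : ∃ q : Freq, q 0 * k 0 + q 1 * k 1 = 1 := ⟨![u, v], by simpa using huv⟩
  rw [bezout, dif_pos h]
  exact h.choose_spec

/-! ### Characters and lifts -/

/-- The homomorphism `x ↦ k · x` from the torus to the circle. -/
def character (k : Freq) (x : Torus) : UnitAddCircle := ∑ i, k i • x i

theorem continuous_character (k : Freq) : Continuous (character k) := by
  unfold character; fun_prop

theorem character_add (k : Freq) (x y : Torus) :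
    character k (x + y) = character k x + character k y := by
  simp only [character, Pi.add_apply, smul_add, Finset.sum_add_distrib]

theorem mFourier_eq (m : Freq) (x : Torus) :
    UnitAddTorus.mFourier m x = fourier 1 (character m x) := by
  simp only [UnitAddTorus.mFourier, ContinuousMap.coe_mk, character, Fin.sum_univ_two,
    Fin.prod_univ_two, fourier_apply, one_smul, AddCircle.toCircle_add, Circle.coe_mul]

theorem fourier_character (p : ℤ) (k : Freq) (x : Torus) :
    fourier p (character k x) = UnitAddTorus.mFourier (p • k) x := by
  rw [mFourier_eq, fourier_apply, fourier_apply, one_smul]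
  congr 2
  simp only [character, Finset.smul_sum, Pi.smul_apply, smul_smul, smul_eq_mul]

/-- The parametrization `(y, s) ↦ y p + s k^⊥` of the torus, where `p · k = 1`. -/
def liftMap (k : Freq) (z : UnitAddCircle × UnitAddCircle) : Torus :=
  fun i => bezout k i • z.1 + (![-k 1, k 0] : Freq) i • z.2

theorem continuous_liftMap (k : Freq) : Continuous (liftMap k) := by
  unfold liftMap; fun_prop

theorem character_liftMap (k m : Freq) (z : UnitAddCircle × UnitAddCircle) :
    character m (liftMap k z) = (bezout k 0 * m 0 + bezout k 1 * m 1) • z.1 + det k m • z.2 := by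
  simp only [character, liftMap, Fin.sum_univ_two, det, Matrix.cons_val_zero, Matrix.cons_val_one]
  module

theorem character_liftMap_self {k : Freq} (hk : k ∈ directions) (z : UnitAddCircle × UnitAddCircle) :
    character k (liftMap k z) = z.1 := by
  rw [character_liftMap, bezout_spec hk, show det k k = 0 by simp only [det]; ring]
  simp

theorem volume_circle : (volume : Measure UnitAddCircle) = AddCircle.haarAddCircle := by
  rw [AddCircle.volume_eq_smul_haarAddCircle]; simp

theorem integral_mFourier (m : Freq) :
    ∫ x : Torus, UnitAddTorus.mFourier m x = if m = 0 then 1 else 0 := by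
  have h1 : ∫ x : Torus, UnitAddTorus.mFourier m x = ∏ i, ∫ y : UnitAddCircle, fourier (m i) y := by
    rw [← integral_fintype_prod_volume_eq_prod (fun i y => fourier (m i) y)]; rfl
  rw [h1]
  simp only [volume_circle, integral_fourier]
  split_ifs with h
  · simp [h]
  · obtain ⟨i, hi⟩ := Function.ne_iff.mp h
    exact Finset.prod_eq_zero (Finset.mem_univ i) (if_neg hi)

theorem integrable_torus {μ : Measure Torus} [IsFiniteMeasure μ] {E : Type*} [NormedAddCommGroup E]
    [SecondCountableTopologyEither Torus E]
    {g : Torus → E} (hg : Continuous g) : Integrable g μ :=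
  hg.integrable_of_hasCompactSupport (HasCompactSupport.of_compactSpace g)

/-- Finite measures on the torus are determined by their Fourier coefficients. -/
theorem measure_ext_mFourier {μ μ' : Measure Torus} [IsFiniteMeasure μ] [IsFiniteMeasure μ']
    (h : ∀ m : Freq, ∫ x, UnitAddTorus.mFourier m x ∂μ = ∫ x, UnitAddTorus.mFourier m x ∂μ') :
    μ = μ' := by
  have hclm : ∀ (μ : Measure Torus) [IsFiniteMeasure μ], ∃ A : C(Torus, ℂ) →L[ℂ] ℂ,
      ∀ φ, A φ = ∫ x, φ x ∂μ := fun μ _ => ⟨LinearMap.mkContinuous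
        { toFun := fun φ => ∫ x, φ x ∂μ
          map_add' := fun φ ψ => integral_add (integrable_torus φ.continuous)
            (integrable_torus ψ.continuous)
          map_smul' := fun z φ => integral_smul z _ } (μ.real Set.univ) fun φ => by
        rw [mul_comm]
        exact norm_integral_le_of_norm_le_const (Eventually.of_forall φ.norm_coe_le_norm),
        fun φ => rfl⟩
  obtain ⟨A, hA⟩ := hclm μ
  obtain ⟨A', hA'⟩ := hclm μ'
  have hAA : A = A' := by
    refine ContinuousLinearMap.ext_on (s := Set.range UnitAddTorus.mFourier) ?_ ?_
    · rw [Submodule.dense_iff_topologicalClosure_eq_top]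
      exact UnitAddTorus.span_mFourier_closure_eq_top
    · rintro _ ⟨m, rfl⟩
      rw [hA, hA', h]
  refine ext_of_forall_integral_eq_of_IsFiniteMeasure fun f => ?_
  have h1 := hA ⟨fun x => (f x : ℂ), by fun_prop⟩
  rw [hAA, hA'] at h1
  simp only [ContinuousMap.coe_mk, integral_complex_ofReal] at h1
  exact_mod_cast h1.symm

theorem measure_ext_fourier {μ μ' : Measure UnitAddCircle} [IsFiniteMeasure μ] [IsFiniteMeasure μ']
    (h : ∀ p : ℤ, ∫ y, fourier p y ∂μ = ∫ y, fourier p y ∂μ') : μ = μ' := by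
  have hAA : integralCLM μ 1 = integralCLM μ' 1 := clm_ext_fourier fun p => by
    simpa [integralCLM_apply] using h p
  refine ext_of_forall_integral_eq_of_IsFiniteMeasure fun f => ?_
  have h1 := DFunLike.congr_fun hAA ⟨fun x => (f x : ℂ), by fun_prop⟩
  simp only [integralCLM_apply, ContinuousMap.coe_mk, ContinuousMap.one_apply, mul_one,
    integral_complex_ofReal] at h1
  exact_mod_cast h1

/-- The measure on the torus with marginal `θ` in the direction `k`, uniform along the closed
geodesics orthogonal to `k`. -/
def lift (k : Freq) (θ : Measure UnitAddCircle) : Measure Torus :=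
  (θ.prod AddCircle.haarAddCircle).map (liftMap k)

instance (k : Freq) (θ : Measure UnitAddCircle) [IsFiniteMeasure θ] : IsFiniteMeasure (lift k θ) := by
  unfold lift; infer_instance

theorem lift_univ (k : Freq) (θ : Measure UnitAddCircle) [IsFiniteMeasure θ] :
    lift k θ Set.univ = θ Set.univ := by
  rw [lift, Measure.map_apply (continuous_liftMap k).measurable MeasurableSet.univ,
    Set.preimage_univ, Measure.prod_apply MeasurableSet.univ]
  simp

theorem integral_lift (k : Freq) (θ : Measure UnitAddCircle) [IsFiniteMeasure θ]
    {E : Type*} [NormedAddCommGroup E] [NormedSpace ℝ E] [SecondCountableTopologyEither Torus E]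
    [SecondCountableTopologyEither (UnitAddCircle × UnitAddCircle) E]
    {g : Torus → E} (hg : Continuous g) :
    ∫ x, g x ∂(lift k θ) = ∫ y, ∫ s, g (liftMap k (y, s)) ∂AddCircle.haarAddCircle ∂θ := by
  rw [lift, integral_map (continuous_liftMap k).measurable.aemeasurable
    hg.aestronglyMeasurable, integral_prod]
  exact (hg.comp (continuous_liftMap k)).integrable_of_hasCompactSupport
    (HasCompactSupport.of_compactSpace _)

/-- In the coordinates (y, s), the character of index m oscillates along the geodesic variable s
with frequency det k m, so integration in s removes it unless m is collinear to k. Hence lifts in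
different directions have no common nonzero Fourier mode. -/
theorem integral_mFourier_lift (k m : Freq) (θ : Measure UnitAddCircle) [IsFiniteMeasure θ] :
    ∫ x, UnitAddTorus.mFourier m x ∂(lift k θ) =
      if det k m = 0 then ∫ y, fourier (bezout k 0 * m 0 + bezout k 1 * m 1) y ∂θ else 0 := by
  rw [integral_lift k θ (UnitAddTorus.mFourier m).continuous]
  have h1 : ∀ y s : UnitAddCircle, UnitAddTorus.mFourier m (liftMap k (y, s)) =
      fourier (bezout k 0 * m 0 + bezout k 1 * m 1) y * fourier (det k m) s := fun y s => by
    rw [mFourier_eq, character_liftMap]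
    simp only [fourier_apply, one_smul, AddCircle.toCircle_add, Circle.coe_mul]
  simp only [h1, integral_const_mul, integral_fourier]
  split_ifs <;> simp

theorem integral_mFourier_lift_zsmul {k : Freq} (hk : k ∈ directions) (p : ℤ)
    (θ : Measure UnitAddCircle) [IsFiniteMeasure θ] :
    ∫ x, UnitAddTorus.mFourier (p • k) x ∂(lift k θ) = ∫ y, fourier p y ∂θ := by
  rw [integral_mFourier_lift, if_pos (by simp only [det, Pi.smul_apply, smul_eq_mul]; ring)]
  have : bezout k 0 * (p • k) 0 + bezout k 1 * (p • k) 1 = p := by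
    simp only [Pi.smul_apply, smul_eq_mul]
    linear_combination p * bezout_spec hk
  rw [this]

theorem lift_haar {k : Freq} (hk : k ∈ directions) :
    lift k AddCircle.haarAddCircle = (volume : Measure Torus) := by
  refine measure_ext_mFourier fun m => ?_
  rw [integral_mFourier]
  by_cases hd : det k m = 0
  · obtain ⟨p, rfl⟩ := (isPrimitive_of_isCoprime hk.1).exists_eq m hd
    rw [integral_mFourier_lift_zsmul hk, integral_fourier]
    have hp : p • k = 0 ↔ p = 0 := by
      rw [smul_eq_zero, or_iff_left (isPrimitive_of_isCoprime hk.1).ne_zero]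
    simp only [hp]
  · rw [integral_mFourier_lift, if_neg hd, if_neg]
    rintro rfl
    simp [det] at hd

theorem lift_absolutelyContinuous {k : Freq} (hk : k ∈ directions) {θ : Measure UnitAddCircle}
    [IsFiniteMeasure θ] (hθ : θ ≪ AddCircle.haarAddCircle) : lift k θ ≪ (volume : Measure Torus) := by
  rw [← lift_haar hk]
  exact (hθ.prod Measure.AbsolutelyContinuous.rfl).map (continuous_liftMap k).measurable

/-! ### Reconstruction of the limit measure -/

section Reconstruction

variable {ν : Measure Torus} [IsProbabilityMeasure ν] {σ ρ : directions → Measure UnitAddCircle}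
  [∀ k, IsFiniteMeasure (σ k)] [∀ k, IsFiniteMeasure (ρ k)]

theorem tsum_mass_le
    (hsum : ∀ F : Finset directions, ∑ k ∈ F, ((σ k).real Set.univ + (ρ k).real Set.univ) ≤ 1) :
    ∑' k, (σ k Set.univ + ρ k Set.univ) ≤ 1 := by
  rw [ENNReal.tsum_eq_iSup_sum]
  refine iSup_le fun F => ?_
  have h1 : ∑ k ∈ F, (σ k Set.univ + ρ k Set.univ) =
      ENNReal.ofReal (∑ k ∈ F, ((σ k).real Set.univ + (ρ k).real Set.univ)) := by
    rw [ENNReal.ofReal_sum_of_nonneg fun k _ => by positivity]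
    refine Finset.sum_congr rfl fun k _ => ?_
    rw [ENNReal.ofReal_add (by positivity) (by positivity), ofReal_measureReal, ofReal_measureReal]
  rw [h1]
  exact ENNReal.ofReal_le_one.mpr (hsum F)

theorem isFiniteMeasure_sum_lift {θ : directions → Measure UnitAddCircle}
    [∀ k, IsFiniteMeasure (θ k)] (h : ∑' k, θ k Set.univ ≤ 1) :
    IsFiniteMeasure (Measure.sum fun k : directions => lift k (θ k)) := by
  refine ⟨?_⟩
  rw [Measure.sum_apply _ MeasurableSet.univ]
  simp only [lift_univ]
  exact h.trans_lt ENNReal.one_lt_top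

/-- A probability measure whose Fourier coefficients are those of a family of measures on the
circle is the sum of the lifts of this family and a constant. -/
theorem eq_sum_lift_add {θ : directions → Measure UnitAddCircle} [∀ k, IsFiniteMeasure (θ k)]
    (h : ∑' k, θ k Set.univ ≤ 1)
    (hN : ∀ (k : directions) (p : ℤ), p ≠ 0 →
      ∫ x, UnitAddTorus.mFourier (p • (k : Freq)) x ∂ν = ∫ y, fourier p y ∂(θ k)) :
    ν = (Measure.sum fun k : directions => lift k (θ k)) +
      (1 - ∑' k, θ k Set.univ) • (volume : Measure Torus) := by
  have hfin := isFiniteMeasure_sum_lift h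
  set M := Measure.sum fun k : directions => lift k (θ k) with hM
  have hMu : M Set.univ = ∑' k, θ k Set.univ := by
    rw [hM, Measure.sum_apply _ MeasurableSet.univ]
    simp only [lift_univ]
  -- The missing mass, spread uniformly: it affects the zero Fourier coefficient only.
  set C := 1 - ∑' k, θ k Set.univ with hC
  have hCt : C ≠ ⊤ := ne_top_of_le_ne_top ENNReal.one_ne_top tsub_le_self
  have hfin2 : IsFiniteMeasure (C • (volume : Measure Torus)) := Measure.smul_finite _ hCt
  refine measure_ext_mFourier fun m => ?_
  rw [integral_add_measure (integrable_torus (UnitAddTorus.mFourier m).continuous)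
    (integrable_torus (UnitAddTorus.mFourier m).continuous), integral_smul_measure,
    integral_mFourier]
  by_cases hm : m = 0
  · subst hm
    have h1 : M Set.univ + C = 1 := by rw [hMu, hC]; exact add_tsub_cancel_of_le h
    have h2 : M.real Set.univ + C.toReal = 1 := by
      rw [measureReal_def, ← ENNReal.toReal_add (measure_ne_top _ _) hCt, h1, ENNReal.toReal_one]
    simp only [UnitAddTorus.mFourier_zero, ContinuousMap.one_apply, integral_const, probReal_univ,
      Complex.real_smul, mul_one, if_true, Complex.ofReal_one]
    exact_mod_cast h2.symm
  · rw [if_neg hm, smul_zero, add_zero, hM, integral_sum_measure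
      (by rw [← hM]; exact integrable_torus (UnitAddTorus.mFourier m).continuous)]
    obtain ⟨k, hk, p, hp, rfl⟩ := exists_direction hm
    rw [tsum_eq_single ⟨k, hk⟩, integral_mFourier_lift_zsmul hk, hN ⟨k, hk⟩ p hp]
    intro k' hk'
    rw [integral_mFourier_lift, if_neg]
    have h1 : det k' (p • k) = p * det k' k := by
      simp only [det, Pi.smul_apply, smul_eq_mul]; ring
    rw [h1]
    exact mul_ne_zero hp (det_ne_zero_of_mem_directions k'.2 hk fun h => hk' (Subtype.ext h))

/-- Decomposition of the limit measure. -/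
theorem eq_add_sum_lift
    (hρ : ∀ k, ρ k ≪ (AddCircle.haarAddCircle : Measure UnitAddCircle))
    (hN : ∀ (k : directions) (p : ℤ), p ≠ 0 →
      ∫ x, UnitAddTorus.mFourier (p • (k : Freq)) x ∂ν =
        ∫ y, fourier p y ∂(σ k) + ∫ y, fourier p y ∂(ρ k))
    (hsum : ∀ F : Finset directions, ∑ k ∈ F, ((σ k).real Set.univ + (ρ k).real Set.univ) ≤ 1) :
    ∃ R : Measure Torus, R ≪ volume ∧ ν = R + Measure.sum fun k : directions => lift k (σ k) := by
  have h := eq_sum_lift_add (ν := ν) (θ := fun k => σ k + ρ k)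
    (by simpa using tsum_mass_le hsum) fun k p hp => by
      rw [hN k p hp, integral_add_measure (integrable_circle' (fourier p).continuous)
        (integrable_circle' (fourier p).continuous)]
  refine ⟨(Measure.sum fun k : directions => lift k (ρ k)) +
    (1 - ∑' k, (σ k + ρ k) Set.univ) • (volume : Measure Torus), ?_, ?_⟩
  · refine Measure.AbsolutelyContinuous.add_left ?_ (Measure.smul_absolutelyContinuous)
    exact Measure.absolutelyContinuous_sum_left fun k => lift_absolutelyContinuous k.2 (hρ k)
  · have h1 : ∀ k : directions, lift k (σ k + ρ k) = lift k (σ k) + lift k (ρ k) := fun k => by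
      rw [lift, Measure.add_prod, Measure.map_add _ _ (continuous_liftMap _).measurable]; rfl
    conv_lhs => rw [h]
    simp only [h1]
    rw [← Measure.sum_add_sum]
    abel

/-- The limit measure does not charge the level sets of `k · x` above noncritical values. -/
theorem measure_level_eq_zero {w : Freq → ℂ} {k : directions}
    (hσ : σ k {y | averageDeriv w k y ≠ 0} = 0)
    (hρ : ρ k ≪ (AddCircle.haarAddCircle : Measure UnitAddCircle))
    (hN : ∀ p : ℤ, p ≠ 0 →
      ∫ x, UnitAddTorus.mFourier (p • (k : Freq)) x ∂ν =
        ∫ y, fourier p y ∂(σ k) + ∫ y, fourier p y ∂(ρ k))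
    (hsum : (σ k).real Set.univ + (ρ k).real Set.univ ≤ 1)
    {y : UnitAddCircle} (hy : averageDeriv w k y ≠ 0) :
    ν {x | character k x = y} = 0 := by
  have hmeas := (continuous_character k).measurable
  set C : ℝ := 1 - ((σ k).real Set.univ + (ρ k).real Set.univ) with hC
  have hC0 : 0 ≤ C := by linarith
  set H : Measure UnitAddCircle := ENNReal.ofReal C • AddCircle.haarAddCircle with hH
  have hHf : IsFiniteMeasure H := Measure.smul_finite _ ENNReal.ofReal_ne_top
  have hfin : IsFiniteMeasure (ν.map (character k)) := inferInstance
  -- The nonzero Fourier coefficients agree by hypothesis, and C adjusts the total mass. Since ρ and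
  -- Haar measure have no atoms, an atom can come only from σ, which lives on the critical values.
  have h : ν.map (character k) = σ k + ρ k + H := by
    refine measure_ext_fourier fun p => ?_
    rw [integral_map hmeas.aemeasurable (fourier p).continuous.aestronglyMeasurable,
      integral_add_measure (integrable_circle' (fourier p).continuous)
        (integrable_circle' (fourier p).continuous),
      integral_add_measure (integrable_circle' (fourier p).continuous)
        (integrable_circle' (fourier p).continuous), hH, integral_smul_measure, integral_fourier,
      ENNReal.toReal_ofReal hC0]
    simp only [fourier_character]
    split_ifs with hp
    · subst hp
      simp only [zero_smul, UnitAddTorus.mFourier_zero, ContinuousMap.one_apply, integral_const,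
        probReal_univ, fourier_zero, Complex.real_smul, mul_one, hC]
      push_cast
      ring
    · rw [hN p hp, smul_zero, add_zero]
  have h0 : (AddCircle.haarAddCircle : Measure UnitAddCircle) {y} = 0 := by
    rw [← volume_circle, ← Metric.closedBall_zero, AddCircle.volume_closedBall]
    simp
  have h1 : ν {x | character k x = y} = ν.map (character k) {y} := by
    rw [Measure.map_apply hmeas (measurableSet_singleton y)]; rfl
  have h2 : σ k {y} = 0 := measure_mono_null (by simpa using hy) hσ
  rw [h1, h, Measure.add_apply, Measure.add_apply, h2, hρ h0, hH, Measure.smul_apply, h0]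
  simp

end Reconstruction

/-! ### Barycenters and closed convex hulls of measures -/

open scoped BoundedContinuousFunction

section Barycenter

variable {Y : Type*} [MeasurableSpace Y] [TopologicalSpace Y] [OpensMeasurableSpace Y]

/-- The weak topology is induced by integrals of nonnegative test functions. Taking these integrals
in ℝ makes real convexity available, whereas finite measures themselves form a module over ℝ≥0 only.
-/
theorem isInducing_integral : IsInducing
    fun (m : FiniteMeasure Y) (f : Y →ᵇ ℝ≥0) => ∫ x, (f x : ℝ) ∂(m : Measure Y) := by
  have h1 : IsInducing (fun m : FiniteMeasure Y => m.toWeakDualBCNN) := ⟨rfl⟩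
  have h2 : IsInducing (fun (φ : WeakDual ℝ≥0 (Y →ᵇ ℝ≥0)) (f : Y →ᵇ ℝ≥0) => φ f) := ⟨rfl⟩
  have h3 : IsInducing (fun (φ : (Y →ᵇ ℝ≥0) → ℝ≥0) (f : Y →ᵇ ℝ≥0) => (φ f : ℝ)) :=
    IsInducing.piMap (f := fun (_ : Y →ᵇ ℝ≥0) (x : ℝ≥0) => (x : ℝ)) fun _ =>
      NNReal.isEmbedding_coe.isInducing
  have h4 := h3.comp (h2.comp h1)
  convert h4 using 1
  funext m f
  exact (BoundedContinuousFunction.toReal_lintegral_coe_eq_integral f (m : Measure Y)).symm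

theorem integrable_nnreal (m : FiniteMeasure Y) (f : Y →ᵇ ℝ≥0) :
    Integrable (fun x => (f x : ℝ)) (m : Measure Y) :=
  BoundedContinuousFunction.integrable_of_nnreal (m : Measure Y) f

/-- The barycenter of a probability measure carried by `A` belongs to the closed convex hull
of `A`. -/
theorem mem_closure_convexHull_of_barycenter {X : Type*} [MeasurableSpace X] (P : Measure X)
    [IsProbabilityMeasure P] (A : Set (FiniteMeasure Y)) (G : X → FiniteMeasure Y)
    (hG : ∀ᵐ x ∂P, G x ∈ A) (m : FiniteMeasure Y)
    (hint : ∀ f : Y →ᵇ ℝ≥0, Integrable (fun x => ∫ y, (f y : ℝ) ∂(G x : Measure Y)) P)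
    (hm : ∀ f : Y →ᵇ ℝ≥0, ∫ y, (f y : ℝ) ∂(m : Measure Y) =
      ∫ x, ∫ y, (f y : ℝ) ∂(G x : Measure Y) ∂P) :
    m ∈ closure (convexHull ℝ≥0 A) := by
  rw [isInducing_integral.closure_eq_preimage_closure_image, Set.mem_preimage, mem_closure_iff_nhds]
  intro t ht
  rw [nhds_pi, Filter.mem_pi] at ht
  obtain ⟨I, hI, t', ht', hsub⟩ := ht
  have : Fintype I := hI.fintype
  -- A weak neighbourhood involves finitely many test functions, so the question is finite
  -- dimensional: the mean of a function with values in a closed convex subset of ℝ^I belongs to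
  -- that subset.
  set Φ : FiniteMeasure Y → (I → ℝ) := fun m f => ∫ y, (f.1 y : ℝ) ∂(m : Measure Y) with hΦ
  have hconv : Convex ℝ (Φ '' convexHull ℝ≥0 A) := by
    rintro _ ⟨x, hx, rfl⟩ _ ⟨y, hy, rfl⟩ a b ha hb hab
    lift a to ℝ≥0 using ha
    lift b to ℝ≥0 using hb
    refine ⟨a • x + b • y,
      convex_convexHull ℝ≥0 A hx hy zero_le zero_le (by exact_mod_cast hab), ?_⟩
    funext f
    simp only [hΦ, FiniteMeasure.toMeasure_add, FiniteMeasure.toMeasure_smul]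
    rw [integral_add_measure (((integrable_nnreal x f.1)).smul_measure_nnreal)
      (((integrable_nnreal y f.1)).smul_measure_nnreal), integral_smul_nnreal_measure,
      integral_smul_nnreal_measure]
    rfl
  have hmem : Φ m ∈ closure (Φ '' convexHull ℝ≥0 A) := by
    have h1 : Φ m = ∫ x, Φ (G x) ∂P := by
      funext f
      rw [eval_integral (f := fun x => Φ (G x)) fun f => hint f.1]
      exact hm f.1
    rw [h1]
    refine hconv.closure.integral_mem isClosed_closure ?_ (Integrable.of_eval fun f => hint f.1)
    filter_upwards [hG] with x hx
    exact subset_closure ⟨G x, subset_convexHull _ _ hx, rfl⟩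
  rw [mem_closure_iff_nhds] at hmem
  obtain ⟨_, hx, x, hxS, rfl⟩ := hmem (Set.univ.pi fun f : I => t' f)
    (set_pi_mem_nhds Set.finite_univ fun f _ => ht' f)
  refine ⟨_, hsub ?_, x, hxS, rfl⟩
  intro f hf
  exact hx ⟨f, hf⟩ (Set.mem_univ _)

end Barycenter

section SumLift

theorem integral_lift_dirac (k : Freq) (y : UnitAddCircle) {g : Torus → ℝ} (hg : Continuous g) :
    ∫ x, g x ∂(lift k (Measure.dirac y)) =
      ∫ s, g (liftMap k (y, s)) ∂AddCircle.haarAddCircle := by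
  rw [integral_lift k _ hg]
  exact integral_dirac (fun y => ∫ s, g (liftMap k (y, s)) ∂AddCircle.haarAddCircle) y

/-- A normalized sum of lifts is a limit of convex combinations of lifts of Dirac masses. -/
theorem sum_lift_mem_closure_convexHull {σ : directions → Measure UnitAddCircle}
    [∀ k, IsFiniteMeasure (σ k)] {α : ℝ≥0} (hα : α ≠ 0) (hsum : ∑' k, σ k Set.univ = α)
    {Z : directions → Set UnitAddCircle} (hZ : ∀ k, MeasurableSet (Z k)) (hσ : ∀ k, σ k (Z k)ᶜ = 0)
    {A : Set (FiniteMeasure Torus)}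
    (hA : ∀ k, ∀ y ∈ Z k, (⟨lift k (Measure.dirac y), inferInstance⟩ : FiniteMeasure Torus) ∈ A)
    {m : FiniteMeasure Torus}
    (hm : (Measure.sum fun k : directions => lift k (σ k)) = α • (m : Measure Torus)) :
    m ∈ closure (convexHull ℝ≥0 A) := by
  -- The disjoint union of the σ k, viewed as a measure on pairs (k, y). Normalized by α it is the
  -- probability whose barycenter, for the map (k, y) ↦ lift of the Dirac mass at y, is m.
  set P₀ : Measure (directions × UnitAddCircle) :=
    Measure.sum fun k => (σ k).map (Prod.mk k) with hP₀
  have hP₀u : P₀ Set.univ = α := by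
    rw [hP₀, Measure.sum_apply _ MeasurableSet.univ, ← hsum]
    refine tsum_congr fun k => ?_
    rw [Measure.map_apply measurable_prodMk_left MeasurableSet.univ, Set.preimage_univ]
  have hP₀f : IsFiniteMeasure P₀ := ⟨by rw [hP₀u]; exact ENNReal.coe_lt_top⟩
  set P : Measure (directions × UnitAddCircle) := α⁻¹ • P₀ with hP
  have hPp : IsProbabilityMeasure P := ⟨by
    rw [hP, Measure.smul_apply, hP₀u, ENNReal.smul_def, smul_eq_mul, ← ENNReal.coe_mul,
      inv_mul_cancel₀ hα, ENNReal.coe_one]⟩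
  have hsm : ∀ f : Torus →ᵇ ℝ≥0, StronglyMeasurable fun x : directions × UnitAddCircle =>
      ∫ s, (f (liftMap x.1 (x.2, s)) : ℝ) ∂AddCircle.haarAddCircle := fun f => by
    refine Measurable.stronglyMeasurable (measurable_from_prod_countable_right fun k => ?_)
    refine (StronglyMeasurable.integral_prod_right'
      (f := fun z : UnitAddCircle × UnitAddCircle => (f (liftMap k z) : ℝ)) ?_).measurable
    exact (NNReal.continuous_coe.comp
      (f.continuous.comp (continuous_liftMap k))).stronglyMeasurable
  have hbd : ∀ (f : Torus →ᵇ ℝ≥0) (x : directions × UnitAddCircle),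
      ‖∫ s, (f (liftMap x.1 (x.2, s)) : ℝ) ∂AddCircle.haarAddCircle‖ ≤ nndist f 0 := fun f x => by
    refine (norm_integral_le_of_norm_le_const (C := nndist f 0)
      (Eventually.of_forall fun s => ?_)).trans (by simp)
    rw [Real.norm_eq_abs, NNReal.abs_eq]
    exact_mod_cast BoundedContinuousFunction.NNReal.upper_bound f _
  have hint₀ : ∀ f : Torus →ᵇ ℝ≥0, Integrable (fun x : directions × UnitAddCircle =>
      ∫ s, (f (liftMap x.1 (x.2, s)) : ℝ) ∂AddCircle.haarAddCircle) P₀ := fun f =>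
    Integrable.mono' (integrable_const _) (hsm f).aestronglyMeasurable (Eventually.of_forall (hbd f))
  have hG : ∀ (f : Torus →ᵇ ℝ≥0) (x : directions × UnitAddCircle),
      ∫ z, (f z : ℝ) ∂(lift x.1 (Measure.dirac x.2)) =
      ∫ s, (f (liftMap x.1 (x.2, s)) : ℝ) ∂AddCircle.haarAddCircle := fun f x =>
    integral_lift_dirac _ _ (NNReal.continuous_coe.comp f.continuous)
  refine mem_closure_convexHull_of_barycenter P A
    (fun x => ⟨lift x.1 (Measure.dirac x.2), inferInstance⟩) ?_ m (fun f => ?_) fun f => ?_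
  · have h1 : P {x | x.2 ∈ Z x.1}ᶜ = 0 := by
      have hms : MeasurableSet {x : directions × UnitAddCircle | x.2 ∈ Z x.1}ᶜ := by
        refine MeasurableSet.compl ?_
        have : {x : directions × UnitAddCircle | x.2 ∈ Z x.1} = ⋃ k, {k} ×ˢ Z k := by
          ext ⟨k, y⟩
          simp only [Set.mem_ofPred_eq, Set.mem_iUnion, Set.mem_prod, Set.mem_singleton_iff]
          exact ⟨fun h => ⟨k, rfl, h⟩, fun ⟨_, h, h'⟩ => h ▸ h'⟩
        rw [this]
        exact MeasurableSet.iUnion fun k => (measurableSet_singleton k).prod (hZ k)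
      rw [hP, Measure.smul_apply, hP₀, Measure.sum_apply _ hms]
      simp only [Measure.map_apply measurable_prodMk_left hms]
      have : ∀ k, σ k (Prod.mk k ⁻¹' {x : directions × UnitAddCircle | x.2 ∈ Z x.1}ᶜ) = 0 := hσ
      simp only [this, tsum_zero, smul_zero]
    filter_upwards [compl_mem_ae_iff.mpr h1] with x hx
    rw [compl_compl] at hx
    exact hA x.1 x.2 hx
  · simp only [FiniteMeasure.toMeasure_mk, hG]
    exact (hint₀ f).smul_measure_nnreal
  · simp only [FiniteMeasure.toMeasure_mk, hG]
    have hf : Continuous fun z => (f z : ℝ) := NNReal.continuous_coe.comp f.continuous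
    have h2 : (α : ℝ) * ∫ z, (f z : ℝ) ∂(m : Measure Torus) =
        ∑' k : directions, ∫ y, ∫ s, (f (liftMap k (y, s)) : ℝ) ∂AddCircle.haarAddCircle ∂(σ k) := by
      have h3 := integral_smul_nnreal_measure (μ := (m : Measure Torus)) (fun z => (f z : ℝ)) α
      rw [← hm, integral_sum_measure] at h3
      · rw [← smul_eq_mul, ← NNReal.smul_def, ← h3]
        exact tsum_congr fun k => integral_lift k _ hf
      · rw [hm]; exact (integrable_nnreal m f).smul_measure_nnreal
    rw [hP, integral_smul_nnreal_measure, hP₀, integral_sum_measure (by rw [← hP₀]; exact hint₀ f)]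
    have h4 : ∀ k : directions, ∫ x, ∫ s, (f (liftMap x.1 (x.2, s)) : ℝ) ∂AddCircle.haarAddCircle
        ∂((σ k).map (Prod.mk k)) =
        ∫ y, ∫ s, (f (liftMap k (y, s)) : ℝ) ∂AddCircle.haarAddCircle ∂(σ k) := fun k =>
      integral_map measurable_prodMk_left.aemeasurable (hsm f).aestronglyMeasurable
    simp only [h4]
    rw [← h2, NNReal.smul_def, smul_eq_mul, NNReal.coe_inv, inv_mul_cancel_left₀]
    exact_mod_cast hα

end SumLift

/-! ### Averages of the potential along closed geodesics -/

/-- The primitive velocity orthogonal to `k`. -/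
def perp (k : Freq) : Plane := !₂[-(k 1 : ℝ), (k 0 : ℝ)]

theorem proj_smul_perp (k : Freq) (s : ℝ) (i : Fin 2) :
    proj (s • perp k) i = (![-k 1, k 0] : Freq) i • (s : UnitAddCircle) := by
  rw [← AddCircle.coe_zsmul]
  fin_cases i <;> simp [proj, perp, mul_comm]

theorem proj_add (y z : Plane) : proj (y + z) = proj y + proj z := by
  funext i; simp [proj]

theorem isPeriod_perp (k : Freq) : IsPeriod (perp k) 1 := by
  refine ⟨one_pos, ?_⟩
  funext i
  rw [proj_smul_perp]
  have : ((1 : ℝ) : UnitAddCircle) = 0 := AddCircle.coe_period 1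
  rw [this, smul_zero]; rfl

theorem perp_mem_periodicDirections {k : Freq} (hk : k ∈ directions) :
    perp k ∈ periodicDirections := by
  refine ⟨fun h => (isPrimitive_of_isCoprime hk.1).ne_zero ?_, 1, isPeriod_perp k⟩
  have h0 := congrFun (congrArg WithLp.ofLp h) 0
  have h1 := congrFun (congrArg WithLp.ofLp h) 1
  simp [perp] at h0 h1
  ext i; fin_cases i <;> simp [h0, h1]

theorem continuous_proj : Continuous proj := by
  unfold proj
  exact continuous_pi fun i => (AddCircle.continuous_mk' 1).comp (by fun_prop)

theorem continuous_geodesic (x : Torus) (ξ : Plane) : Continuous (geodesic x ξ) := by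
  unfold geodesic
  exact continuous_const.add (continuous_proj.comp (by fun_prop))

theorem character_proj (l : Freq) (h : Plane) :
    character l (proj h) = ((∑ i, (l i : ℝ) * h i : ℝ) : UnitAddCircle) := by
  simp only [character, proj, Fin.sum_univ_two, ← AddCircle.coe_zsmul, ← AddCircle.coe_add,
    zsmul_eq_mul]

theorem character_geodesic (k l : Freq) (x : Torus) (s : ℝ) :
    character l (geodesic x (perp k) s) = character l x + det k l • (s : UnitAddCircle) := by
  rw [geodesic, character_add, character_proj, ← AddCircle.coe_zsmul]
  congr 2
  simp [perp, det, Fin.sum_univ_two]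
  ring

/-- The primitive of g minus its linear growth is continuous and periodic, hence bounded; after
division by T it disappears. -/
theorem tendsto_average_of_periodic {g : ℝ → ℝ} (hg : Continuous g) (hp : Function.Periodic g 1) :
    Tendsto (fun T : ℝ => T⁻¹ * ∫ s in (0 : ℝ)..T, g s) atTop (𝓝 (∫ s in (0 : ℝ)..1, g s)) := by
  set m := ∫ s in (0 : ℝ)..1, g s with hm
  set H : ℝ → ℝ := fun T => (∫ s in (0 : ℝ)..T, g s) - T * m with hH
  have hHc : Continuous H := by
    have := intervalIntegral.continuous_primitive (μ := volume)
      (fun a b => hg.intervalIntegrable a b) 0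
    fun_prop
  have hHp : Function.Periodic H 1 := fun T => by
    have h1 : ∫ s in (0 : ℝ)..T + 1, g s = (∫ s in (0 : ℝ)..T, g s) + ∫ s in T..T + 1, g s :=
      (intervalIntegral.integral_add_adjacent_intervals (hg.intervalIntegrable _ _)
        (hg.intervalIntegrable _ _)).symm
    have h2 : ∫ s in T..T + 1, g s = m := by
      have := hp.intervalIntegral_add_eq T 0
      rwa [zero_add] at this
    simp only [hH, h1, h2]
    ring
  obtain ⟨B, hB⟩ := hHp.isBounded_of_continuous one_ne_zero hHc |>.exists_norm_le
  have h1 : Tendsto (fun T : ℝ => T⁻¹ * H T) atTop (𝓝 0) := by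
    refine squeeze_zero_norm' (a := fun T => T⁻¹ * B) ?_ (by
      simpa using tendsto_inv_atTop_zero.mul_const B)
    filter_upwards [eventually_gt_atTop 0] with T hT
    rw [norm_mul, norm_inv, Real.norm_of_nonneg hT.le]
    exact mul_le_mul_of_nonneg_left (hB _ (Set.mem_range_self T)) (by positivity)
  have h2 := h1.add_const m
  rw [zero_add] at h2
  refine h2.congr' ?_
  filter_upwards [eventually_gt_atTop 0] with T hT
  simp only [hH]
  field_simp
  ring

/-- `V` is the sum of its Fourier series with coefficients `w`. -/
def HasFourierSeries (V : Torus → ℝ) (w : Freq → ℂ) : Prop :=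
  ∀ x, HasSum (fun l => w l * UnitAddTorus.mFourier l x) (V x : ℂ)

/-- The average of the potential along the geodesics orthogonal to `k`. -/
def lineAverage (w : Freq → ℂ) (k : Freq) (y : UnitAddCircle) : ℂ :=
  ∑' q : ℤ, w (q • k) * fourier q y

section Average

variable {V : Torus → ℝ} {w : Freq → ℂ} (hV : Continuous V) (hw : IsPotential w)
  (hVw : HasFourierSeries V w)

include hw in
theorem averageDeriv_apply {k : Freq} (hk : IsPrimitive k) (y : UnitAddCircle) :
    averageDeriv w k y = ∑' q : ℤ, (q : ℂ) * w (q • k) * fourier q y := by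
  rw [averageDeriv, ← ContinuousMap.tsum_apply (hw.summable_averageDeriv hk)]
  rfl

include hw in
theorem hasDerivAt_lineAverage {k : Freq} (hk : IsPrimitive k) (t : ℝ) :
    HasDerivAt (fun t : ℝ => lineAverage w k (t : UnitAddCircle))
      (2 * Real.pi * Complex.I * averageDeriv w k (t : UnitAddCircle)) t := by
  rw [averageDeriv_apply hw hk, ← tsum_mul_left]
  refine hasDerivAt_tsum (g := fun (q : ℤ) (t : ℝ) => w (q • k) * fourier q (t : UnitAddCircle))
    (g' := fun (q : ℤ) (t : ℝ) => 2 * Real.pi * Complex.I *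
      ((q : ℂ) * w (q • k) * fourier q (t : UnitAddCircle))) (y₀ := 0)
    ((hw.summable_line hk).mul_left (2 * Real.pi)) (fun q t => ?_) (fun q t => ?_) ?_ t
  · have := (hasDerivAt_fourier 1 q t).const_mul (w (q • k))
    refine this.congr_deriv ?_
    simp
    ring
  · rw [norm_mul, norm_mul _ (fourier q _), norm_fourier_apply, mul_one]
    simp [abs_of_pos Real.pi_pos]
  · refine Summable.of_norm_bounded (hw.summable.comp_injective hk.injective) fun q => ?_
    rw [norm_mul, norm_fourier_apply, mul_one]
    rfl

-- Along the velocity orthogonal to k, the mode l oscillates with the integer frequency det k l.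
-- Averaging over the period 1 keeps the modes with det k l = 0, which are the multiples of k.
include hV hw hVw in
theorem geodesicAverage_perp {k : Freq} (hk : IsPrimitive k) (x : Torus) :
    geodesicAverage V x (perp k) = (lineAverage w k (character k x)).re := by
  have hc : Continuous fun s : ℝ => V (geodesic x (perp k) s) := hV.comp (continuous_geodesic _ _)
  have hper : Function.Periodic (fun s : ℝ => V (geodesic x (perp k) s)) 1 := fun s => by
    simp only [geodesic]
    rw [add_smul, proj_add, (isPeriod_perp k).2, add_zero]
  rw [geodesicAverage, (tendsto_average_of_periodic hc hper).limUnder_eq,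
    ← Complex.ofReal_re (∫ s in (0 : ℝ)..1, V (geodesic x (perp k) s)),
    ← intervalIntegral.integral_ofReal]
  congr 1
  have h1 : ∀ s : ℝ, HasSum (fun l => w l * UnitAddTorus.mFourier l x *
      fourier (det k l) (s : UnitAddCircle)) (V (geodesic x (perp k) s) : ℂ) := fun s => by
    refine (hVw _).congr_fun (fun l => ?_) |> id
    rw [mFourier_eq, mFourier_eq, character_geodesic]
    simp only [fourier_apply, one_smul, AddCircle.toCircle_add, Circle.coe_mul]
    ring
  have h2 := intervalIntegral.hasSum_integral_of_dominated_convergence (μ := volume) (a := 0)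
    (b := 1) (F := fun (l : Freq) (s : ℝ) => w l * UnitAddTorus.mFourier l x *
      fourier (det k l) (s : UnitAddCircle)) (f := fun s => (V (geodesic x (perp k) s) : ℂ))
    (bound := fun l _ => ‖w l‖)
    (fun l => Continuous.aestronglyMeasurable (continuous_const.mul
      ((fourier (det k l)).continuous.comp (AddCircle.continuous_mk' 1))))
    (fun l => Eventually.of_forall fun s _ => by
      rw [norm_mul, norm_fourier_apply, mul_one, mFourier_eq, norm_mul, norm_fourier_apply, mul_one])
    (Eventually.of_forall fun s _ => hw.summable)
    (by simp)
    (Eventually.of_forall fun s _ => h1 s)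
  have h3 : ∀ l : Freq, ∫ s in (0 : ℝ)..1, w l * UnitAddTorus.mFourier l x *
      fourier (det k l) (s : UnitAddCircle) =
      if det k l = 0 then w l * UnitAddTorus.mFourier l x else 0 := fun l => by
    rw [intervalIntegral.integral_const_mul]
    have := UnitAddCircle.intervalIntegral_preimage 0 (fun s => (fourier (det k l) s : ℂ))
    rw [zero_add, volume_circle, integral_fourier] at this
    rw [this]
    split_ifs <;> simp
  simp only [h3] at h2
  rw [← h2.tsum_eq, lineAverage, ← hk.injective.tsum_eq]
  · refine tsum_congr fun q => ?_
    rw [if_pos (by simp only [det, Pi.smul_apply, smul_eq_mul]; ring), fourier_character]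
  · intro l hl
    by_cases hd : det k l = 0
    · obtain ⟨p, hp⟩ := hk.exists_eq l hd
      exact ⟨p, hp.symm⟩
    · simp [hd] at hl

include hV hw hVw in
/-- Points above critical values of the averaged potential are critical. -/
theorem mem_criticalSet {k : Freq} (hk : k ∈ directions) {x : Torus}
    (hx : averageDeriv w k (character k x) = 0) : x ∈ criticalSet V := by
  have hk' := isPrimitive_of_isCoprime hk.1
  refine ⟨perp k, perp_mem_periodicDirections hk, ?_⟩
  obtain ⟨t, ht⟩ := QuotientAddGroup.mk_surjective (character k x)
  have ht' : (t : UnitAddCircle) = character k x := ht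
  have h1 := hasDerivAt_lineAverage hw hk' t
  rw [ht', hx, mul_zero] at h1
  have h2 : HasDerivAt (fun t : ℝ => (lineAverage w k (t : UnitAddCircle)).re) 0 t := by
    have := Complex.reCLM.hasFDerivAt.comp_hasDerivAt t h1
    rw [map_zero] at this
    exact this
  -- The average depends on x only through k·x, so its differential is the derivative of
  -- `lineAverage` times the linear form h ↦ k·h.
  set A : Plane →L[ℝ] ℝ := (k 0 : ℝ) • EuclideanSpace.proj 0 + (k 1 : ℝ) • EuclideanSpace.proj 1
    with hA
  have h3 : HasFDerivAt (fun h : Plane => t + A h) A 0 := A.hasFDerivAt.const_add t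
  have h4 : HasDerivAt (fun t : ℝ => (lineAverage w k (t : UnitAddCircle)).re) 0 (t + A 0) := by
    simpa using h2
  have h5 := h4.comp_hasFDerivAt (0 : Plane) h3
  rw [zero_smul] at h5
  refine h5.congr_of_eventuallyEq (Eventually.of_forall fun h => ?_)
  simp only [Function.comp_apply]
  rw [geodesicAverage_perp hV hw hVw hk', character_add, character_proj, ← ht',
    ← AddCircle.coe_add]
  simp [hA, Fin.sum_univ_two]

theorem eq_geodesic (k : Freq) (y : UnitAddCircle) (s : ℝ) :
    liftMap k (y, (s : UnitAddCircle)) = geodesic (liftMap k (y, 0)) (perp k) s := by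
  funext i
  simp only [geodesic, Pi.add_apply, proj_smul_perp, liftMap, smul_zero, add_zero]

include hV hw hVw in
/-- Lifts of Dirac masses at critical values are uniform measures along critical geodesics. -/
theorem lift_dirac_mem {k : Freq} (hk : k ∈ directions) {y : UnitAddCircle}
    (hy : averageDeriv w k y = 0) : ∃ γ : Set Torus, γ ⊆ criticalSet V ∧
      IsNormalizedLebesgueAlong γ (lift k (Measure.dirac y)) := by
  refine ⟨Set.range (geodesic (liftMap k (y, 0)) (perp k)), ?_, liftMap k (y, 0), perp k,
    perp_mem_periodicDirections hk, 1, isPeriod_perp k, rfl, ?_⟩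
  · rintro _ ⟨s, rfl⟩
    refine mem_criticalSet hV hw hVw hk ?_
    rw [← eq_geodesic, character_liftMap_self hk]
    exact hy
  · have h1 := (UnitAddCircle.measurePreserving_mk 0).map_eq
    rw [zero_add, volume_circle] at h1
    have hm : Measurable fun s : ℝ => (s : UnitAddCircle) := (AddCircle.continuous_mk' 1).measurable
    rw [lift, Measure.dirac_prod, Measure.map_map (continuous_liftMap k).measurable
      measurable_prodMk_left, ← h1, Measure.map_map ((continuous_liftMap k).measurable.comp
      measurable_prodMk_left) hm, ENNReal.ofReal_one, inv_one, one_smul]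
    congr 1
    funext s
    exact eq_geodesic k y s

-- Since `averageDeriv` is the derivative of a real function divided by 2πi, it is purely imaginary.
-- In terms of coefficients, q w(q • k) changes into minus its conjugate under q ↦ -q.
include hw in
theorem averageDeriv_re {k : Freq} (hk : IsPrimitive k) (y : UnitAddCircle) :
    (averageDeriv w k y).re = 0 := by
  have h1 : conj (averageDeriv w k y) = -averageDeriv w k y := by
    rw [averageDeriv_apply hw hk, Complex.conj_tsum, ← tsum_neg, ← (Equiv.neg ℤ).tsum_eq]
    refine tsum_congr fun q => ?_
    simp only [Equiv.neg_apply, map_mul, hw.conj_eq]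
    rw [← fourier_neg, neg_neg, neg_smul, neg_neg]
    simp
  have h2 := congrArg Complex.re h1
  rw [Complex.conj_re, Complex.neg_re] at h2
  linarith

-- The Fourier coefficient of index q carries a factor q, so the one of index 0 vanishes.
include hw in
theorem integral_averageDeriv {k : Freq} (hk : IsPrimitive k) :
    ∫ y, averageDeriv w k y ∂AddCircle.haarAddCircle = 0 := by
  have h1 : integralCLM AddCircle.haarAddCircle 1 (averageDeriv w k) = 0 := by
    rw [averageDeriv, ContinuousLinearMap.map_tsum _ (hw.summable_averageDeriv hk)]
    refine (tsum_congr fun q => ?_).trans tsum_zero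
    rw [map_smul, integralCLM_apply]
    simp only [ContinuousMap.one_apply, mul_one, integral_fourier]
    split_ifs with hq <;> simp [hq]
  simpa [integralCLM_apply] using h1

-- A continuous function that is purely imaginary with zero mean vanishes somewhere, by the
-- intermediate value theorem. Critical geodesics thus exist in every direction, and 𝓝(V) is not
-- empty.
include hw in
theorem exists_averageDeriv_eq_zero {k : Freq} (hk : IsPrimitive k) :
    ∃ y, averageDeriv w k y = 0 := by
  by_contra! hne
  have him : ∀ y, (averageDeriv w k y).im ≠ 0 := fun y h =>
    hne y (Complex.ext (averageDeriv_re hw hk y) h)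
  have hc : Continuous fun y => (averageDeriv w k y).im :=
    Complex.continuous_im.comp (averageDeriv w k).continuous
  have hint : ∫ y, (averageDeriv w k y).im ∂AddCircle.haarAddCircle = 0 := by
    have := integral_averageDeriv hw hk
    have h2 := integral_im (𝕜 := ℂ) (integrable_circle' (σ := AddCircle.haarAddCircle)
      (averageDeriv w k).continuous)
    simp only [RCLike.im_to_complex] at h2
    rw [h2, this, Complex.zero_im]
  have hpos : ∀ g : UnitAddCircle → ℝ, Continuous g → (∀ y, 0 < g y) →
      0 < ∫ y, g y ∂AddCircle.haarAddCircle := fun g hg hgp => by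
    refine hg.integral_pos_of_hasCompactSupport_nonneg_nonzero
      (HasCompactSupport.of_compactSpace g) (fun y => (hgp y).le) (hgp 0).ne'
  rcases lt_or_gt_of_ne (him 0) with h0 | h0
  · have hneg : ∀ y, 0 < -(averageDeriv w k y).im := fun y => by
      by_contra! h
      obtain ⟨z, hz⟩ := mem_range_of_exists_le_of_exists_ge hc ⟨0, h0.le⟩ ⟨y, by linarith⟩
      exact him z hz
    have := hpos _ hc.neg hneg
    rw [integral_neg', hint] at this
    simp at this
  · have hpos' : ∀ y, 0 < (averageDeriv w k y).im := fun y => by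
      by_contra! h
      obtain ⟨z, hz⟩ := mem_range_of_exists_le_of_exists_ge hc ⟨y, h⟩ ⟨0, h0.le⟩
      exact him z hz
    have := hpos _ hc hpos'
    rw [hint] at this
    exact lt_irrefl _ this

/-- Closed geodesics are contained in level sets of characters. -/
theorem IsClosedGeodesic.exists_subset {γ : Set Torus} (h : IsClosedGeodesic γ) :
    ∃ k ∈ directions, ∃ y, γ ⊆ {x | character k x = y} := by
  obtain ⟨x, ξ, ⟨hξ, T, hT, hper⟩, rfl⟩ := h
  have h1 : ∀ i, ∃ n : ℤ, T * ξ i = n := fun i => by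
    have := congrFun hper i
    simp only [proj, PiLp.smul_apply, smul_eq_mul, Pi.zero_apply] at this
    obtain ⟨n, hn⟩ := (AddCircle.coe_eq_zero_iff 1).mp this
    exact ⟨n, by rw [← hn]; simp⟩
  choose n hn using h1
  -- Periodicity says that n = Tξ is an integer vector. The rotated vector is an integer vector
  -- orthogonal to ξ, and its primitive direction k makes k·x constant along the geodesic.
  have hm : (![n 1, -n 0] : Freq) ≠ 0 := by
    intro h0
    apply hξ
    have h2 : n 1 = 0 := congrFun h0 0
    have h3 : n 0 = 0 := by simpa using congrFun h0 1
    ext i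
    have := hn i
    fin_cases i
    · simp only [Fin.zero_eta, h3, Int.cast_zero, mul_eq_zero, hT.ne', false_or] at this
      simpa using this
    · simp only [Fin.mk_one, h2, Int.cast_zero, mul_eq_zero, hT.ne', false_or] at this
      simpa using this
  obtain ⟨k, hk, p, hp, hkp⟩ := exists_direction hm
  refine ⟨k, hk, character k x, ?_⟩
  rintro _ ⟨s, rfl⟩
  simp only [Set.mem_ofPred_eq, geodesic]
  rw [character_add, character_proj]
  have h4 : ∑ i, (k i : ℝ) * (s • ξ) i = 0 := by
    have ha : n 1 = p * k 0 := congrFun hkp 0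
    have hb : -n 0 = p * k 1 := by simpa using congrFun hkp 1
    have ha' : T * ξ 1 = p * k 0 := by rw [hn, ha]; push_cast; rfl
    have hb' : -(T * ξ 0) = p * k 1 := by rw [hn]; exact_mod_cast hb
    have hp' : (p : ℝ) ≠ 0 := by exact_mod_cast hp
    have h5 : (p : ℝ) * T * (k 0 * ξ 0 + k 1 * ξ 1) = 0 := by
      linear_combination (-(T * ξ 0)) * ha' - (T * ξ 1) * hb'
    have h6 : k 0 * ξ 0 + k 1 * ξ 1 = 0 := by
      rcases mul_eq_zero.mp h5 with h | h
      · exact absurd h (mul_ne_zero hp' hT.ne')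
      · exact h
    simp only [Fin.sum_univ_two, PiLp.smul_apply, smul_eq_mul]
    linear_combination s * h6
  rw [h4]
  simp

end Average

/-! ### The structure theorem for a single limit measure -/

section Structure

variable {V : Torus → ℝ} {w : Freq → ℂ} {ħ ε a ℓ : ℕ → ℝ} {c : ℕ → ℝ → SeqL2}

theorem Regime.structure (h : Regime w ħ ε a ℓ c) (hV : Continuous V) (hVw : HasFourierSeries V w)
    (ν : FiniteMeasure Torus) [IsProbabilityMeasure (ν : Measure Torus)]
    (hlim : ∀ m : Freq, Tendsto (fun n => formAverage (a n) (ℓ n) (c n) (fun _ => 1) m) atTop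
      (𝓝 (∫ x, UnitAddTorus.mFourier (-m) x ∂(ν : Measure Torus)))) :
    (∀ γ : Set Torus, IsClosedGeodesic γ → ¬ γ ⊆ criticalSet V → (ν : Measure Torus) γ = 0) ∧
    ∃ (f : Torus → ℝ) (α : ℝ≥0) (νsing : FiniteMeasure Torus),
      Integrable f volume ∧ (∀ x, 0 ≤ f x) ∧ α ≤ 1 ∧ νsing ∈ criticalMeasures V ∧
      (ν : Measure Torus) = volume.withDensity (fun x => ENNReal.ofReal (f x)) +
          α • (νsing : Measure Torus) := by
  have hw := h.potential
  obtain ⟨σ, ρ, hσf, hρf, hcrit, hac, hN', hsum⟩ := h.exists_direction_family (K := directions)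
    (fun k hk => isPrimitive_of_isCoprime hk.1)
    (fun k hk k' hk' hne => det_ne_zero_of_mem_directions hk hk' hne) hlim
  have hN : ∀ (k : directions) (p : ℤ), p ≠ 0 →
      ∫ x, UnitAddTorus.mFourier (p • (k : Freq)) x ∂(ν : Measure Torus) =
        ∫ y, fourier p y ∂(σ k) + ∫ y, fourier p y ∂(ρ k) := fun k p hp => by
    have := hN' k (-p) (neg_ne_zero.mpr hp)
    rwa [neg_smul, neg_neg, neg_neg] at this
  refine ⟨fun γ hγ hncrit => ?_, ?_⟩
  -- The geodesic lies in a level set {k·x = y}. If y were critical for the averaged potential, this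
  -- whole level set would be contained in 𝓒(V).
  · obtain ⟨k, hk, y, hsub⟩ := hγ.exists_subset
    refine measure_mono_null hsub (measure_level_eq_zero (k := ⟨k, hk⟩) (hcrit ⟨k, hk⟩)
      (hac ⟨k, hk⟩) (hN ⟨k, hk⟩) (by simpa using hsum {⟨k, hk⟩}) fun h0 => hncrit fun x hx => ?_)
    refine mem_criticalSet hV hw hVw hk ?_
    rw [show character k x = y from hsub hx]
    exact h0
  · obtain ⟨R, hR, hdec⟩ := eq_add_sum_lift hac hN hsum
    set S := Measure.sum fun k : directions => lift k (σ k) with hS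
    have hRf : IsFiniteMeasure R := by
      refine isFiniteMeasure_of_le (ν : Measure Torus) ?_
      rw [hdec]
      exact Measure.le_add_right le_rfl
    have htsum : ∑' k, σ k Set.univ ≤ 1 :=
      (ENNReal.tsum_le_tsum fun k => le_self_add).trans (tsum_mass_le hsum)
    have hSf : IsFiniteMeasure S := isFiniteMeasure_sum_lift htsum
    have hSu : S Set.univ = ∑' k, σ k Set.univ := by
      rw [hS, Measure.sum_apply _ MeasurableSet.univ]
      simp only [lift_univ]
    have hmem : ∀ {k : Freq}, k ∈ directions → ∀ {y : UnitAddCircle}, averageDeriv w k y = 0 →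
        (⟨lift k (Measure.dirac y), inferInstance⟩ : FiniteMeasure Torus) ∈
          {m : FiniteMeasure Torus | ∃ γ : Set Torus, γ ⊆ criticalSet V ∧
            IsNormalizedLebesgueAlong γ (m : Measure Torus)} := fun hk _ hy =>
      lift_dirac_mem hV hw hVw hk hy
    set α : ℝ≥0 := (S Set.univ).toNNReal with hα
    have hαS : (α : ℝ≥0∞) = S Set.univ := ENNReal.coe_toNNReal (measure_ne_top _ _)
    have hα1 : α ≤ 1 := by
      rw [← ENNReal.coe_le_coe, hαS, hSu]
      exact htsum
    have hf : R = volume.withDensity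
        (fun x => ENNReal.ofReal ((R.rnDeriv (volume : Measure Torus) x).toReal)) := by
      conv_lhs => rw [← Measure.withDensity_rnDeriv_eq R _ hR]
      refine withDensity_congr_ae ?_
      filter_upwards [Measure.rnDeriv_lt_top R (volume : Measure Torus)] with x hx
      rw [ENNReal.ofReal_toReal hx.ne]
    obtain ⟨νsing, hνs, hSν⟩ : ∃ νsing ∈ criticalMeasures V, S = α • (νsing : Measure Torus) := by
      -- Without singular part, any element of 𝓝(V) will do; one is obtained from a critical
      -- geodesic in the direction (1, 0).
      by_cases hα0 : α = 0
      · have hk : (![1, 0] : Freq) ∈ directions := by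
          refine ⟨?_, Or.inl (by simp)⟩
          simpa using isCoprime_one_left
        obtain ⟨y, hy⟩ := exists_averageDeriv_eq_zero hw (isPrimitive_of_isCoprime hk.1)
        refine ⟨_, subset_closure (subset_convexHull _ _ (hmem hk hy)), ?_⟩
        rw [hα0, zero_smul, ← Measure.measure_univ_eq_zero, ← hαS, hα0, ENNReal.coe_zero]
      · obtain ⟨S', hS'⟩ : ∃ S' : FiniteMeasure Torus, (S' : Measure Torus) = S := ⟨⟨S, hSf⟩, rfl⟩
        have hSeq : S = α • (((α⁻¹ • S' : FiniteMeasure Torus) : Measure Torus)) := by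
          rw [FiniteMeasure.toMeasure_smul, smul_smul, mul_inv_cancel₀ hα0, one_smul, hS']
        refine ⟨α⁻¹ • S', ?_, hSeq⟩
        refine sum_lift_mem_closure_convexHull hα0 (by rw [← hSu, hαS])
          (Z := fun k => {y | averageDeriv w k y = 0}) (fun k => ?_) hcrit
          (fun k y hy => hmem k.2 hy) hSeq
        exact (isClosed_eq (averageDeriv w k).continuous continuous_const).measurableSet
    refine ⟨fun x => (R.rnDeriv (volume : Measure Torus) x).toReal, α, νsing,
      Measure.integrable_toReal_rnDeriv, fun x => ENNReal.toReal_nonneg, hα1, hνs, ?_⟩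
    rw [← hf, ← hSν]
    exact hdec

end Structure

/-! ### Fourier analysis in `L²` of the torus -/

section L2

/-- The exponential `exp(2πi m·x)` in `L²`. -/
def mode (m : Freq) : L2Torus := ContinuousMap.toLp (E := ℂ) 2 volume ℂ (UnitAddTorus.mFourier m)

theorem coeFn_mode (m : Freq) : mode m =ᵐ[volume] UnitAddTorus.mFourier m :=
  ContinuousMap.coeFn_toLp volume (UnitAddTorus.mFourier m)

theorem orthonormal_mode : Orthonormal ℂ mode := by
  rw [orthonormal_iff_ite]
  intro m n
  simp only [mode, ContinuousMap.inner_toLp, ← UnitAddTorus.mFourier_neg,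
    ← UnitAddTorus.mFourier_add]
  rw [integral_mFourier]
  refine if_congr ⟨fun h => ?_, fun h => ?_⟩ rfl rfl
  · exact (add_neg_eq_zero.mp h).symm
  · rw [h, add_neg_cancel]

theorem span_mode_closure_eq_top : (Submodule.span ℂ (Set.range mode)).topologicalClosure = ⊤ := by
  have := (ContinuousMap.toLp_denseRange (p := 2) ℂ (volume : Measure Torus) ℂ
    (by simp)).topologicalClosure_map_submodule UnitAddTorus.span_mFourier_closure_eq_top
  rw [Submodule.map_span, ← Set.range_comp] at this
  exact this

/-- The Fourier basis of `L²(𝕋²)`. -/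
def modeBasis : HilbertBasis Freq ℂ L2Torus :=
  HilbertBasis.mk orthonormal_mode span_mode_closure_eq_top.ge

theorem modeBasis_apply (m : Freq) : modeBasis m = mode m := by
  simp [modeBasis]

/-- The sequence of Fourier coefficients. -/
def coeffs (u : L2Torus) : SeqL2 := modeBasis.repr u

theorem continuous_coeffs : Continuous coeffs := modeBasis.repr.continuous

theorem norm_coeffs (u : L2Torus) : ‖coeffs u‖ = ‖u‖ := modeBasis.repr.norm_map u

theorem coeffs_apply (u : L2Torus) (m : Freq) : coeffs u m = fourierCoefficient u m := by
  rw [coeffs, HilbertBasis.repr_apply_apply, modeBasis_apply, L2.inner_def, fourierCoefficient]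
  refine integral_congr_ae ?_
  filter_upwards [coeFn_mode m] with x hx
  rw [hx, UnitAddTorus.mFourier_neg, RCLike.inner_apply, mul_comm]

theorem norm_mFourier_apply (m : Freq) (x : Torus) : ‖UnitAddTorus.mFourier m x‖ = 1 := by
  rw [mFourier_eq, norm_fourier_apply]

/-- Multiplication by an exponential. -/
def modulate (m : Freq) (u : L2Torus) : L2Torus :=
  MemLp.toLp (fun x => UnitAddTorus.mFourier m x * u x) ((Lp.memLp u).congr_norm
    ((UnitAddTorus.mFourier m).continuous.aestronglyMeasurable.mul (Lp.aestronglyMeasurable u))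
    (Eventually.of_forall fun x => by rw [norm_mul, norm_mFourier_apply, one_mul]))

theorem coeFn_modulate (m : Freq) (u : L2Torus) :
    modulate m u =ᵐ[volume] fun x => UnitAddTorus.mFourier m x * u x := MemLp.coeFn_toLp _

theorem coeffs_modulate (m j : Freq) (u : L2Torus) : coeffs (modulate m u) j = coeffs u (j - m) := by
  rw [coeffs_apply, coeffs_apply, fourierCoefficient, fourierCoefficient]
  refine integral_congr_ae ?_
  filter_upwards [coeFn_modulate m u] with x hx
  rw [hx, show -(j - m) = -j + m by abel, UnitAddTorus.mFourier_add]
  ring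

/-- The Fourier coefficients of the density `|u|²`. -/
theorem integral_mFourier_mul_norm_sq (m : Freq) (u : L2Torus) :
    ∫ x, UnitAddTorus.mFourier (-m) x * ((‖u x‖ ^ 2 : ℝ) : ℂ) =
      form (fun _ => 1) m (coeffs u) (coeffs u) := by
  have h1 : ∫ x, UnitAddTorus.mFourier (-m) x * ((‖u x‖ ^ 2 : ℝ) : ℂ) =
      inner ℂ (modulate m u) u := by
    rw [L2.inner_def]
    refine integral_congr_ae ?_
    filter_upwards [coeFn_modulate m u] with x hx
    rw [hx, RCLike.inner_apply, map_mul, ← UnitAddTorus.mFourier_neg, mul_left_comm,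
      Complex.mul_conj, Complex.normSq_eq_norm_sq]
  rw [h1, ← modeBasis.repr.inner_map_map, lp.inner_eq_tsum, form]
  refine tsum_congr fun j => ?_
  rw [RCLike.inner_apply, one_mul]
  have := coeffs_modulate m j u
  simp only [coeffs] at this ⊢
  rw [this]

theorem tsum_norm_coeffs_sq (u : L2Torus) : ∑' j, ‖coeffs u j‖ ^ 2 = ‖u‖ ^ 2 := by
  rw [tsum_norm_sq, norm_coeffs]

end L2

/-! ### Fourier coefficients of smooth functions -/

section Smooth

instance : IsProbabilityMeasure (volume : Measure Torus) := ⟨by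
  simp [volume_pi, volume_circle]⟩

theorem isOpenQuotientMap_proj : IsOpenQuotientMap proj := by
  have h1 : IsOpenQuotientMap (Pi.map fun (_ : Fin 2) (t : ℝ) => (t : UnitAddCircle)) :=
    IsOpenQuotientMap.piMap fun _ => QuotientAddGroup.isOpenQuotientMap_mk
  exact h1.comp (EuclideanSpace.equiv (Fin 2) ℝ).toHomeomorph.isOpenQuotientMap

theorem SmoothOnTorus.continuous {F : Type} [NormedAddCommGroup F] [NormedSpace ℝ F]
    {g : Torus → F} (hg : SmoothOnTorus g) : Continuous g :=
  isOpenQuotientMap_proj.isQuotientMap.continuous_iff.mpr (ContDiff.continuous hg)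

/-- The partial derivatives of a function on the torus. -/
def partialDeriv (i : Fin 2) (g : Torus → ℂ) (x : Torus) : ℂ :=
  fderiv ℝ (fun h : Plane => g (x + proj h)) 0 (EuclideanSpace.single i 1)

variable {g : Torus → ℂ}

theorem partialDeriv_proj (i : Fin 2) (g : Torus → ℂ) (y : Plane) :
    partialDeriv i g (proj y) = fderiv ℝ (fun y => g (proj y)) y (EuclideanSpace.single i 1) := by
  have h1 : (fun h : Plane => g (proj y + proj h)) = fun h => (fun y => g (proj y)) (y + h) := by
    funext h
    simp only [proj_add]
  rw [partialDeriv, h1, fderiv_comp_add_left (f := fun y => g (proj y)), add_zero]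

theorem SmoothOnTorus.partialDeriv (hg : SmoothOnTorus g) (i : Fin 2) :
    SmoothOnTorus (partialDeriv i g) := by
  unfold SmoothOnTorus at *
  simp only [partialDeriv_proj]
  exact (hg.fderiv_right (m := ∞) (by simp)).clm_apply contDiff_const

theorem SmoothOnTorus.hasDerivAt (hg : SmoothOnTorus g) (i : Fin 2) (x : Torus) (t : ℝ) :
    HasDerivAt (fun t : ℝ => g (x + proj (t • EuclideanSpace.single i 1)))
      (TorusSchrodinger.partialDeriv i g (x + proj (t • EuclideanSpace.single i 1))) t := by
  obtain ⟨y, rfl⟩ := isOpenQuotientMap_proj.surjective x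
  simp only [← proj_add]
  rw [partialDeriv_proj]
  have h1 : HasFDerivAt (fun y => g (proj y)) (fderiv ℝ (fun y => g (proj y))
      (y + t • EuclideanSpace.single i 1)) (y + t • EuclideanSpace.single i 1) :=
    (ContDiff.differentiable hg (by simp) _).hasFDerivAt
  have h2 : HasDerivAt (fun t : ℝ => y + t • (EuclideanSpace.single i 1 : Plane))
      (EuclideanSpace.single i 1) t := by
    simpa using ((hasDerivAt_id t).smul_const (EuclideanSpace.single i 1 : Plane)).const_add y
  exact h1.comp_hasDerivAt t h2

/-- The Fourier coefficients of a function. -/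
def fourierCoef (g : Torus → ℂ) (l : Freq) : ℂ := ∫ x, UnitAddTorus.mFourier (-l) x * g x

theorem character_single (l : Freq) (i : Fin 2) (t : ℝ) :
    character l (proj (t • EuclideanSpace.single i 1)) = ((l i * t : ℝ) : UnitAddCircle) := by
  rw [character_proj]
  congr 1
  fin_cases i <;> simp

theorem fourierCoef_translate (l : Freq) (z : Torus) :
    fourierCoef (fun x => g (x + z)) l = UnitAddTorus.mFourier l z * fourierCoef g l := by
  rw [fourierCoef, fourierCoef, ← integral_const_mul,
    ← integral_add_right_eq_self (fun x => UnitAddTorus.mFourier l z *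
      (UnitAddTorus.mFourier (-l) x * g x)) z]
  refine integral_congr_ae (Eventually.of_forall fun x => ?_)
  simp only
  rw [← mul_assoc]
  congr 1
  simp only [mFourier_eq, character_add, fourier_apply, one_smul, AddCircle.toCircle_add,
    Circle.coe_mul]
  have h1 : character (-l) z = -character l z := by
    simp [character]
  rw [h1, AddCircle.toCircle_neg]
  have h2 : ((AddCircle.toCircle (character l z) : Circle) : ℂ) *
      ((AddCircle.toCircle (character l z))⁻¹ : Circle) = 1 := by
    rw [← Circle.coe_mul, mul_inv_cancel, Circle.coe_one]
  linear_combination (-((AddCircle.toCircle (character (-l) x) : Circle) : ℂ)) * h2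

/-- Translation invariance replaces integration by parts: translating g by t in the coordinate i
multiplies its coefficient of index l by exp(2πi lᵢ t), and differentiation at t = 0 gives the
formula. -/
theorem fourierCoef_partialDeriv (hg : SmoothOnTorus g) (i : Fin 2) (l : Freq) :
    fourierCoef (partialDeriv i g) l = 2 * Real.pi * Complex.I * l i * fourierCoef g l := by
  have hd := hg.partialDeriv i
  obtain ⟨B, hB⟩ := isCompact_univ.exists_bound_of_continuousOn hd.continuous.continuousOn
  set γ : ℝ → Torus := fun t => proj (t • EuclideanSpace.single i 1) with hγ
  have h1 := hasDerivAt_integral_of_dominated_loc_of_deriv_le (μ := (volume : Measure Torus))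
    (F := fun t x => UnitAddTorus.mFourier (-l) x * g (x + γ t))
    (F' := fun t x => UnitAddTorus.mFourier (-l) x * partialDeriv i g (x + γ t)) (x₀ := 0)
    (s := Set.univ) (bound := fun _ => B) Filter.univ_mem
    (Eventually.of_forall fun t => Continuous.aestronglyMeasurable
      ((UnitAddTorus.mFourier (-l)).continuous.mul (hg.continuous.comp (by fun_prop))))
    (integrable_torus ((UnitAddTorus.mFourier (-l)).continuous.mul
      (hg.continuous.comp (by fun_prop))))
    (Continuous.aestronglyMeasurable
      ((UnitAddTorus.mFourier (-l)).continuous.mul (hd.continuous.comp (by fun_prop))))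
    (Eventually.of_forall fun x t _ => by
      rw [norm_mul, norm_mFourier_apply, one_mul]; exact hB _ (Set.mem_univ _))
    (integrable_const _)
    (Eventually.of_forall fun x t _ => (hg.hasDerivAt i x t).const_mul _)
  have h2 : ∀ t : ℝ, ∫ x, UnitAddTorus.mFourier (-l) x * g (x + γ t) =
      fourier (l i) (t : UnitAddCircle) * fourierCoef g l := fun t => by
    have := fourierCoef_translate (g := g) l (γ t)
    rw [fourierCoef] at this
    rw [this, mFourier_eq, hγ, character_single, fourier_apply, fourier_apply, one_smul,
      ← AddCircle.coe_zsmul, zsmul_eq_mul]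
  have h3 : HasDerivAt (fun t : ℝ => (fourier (l i) (t : UnitAddCircle) : ℂ) * fourierCoef g l)
      (2 * Real.pi * Complex.I * l i * fourierCoef g l) 0 := by
    have := (hasDerivAt_fourier 1 (l i) 0).mul_const (fourierCoef g l)
    refine this.congr_deriv ?_
    rw [show ((0 : ℝ) : AddCircle (1 : ℝ)) = 0 from rfl, fourier_eval_zero]
    simp
  have h4 := h1.2
  simp only [h2] at h4
  have h5 := h4.unique h3
  rw [← h5, fourierCoef]
  refine integral_congr_ae (Eventually.of_forall fun x => ?_)
  have h6 : γ 0 = 0 := by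
    funext i; simp [hγ, proj]
  simp only [h6, add_zero]

theorem exists_fourierCoef_bound (a b : ℕ) (hg : SmoothOnTorus g) :
    ∃ C : ℝ, ∀ l : Freq, |(l 0 : ℝ)| ^ a * |(l 1 : ℝ)| ^ b * ‖fourierCoef g l‖ ≤ C := by
  have hstep : ∀ (i : Fin 2) (g : Torus → ℂ), SmoothOnTorus g → ∀ l : Freq,
      |(l i : ℝ)| * ‖fourierCoef g l‖ ≤ ‖fourierCoef (partialDeriv i g) l‖ := fun i g hg l => by
    rw [fourierCoef_partialDeriv hg]
    simp only [norm_mul, Complex.norm_I, Complex.norm_real, Complex.norm_intCast, Complex.norm_ofNat,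
      mul_one, Real.norm_eq_abs, abs_of_pos Real.pi_pos]
    have h1 : (1 : ℝ) ≤ 2 * Real.pi := by linarith [Real.pi_gt_three]
    calc |(l i : ℝ)| * ‖fourierCoef g l‖ = 1 * |(l i : ℝ)| * ‖fourierCoef g l‖ := by ring
      _ ≤ _ := by gcongr
  induction a generalizing g with
  | zero =>
    induction b generalizing g with
    | zero =>
      obtain ⟨B, hB⟩ := isCompact_univ.exists_bound_of_continuousOn hg.continuous.continuousOn
      refine ⟨B, fun l => ?_⟩
      rw [pow_zero, pow_zero, one_mul, one_mul, fourierCoef]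
      have h1 := norm_integral_le_of_norm_le_const (μ := (volume : Measure Torus)) (C := B)
        (f := fun x => UnitAddTorus.mFourier (-l) x * g x) (Eventually.of_forall fun x => by
          rw [norm_mul, norm_mFourier_apply, one_mul]
          exact hB x (Set.mem_univ _))
      rwa [probReal_univ, mul_one] at h1
    | succ b ih =>
      obtain ⟨C, hC⟩ := ih (hg.partialDeriv 1)
      refine ⟨C, fun l => (le_trans ?_ (hC l))⟩
      calc |(l 0 : ℝ)| ^ 0 * |(l 1 : ℝ)| ^ (b + 1) * ‖fourierCoef g l‖
          = |(l 0 : ℝ)| ^ 0 * |(l 1 : ℝ)| ^ b * (|(l 1 : ℝ)| * ‖fourierCoef g l‖) := by ring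
        _ ≤ _ := by gcongr; exact hstep 1 g hg l
  | succ a ih =>
    obtain ⟨C, hC⟩ := ih (hg.partialDeriv 0)
    refine ⟨C, fun l => (le_trans ?_ (hC l))⟩
    calc |(l 0 : ℝ)| ^ (a + 1) * |(l 1 : ℝ)| ^ b * ‖fourierCoef g l‖
        = |(l 0 : ℝ)| ^ a * |(l 1 : ℝ)| ^ b * (|(l 0 : ℝ)| * ‖fourierCoef g l‖) := by ring
      _ ≤ _ := by gcongr; exact hstep 0 g hg l

theorem summable_freq :
    Summable fun l : Freq => (1 + (l 0 : ℝ) ^ 2)⁻¹ * (1 + (l 1 : ℝ) ^ 2)⁻¹ := by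
  have h1 : Summable fun n : ℤ => (1 + (n : ℝ) ^ 2)⁻¹ := by
    have hs : Summable fun n : ℤ => 1 / (n : ℝ) ^ 2 := Real.summable_one_div_int_pow.mpr one_lt_two
    refine Summable.of_norm_bounded_eventually hs ?_
    have : ∀ᶠ n : ℤ in cofinite, n ≠ 0 := by
      rw [Filter.eventually_cofinite]; simp
    filter_upwards [this] with n hn
    have hn' : (0 : ℝ) < (n : ℝ) ^ 2 := by positivity
    rw [Real.norm_of_nonneg (by positivity), one_div]
    exact inv_anti₀ hn' (by linarith)
  have h2 := h1.mul_of_nonneg h1 (fun _ => by positivity) (fun _ => by positivity)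
  exact ((finTwoArrowEquiv ℤ).summable_iff (f := fun x : ℤ × ℤ =>
    (1 + (x.1 : ℝ) ^ 2)⁻¹ * (1 + (x.2 : ℝ) ^ 2)⁻¹)).mpr h2

theorem summable_fourierCoef (hg : SmoothOnTorus g) :
    Summable fun l : Freq => ‖fourierCoef g l‖ * (1 + (l 0 : ℝ) ^ 2 + (l 1 : ℝ) ^ 2) := by
  obtain ⟨C₀, h0⟩ := exists_fourierCoef_bound 0 0 hg
  obtain ⟨C₁, h1⟩ := exists_fourierCoef_bound 4 2 hg
  obtain ⟨C₂, h2⟩ := exists_fourierCoef_bound 2 4 hg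
  obtain ⟨C₃, h3⟩ := exists_fourierCoef_bound 2 2 hg
  obtain ⟨C₄, h4⟩ := exists_fourierCoef_bound 2 0 hg
  obtain ⟨C₅, h5⟩ := exists_fourierCoef_bound 0 2 hg
  obtain ⟨C₆, h6⟩ := exists_fourierCoef_bound 4 0 hg
  obtain ⟨C₇, h7⟩ := exists_fourierCoef_bound 0 4 hg
  refine Summable.of_nonneg_of_le (fun l => by positivity) (fun l => ?_)
    -- The weights are the coefficients of the expansion of (1 + x²)(1 + y²)(1 + x² + y²), whose
    -- monomials have been bounded one by one.
    (summable_freq.mul_left (C₀ + C₁ + C₂ + 3 * C₃ + 2 * C₄ + 2 * C₅ + C₆ + C₇))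
  specialize h0 l; specialize h1 l; specialize h2 l; specialize h3 l; specialize h4 l
  specialize h5 l; specialize h6 l; specialize h7 l
  have e2 : ∀ x : ℝ, |x| ^ 2 = x ^ 2 := sq_abs
  have e4 : ∀ x : ℝ, |x| ^ 4 = x ^ 4 := fun x => by
    rw [show 4 = 2 * 2 by norm_num, pow_mul, sq_abs, pow_mul]
  simp only [e2, e4, pow_zero, one_mul, mul_one] at h0 h1 h2 h3 h4 h5 h6 h7
  rw [← mul_inv, ← div_eq_mul_inv, le_div_iff₀ (by positivity)]
  generalize (l 0 : ℝ) = x at *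
  generalize (l 1 : ℝ) = y at *
  generalize ‖fourierCoef g l‖ = f at *
  nlinarith

theorem isPotential_fourierCoef {V : Torus → ℝ} (hV : SmoothOnTorus fun x => (V x : ℂ)) :
    IsPotential (fourierCoef fun x => (V x : ℂ)) := by
  have hs := summable_fourierCoef hV
  have hdot : ∀ k l : Freq, |dot k l| ≤ (|(k 0 : ℝ)| + |(k 1 : ℝ)|) *
      (1 + (l 0 : ℝ) ^ 2 + (l 1 : ℝ) ^ 2) := fun k l => by
    simp only [dot, Fin.sum_univ_two]
    refine (abs_add_le _ _).trans ?_
    rw [abs_mul, abs_mul, add_mul]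
    gcongr <;> nlinarith [sq_abs (l 0 : ℝ), sq_abs (l 1 : ℝ), sq_nonneg (|(l 0 : ℝ)| - 1),
      sq_nonneg (|(l 1 : ℝ)| - 1), sq_nonneg (l 0 : ℝ), sq_nonneg (l 1 : ℝ)]
  have hdot2 : ∀ k l : Freq, dot k l ^ 2 ≤ ((k 0 : ℝ) ^ 2 + (k 1 : ℝ) ^ 2) *
      (1 + (l 0 : ℝ) ^ 2 + (l 1 : ℝ) ^ 2) := fun k l => by
    simp only [dot, Fin.sum_univ_two]
    nlinarith [sq_nonneg ((k 0 : ℝ) * l 1 - k 1 * l 0), sq_nonneg (k 0 : ℝ), sq_nonneg (k 1 : ℝ)]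
  refine ⟨⟨?_, fun l => ?_⟩, fun k => ?_, fun k => ?_⟩
  · refine Summable.of_nonneg_of_le (fun l => norm_nonneg _) (fun l => ?_) hs
    refine le_mul_of_one_le_right (norm_nonneg _) ?_
    linarith [sq_nonneg (l 0 : ℝ), sq_nonneg (l 1 : ℝ)]
  · rw [fourierCoef, ← integral_conj, fourierCoef]
    refine integral_congr_ae (Eventually.of_forall fun x => ?_)
    simp only [map_mul, Complex.conj_ofReal, ← UnitAddTorus.mFourier_neg]
  · refine Summable.of_nonneg_of_le (fun l => by positivity) (fun l => ?_)
      (hs.mul_left (|(k 0 : ℝ)| + |(k 1 : ℝ)|))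
    rw [mul_left_comm]
    exact mul_le_mul_of_nonneg_left (hdot k l) (norm_nonneg _)
  · refine Summable.of_nonneg_of_le (fun l => by positivity) (fun l => ?_)
      (hs.mul_left ((k 0 : ℝ) ^ 2 + (k 1 : ℝ) ^ 2))
    rw [mul_left_comm]
    exact mul_le_mul_of_nonneg_left (hdot2 k l) (norm_nonneg _)

theorem mFourierCoeff_eq (g : Torus → ℂ) (l : Freq) :
    UnitAddTorus.mFourierCoeff g l = fourierCoef g l := by
  have h : (Measure.pi fun _ : Fin 2 => (AddCircle.haarAddCircle : Measure UnitAddCircle)) =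
      (volume : Measure Torus) := by
    rw [volume_pi, volume_circle]
  rw [fourierCoef, ← h]
  rfl

theorem hasFourierSeries_fourierCoef {V : Torus → ℝ} (hV : SmoothOnTorus fun x => (V x : ℂ)) :
    HasFourierSeries V (fourierCoef fun x => (V x : ℂ)) := by
  intro x
  have h1 : UnitAddTorus.mFourierCoeff (fun x => (V x : ℂ)) = fourierCoef fun x => (V x : ℂ) :=
    funext fun l => mFourierCoeff_eq _ l
  have h2 := UnitAddTorus.hasSum_mFourier_series_apply_of_summable
    (f := (⟨fun x => (V x : ℂ), hV.continuous⟩ : C(Torus, ℂ)))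
    (by
      rw [ContinuousMap.coe_mk, h1]
      exact (isPotential_fourierCoef hV).summable.of_norm) x
  rw [ContinuousMap.coe_mk, h1] at h2
  exact h2

theorem smoothOnTorus_mFourier (j : Freq) : SmoothOnTorus (UnitAddTorus.mFourier j) := by
  have h1 : (fun y : Plane => UnitAddTorus.mFourier j (proj y)) =
      fun y : Plane => Complex.exp (2 * Real.pi * Complex.I *
        Complex.ofRealCLM ((j 0 : ℝ) * (EuclideanSpace.proj 0 : Plane →L[ℝ] ℝ) y +
          (j 1 : ℝ) * (EuclideanSpace.proj 1 : Plane →L[ℝ] ℝ) y)) := by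
    funext y
    rw [mFourier_eq, character_proj, fourier_coe_apply]
    simp [Fin.sum_univ_two]
  unfold SmoothOnTorus
  rw [h1]
  fun_prop

theorem torusLaplacian_mFourier (j : Freq) (x : Torus) :
    torusLaplacian (UnitAddTorus.mFourier j) x =
      -(4 * Real.pi ^ 2 * ∑ i, (j i : ℝ) ^ 2 : ℝ) * UnitAddTorus.mFourier j x := by
  set C := UnitAddTorus.mFourier j x with hC
  set A : Plane →L[ℝ] ℂ := (2 * Real.pi * Complex.I : ℂ) • ((Complex.ofRealCLM).comp
    (∑ i, (j i : ℝ) • (EuclideanSpace.proj i : Plane →L[ℝ] ℝ))) with hA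
  have hAi : ∀ i, A (EuclideanSpace.single i 1) = 2 * Real.pi * Complex.I * j i := fun i => by
    fin_cases i <;> simp [hA, Fin.sum_univ_two]
  have h1 : (fun h : Plane => UnitAddTorus.mFourier j (x + proj h)) =
      fun h : Plane => C * Complex.exp (A h) := by
    funext h
    have : UnitAddTorus.mFourier j (x + proj h) = C * UnitAddTorus.mFourier j (proj h) := by
      simp only [hC, mFourier_eq, character_add, fourier_apply, one_smul, AddCircle.toCircle_add,
        Circle.coe_mul]
    rw [this, mFourier_eq, character_proj, fourier_coe_apply]
    congr 2
    simp [hA, Fin.sum_univ_two, mul_add]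
  have h2 : ∀ h : Plane, HasFDerivAt (fun h : Plane => C * Complex.exp (A h))
      ((C * Complex.exp (A h)) • A) h := fun h => by
    have := (A.hasFDerivAt (x := h)).cexp.const_mul C
    rwa [smul_smul] at this
  have h3 : fderiv ℝ (fun h : Plane => C * Complex.exp (A h)) =
      fun h => (C * Complex.exp (A h)) • A := funext fun h => (h2 h).fderiv
  have h4 : ∀ u v : Plane, fderiv ℝ (fun h : Plane => (C * Complex.exp (A h)) • A) 0 u v =
      C * A u * A v := fun u v => by
    rw [((h2 0).smul_const A).fderiv]
    simp
  rw [torusLaplacian, h1, InnerProductSpace.laplacian_eq_iteratedFDeriv_orthonormalBasis _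
    (EuclideanSpace.basisFun (Fin 2) ℝ)]
  simp only [iteratedFDeriv_two_apply, h3, h4, EuclideanSpace.basisFun_apply, Fin.sum_univ_two,
    Matrix.cons_val_zero, Matrix.cons_val_one, hAi]
  push_cast
  linear_combination (4 * Real.pi ^ 2 * C * ((j 0 : ℂ) ^ 2 + (j 1 : ℂ) ^ 2)) * Complex.I_sq

end Smooth

/-! ### Solutions of the Schrödinger equation in Fourier variables -/

section Solutions

variable {V : Torus → ℝ}

theorem SmoothOnTorus.ofReal (hV : SmoothOnTorus V) : SmoothOnTorus fun x => (V x : ℂ) :=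
  Complex.ofRealCLM.contDiff.comp hV

theorem integrable_mul_L2 {φ : Torus → ℂ} (hφ : Continuous φ) (u : L2Torus) :
    Integrable (fun x => φ x * u x) := by
  obtain ⟨B, hB⟩ := isCompact_univ.exists_bound_of_continuousOn hφ.continuousOn
  exact ((Lp.memLp u).integrable (by norm_num)).bdd_mul hφ.aestronglyMeasurable
    (Eventually.of_forall fun x => hB x (Set.mem_univ x))

/-- Multiplication by the potential in Fourier variables. -/
theorem fourierCoef_mul (hV : SmoothOnTorus V) (u : L2Torus) (j : Freq) :
    ∫ x, (V x : ℂ) * UnitAddTorus.mFourier (-j) x * u x =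
      convOp (fourierCoef fun x => (V x : ℂ)) (coeffs u) j := by
  set w := fourierCoef fun x => (V x : ℂ) with hw
  have hws := (isPotential_fourierCoef hV.ofReal).summable
  have h1 := hasSum_convOp_apply hws (coeffs u) j
  have hu : Integrable (fun x => (u x : ℂ)) := (Lp.memLp u).integrable (by norm_num)
  have h2 : HasSum (fun l => ∫ x, w l * (UnitAddTorus.mFourier (l - j) x * u x))
      (∫ x, (V x : ℂ) * UnitAddTorus.mFourier (-j) x * u x) := by
    refine hasSum_integral_of_dominated_convergence (bound := fun l x => ‖w l‖ * ‖u x‖)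
      (fun l => ?_) (fun l => Eventually.of_forall fun x => ?_)
      (Eventually.of_forall fun x => hws.mul_right _) ?_ (Eventually.of_forall fun x => ?_)
    · exact ((integrable_mul_L2 (UnitAddTorus.mFourier (l - j)).continuous u).const_mul _).1
    · rw [norm_mul, norm_mul, norm_mFourier_apply, one_mul]
    · simp only [tsum_mul_right]
      exact hu.norm.const_mul _
    · have h3 := (hasFourierSeries_fourierCoef hV.ofReal x).mul_right
        (UnitAddTorus.mFourier (-j) x * u x)
      rw [← mul_assoc] at h3
      refine h3.congr_fun (fun l => ?_) |> id
      rw [sub_eq_add_neg, UnitAddTorus.mFourier_add]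
      ring
  have h4 : ∀ l, ∫ x, w l * (UnitAddTorus.mFourier (l - j) x * u x) = w l * coeffs u (j - l) :=
    fun l => by
      rw [integral_const_mul, coeffs_apply, fourierCoefficient, neg_sub]
  simp only [h4] at h2
  exact h2.unique h1

/-- The character of index -j is an eigenfunction of the Laplacian, so testing the weak equation
against it isolates the coefficient of index j. -/
theorem IsSchrodingerSolution.isFourierSolution (hV : SmoothOnTorus V) {ħ ε : ℝ} (hħ : 0 < ħ)
    {u : L2Torus} {v : ℝ → L2Torus} (h : IsSchrodingerSolution ħ ε V u v) :
    IsFourierSolution ħ ε (fourierCoef fun x => (V x : ℂ)) (fun t => coeffs (v t)) := by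
  refine ⟨continuous_coeffs.comp h.continuous, fun j t => ?_⟩
  have h1 := h.equation _ (smoothOnTorus_mFourier (-j)) t
  have hħ' : (ħ : ℂ) ≠ 0 := by exact_mod_cast hħ.ne'
  have h2 : ∫ x, schrodingerOp ħ ε V (UnitAddTorus.mFourier (-j)) x * v t x =
      (energy ħ j : ℂ) * coeffs (v t) j +
        (ε : ℂ) ^ 2 * convOp (fourierCoef fun x => (V x : ℂ)) (coeffs (v t)) j := by
    rw [← fourierCoef_mul hV, coeffs_apply, fourierCoefficient, ← integral_const_mul,
      ← integral_const_mul, ← integral_add]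
    · refine integral_congr_ae (Eventually.of_forall fun x => ?_)
      simp only [schrodingerOp, torusLaplacian_mFourier, energy, Fin.sum_univ_two, Pi.neg_apply]
      push_cast
      ring
    · exact (integrable_mul_L2 (UnitAddTorus.mFourier (-j)).continuous _).const_mul _
    · exact (integrable_mul_L2 (hV.ofReal.continuous.mul
        (UnitAddTorus.mFourier (-j)).continuous) _).const_mul _
  rw [h2] at h1
  have h3 : ∀ s, Complex.I * (ħ : ℂ) * ∫ x, UnitAddTorus.mFourier (-j) x * v s x =
      Complex.I * (ħ : ℂ) * coeffs (v s) j := fun s => by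
    rw [coeffs_apply, fourierCoefficient]
  simp only [h3] at h1
  have h4 := h1.const_mul (-(Complex.I / ħ))
  refine (h4.congr_of_eventuallyEq (Eventually.of_forall fun s => ?_))
  simp only
  field_simp
  rw [Complex.I_sq]
  ring

/-- The eigenvalue of -ħ²Δ is twice `energy`, which refers to -(ħ²/2)Δ: hence the threshold δ/2. -/
theorem spectralNorm_sq (δ ħ : ℝ) (u : L2Torus) : spectralNorm (Set.Icc 0 δ) ħ u ^ 2 =
    ∑' j, {j | energy ħ j ≤ δ / 2}.indicator (fun j => ‖coeffs u j‖ ^ 2) j := by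
  rw [spectralNorm, Real.sq_sqrt (tsum_nonneg fun k => Set.indicator_nonneg
    (fun _ _ => by positivity) _)]
  refine tsum_congr fun j => ?_
  have h1 : 4 * Real.pi ^ 2 * ħ ^ 2 * ∑ i, (j i : ℝ) ^ 2 = 2 * energy ħ j := by
    rw [energy]; ring
  have h0 := energy_nonneg ħ j
  rw [h1, ← coeffs_apply]
  by_cases hj : energy ħ j ≤ δ / 2
  · rw [Set.indicator_of_mem (by constructor <;> linarith),
      Set.indicator_of_mem (by exact hj)]
  · rw [Set.indicator_of_notMem (fun h => hj (by linarith [h.2])),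
      Set.indicator_of_notMem (by exact hj)]

theorem spectralNorm_le (S : Set ℝ) (ħ : ℝ) (u : L2Torus) : spectralNorm S ħ u ≤ ‖u‖ := by
  refine Real.sqrt_le_iff.mpr ⟨norm_nonneg _, ?_⟩
  rw [← tsum_norm_coeffs_sq]
  refine Summable.tsum_le_tsum (fun j => ?_) (Summable.of_nonneg_of_le
    (fun j => Set.indicator_nonneg (fun _ _ => by positivity) _) (fun j => ?_)
    (summable_norm_sq (coeffs u))) (summable_norm_sq (coeffs u))
  all_goals
    rw [coeffs_apply]
    exact Set.indicator_le_self' (fun _ _ => by positivity) _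

/-- Admissible data carry little mass at low energy. -/
theorem IsAdmissibleData.eventually_low {u : ℝ → L2Torus} (hu : IsAdmissibleData u) {κ : ℝ}
    (hκ : 0 < κ) : ∃ δ : ℝ, 0 < δ ∧ ∀ᶠ ħ in 𝓝[>] (0 : ℝ),
      ∑' j, {j | energy ħ j ≤ δ}.indicator (fun j => ‖coeffs (u ħ) j‖ ^ 2) j ≤ κ ^ 2 := by
  have h1 := (hu.low.eventually_lt_const hκ).and self_mem_nhdsWithin
  obtain ⟨δ, hδ, hδ0⟩ := h1.exists
  refine ⟨δ / 2, half_pos hδ0, ?_⟩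
  -- A bound on a real limsup says something about the family only if the family is bounded above;
  -- here the norm 1 of the data bounds it.
  have hbdd : IsBoundedUnder (· ≤ ·) (𝓝[>] (0 : ℝ))
      fun ħ => spectralNorm (Set.Icc 0 δ) ħ (u ħ) := by
    refine isBoundedUnder_of_eventually_le (a := 1) ?_
    filter_upwards [self_mem_nhdsWithin] with ħ hħ
    exact (spectralNorm_le _ _ _).trans (hu.norm_eq_one ħ hħ).le
  filter_upwards [eventually_lt_of_limsup_lt hδ hbdd] with ħ hħ
  rw [← spectralNorm_sq]
  exact pow_le_pow_left₀ (Real.sqrt_nonneg _) hħ.le 2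

end Solutions

/-! ### Convergence of time averages and Lebesgue points -/

section Limits

variable {V : Torus → ℝ} {ε : ℝ → ℝ} {u : ℝ → L2Torus} {v : ℝ → ℝ → L2Torus}

/-- The solutions carry little mass at low energy, uniformly in time. -/
theorem eventually_low_energy_le (hV : SmoothOnTorus V) (hε : Tendsto ε (𝓝[>] 0) (𝓝 0))
    (hu : IsAdmissibleData u)
    (hv : ∀ ħ : ℝ, 0 < ħ → IsSchrodingerSolution ħ (ε ħ) V (u ħ) (v ħ)) {κ : ℝ} (hκ : 0 < κ) :
    ∃ δ : ℝ, 0 < δ ∧ ∀ᶠ ħ in 𝓝[>] (0 : ℝ), ∀ t,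
      ∑' j, {j | energy ħ j ≤ δ}.indicator (fun j => ‖coeffs (v ħ t) j‖ ^ 2) j ≤ κ ^ 2 := by
  have hw := isPotential_fourierCoef hV.ofReal
  set W := ∑' l, ‖fourierCoef (fun x => (V x : ℂ)) l‖ with hW
  have hκ8 : 0 < κ / 8 := by positivity
  obtain ⟨δ', hδ', hlow⟩ := hu.eventually_low hκ8
  -- Then δ/δ' = κ/8. Each of the three terms of the bound is at most κ/8, and 2 (3κ/8)² ≤ κ².
  set δ := δ' * (κ / 8) with hδ
  have hδ0 : 0 < δ := by positivity
  refine ⟨δ, hδ0, ?_⟩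
  have h1 : Tendsto (fun ħ => 2 * (ε ħ ^ 2 * W / δ)) (𝓝[>] 0) (𝓝 0) := by
    have := (((hε.pow 2).mul_const W).div_const δ).const_mul 2
    simpa using this
  filter_upwards [hlow, h1.eventually_lt_const hκ8, self_mem_nhdsWithin] with ħ hl hs hħ t
  have hsol := (hv ħ hħ).isFourierSolution hV hħ
  have hn : ‖coeffs (v ħ 0)‖ = 1 := by
    rw [norm_coeffs, (hv ħ hħ).initial, hu.norm_eq_one ħ hħ]
  have h2 := hsol.low_energy_le hw.toIsRealSummable hħ hn hδ0 hδ' hκ8.le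
    (by rw [(hv ħ hħ).initial]; exact hl) t
  have h3 : δ / δ' = κ / 8 := by rw [hδ]; field_simp
  have hW0 : 0 ≤ W := tsum_nonneg fun _ => norm_nonneg _
  have h4 : 0 ≤ 2 * (ε ħ ^ 2 * W / δ) := by positivity
  rw [h3] at h2
  refine h2.trans ?_
  calc 2 * (κ / 8 + κ / 8 + 2 * (ε ħ ^ 2 * W / δ)) ^ 2 ≤ 2 * (κ / 8 + κ / 8 + κ / 8) ^ 2 := by gcongr
    _ ≤ κ ^ 2 := by nlinarith [sq_nonneg κ]

/-- The Fourier coefficients of a measure on the torus. -/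
def measureCoef (μ : Measure Torus) (m : Freq) : ℂ := ∫ x, UnitAddTorus.mFourier (-m) x ∂μ

/-- The real part of an exponential. -/
def reMode (m : Freq) : C(Torus, ℝ) := ⟨fun x => (UnitAddTorus.mFourier (-m) x).re, by fun_prop⟩

/-- The imaginary part of an exponential. -/
def imMode (m : Freq) : C(Torus, ℝ) := ⟨fun x => (UnitAddTorus.mFourier (-m) x).im, by fun_prop⟩

theorem measureCoef_eq (μ : Measure Torus) [IsFiniteMeasure μ] (m : Freq) :
    measureCoef μ m = ((∫ x, reMode m x ∂μ : ℝ) : ℂ) + ((∫ x, imMode m x ∂μ : ℝ) : ℂ) * Complex.I :=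
  (integral_re_add_im (integrable_torus (UnitAddTorus.mFourier (-m)).continuous)).symm

theorem integrable_norm_sq (u : L2Torus) : Integrable fun x => ‖u x‖ ^ 2 :=
  (memLp_two_iff_integrable_sq_norm (Lp.aestronglyMeasurable u)).mp (Lp.memLp u)

theorem form_eq (m : Freq) (u : L2Torus) : form (fun _ => 1) m (coeffs u) (coeffs u) =
    ((∫ x, reMode m x * ‖u x‖ ^ 2 : ℝ) : ℂ) +
      ((∫ x, imMode m x * ‖u x‖ ^ 2 : ℝ) : ℂ) * Complex.I := by
  rw [← integral_mFourier_mul_norm_sq]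
  have hint : Integrable fun x => UnitAddTorus.mFourier (-m) x * ((‖u x‖ ^ 2 : ℝ) : ℂ) :=
    (integrable_norm_sq u).ofReal.bdd_mul (c := 1)
      (UnitAddTorus.mFourier (-m)).continuous.aestronglyMeasurable
      (Eventually.of_forall fun x => (norm_mFourier_apply _ _).le)
  rw [← integral_re_add_im hint]
  simp only [RCLike.re_to_complex, RCLike.im_to_complex, Complex.re_mul_ofReal,
    Complex.im_mul_ofReal]
  rfl

variable {τ : ℝ → ℝ} {ν : ℝ → FiniteMeasure Torus}

theorem IsAccumulationPoint.locallyIntegrable (hν : IsAccumulationPoint τ v ν) (m : Freq) :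
    LocallyIntegrable fun t => measureCoef (ν t) m := by
  obtain ⟨C, hC⟩ := hν.bounded
  have hmeas : AEStronglyMeasurable (fun t => measureCoef (ν t) m) volume := by
    simp only [measureCoef_eq]
    exact (Complex.continuous_ofReal.comp_aestronglyMeasurable (hν.measurable (reMode m))).add
      ((Complex.continuous_ofReal.comp_aestronglyMeasurable (hν.measurable (imMode m))).mul_const _)
  refine (locallyIntegrable_const (C : ℝ)).mono hmeas ?_
  filter_upwards [hC] with t ht
  rw [NNReal.norm_eq]
  refine (norm_integral_le_of_norm_le_const (C := 1)
    (Eventually.of_forall fun x => (norm_mFourier_apply _ _).le)).trans ?_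
  rw [one_mul]
  exact_mod_cast ht

/-- Lebesgue's differentiation theorem for each Fourier coefficient. The frequencies are countable,
so a single null set of times is excluded. -/
theorem IsAccumulationPoint.ae_tendsto_average (hν : IsAccumulationPoint τ v ν) :
    ∀ᵐ t₀ : ℝ, ∀ m : Freq, Tendsto (fun η : ℝ => (η : ℂ)⁻¹ *
      ∫ t in t₀..(t₀ + η), measureCoef (ν t) m) (𝓝[>] 0) (𝓝 (measureCoef (ν t₀) m)) := by
  rw [ae_all_iff]
  intro m
  filter_upwards [_root_.LocallyIntegrable.ae_hasDerivAt_integral (hν.locallyIntegrable m)] with t₀ ht₀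
  have h1 := hasDerivAt_iff_tendsto_slope_zero.mp (ht₀ t₀)
  refine (h1.mono_left (nhdsWithin_mono _ fun x (hx : 0 < x) => hx.ne')).congr fun η => ?_
  rw [intervalIntegral.integral_same, sub_zero, Complex.real_smul, Complex.ofReal_inv]

/-- The time averages of the forms converge to the averages of the Fourier coefficients of the
accumulation point. -/
theorem tendsto_formAverage (hν : IsAccumulationPoint τ v ν) {h : ℕ → ℝ}
    (hτ : ∀ᶠ n in atTop, 0 < τ (h n)) (hvc : ∀ᶠ n in atTop, Continuous (v (h n)))
    (hlim : ∀ θ : ℝ → ℝ, Integrable θ → ∀ a : C(Torus, ℝ),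
      Tendsto (fun n : ℕ => ∫ t : ℝ, θ t * ∫ x : Torus, a x * ‖v (h n) (t * τ (h n)) x‖ ^ 2) atTop
        (𝓝 (∫ t : ℝ, θ t * ∫ x, a x ∂(ν t : Measure Torus))))
    (m : Freq) (t₀ : ℝ) {η : ℝ} (hη : 0 < η) :
    Tendsto (fun n => formAverage (t₀ * τ (h n)) (η * τ (h n)) (fun t => coeffs (v (h n) t))
      (fun _ => 1) m) atTop (𝓝 ((η : ℂ)⁻¹ * ∫ t in t₀..(t₀ + η), measureCoef (ν t) m)) := by
  -- The indicator of the window is an admissible θ. The substitution t ↦ tτ then turns it into a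
  -- window of length ητ for the unscaled evolution.
  set S := Set.Ioc t₀ (t₀ + η) with hS
  have hθ : ∀ F : ℝ → ℝ, ∫ t, S.indicator (fun _ => (1 : ℝ)) t * F t =
      ∫ t in t₀..(t₀ + η), F t := fun F => by
    rw [intervalIntegral.integral_of_le (by linarith), ← hS, ← integral_indicator measurableSet_Ioc]
    refine integral_congr_ae (Eventually.of_forall fun t => ?_)
    change _ = S.indicator F t
    by_cases ht : t ∈ S <;> simp [ht]
  have hθi : Integrable (S.indicator fun _ => (1 : ℝ)) :=
    (integrable_indicator_iff measurableSet_Ioc).mpr (integrableOn_const (by simp))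
  have hcomplex : ∀ G : ℝ → ℂ, IntervalIntegrable G volume t₀ (t₀ + η) →
      ∫ t in t₀..(t₀ + η), G t = ((∫ t in t₀..(t₀ + η), (G t).re : ℝ) : ℂ) +
        ((∫ t in t₀..(t₀ + η), (G t).im : ℝ) : ℂ) * Complex.I := fun G hG => by
    simp only [intervalIntegral.integral_of_le (by linarith : t₀ ≤ t₀ + η)]
    rw [intervalIntegrable_iff_integrableOn_Ioc_of_le (by linarith)] at hG
    exact (integral_re_add_im hG).symm
  have hre := hlim _ hθi (reMode m)
  have him := hlim _ hθi (imMode m)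
  simp only [hθ] at hre him
  have hν1 : ∫ t in t₀..(t₀ + η), measureCoef (ν t) m =
      ((∫ t in t₀..(t₀ + η), ∫ x, reMode m x ∂(ν t : Measure Torus) : ℝ) : ℂ) +
      ((∫ t in t₀..(t₀ + η), ∫ x, imMode m x ∂(ν t : Measure Torus) : ℝ) : ℂ) * Complex.I := by
    have hi : IntervalIntegrable (fun t => measureCoef (ν t) m) volume t₀ (t₀ + η) :=
      intervalIntegrable_iff.mpr (((hν.locallyIntegrable m).integrableOn_isCompact
        isCompact_uIcc).mono_set Set.uIoc_subset_uIcc)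
    rw [hcomplex _ hi]
    simp [measureCoef_eq]
  rw [hν1]
  refine ((((Complex.continuous_ofReal.tendsto _).comp hre).add
    (((Complex.continuous_ofReal.tendsto _).comp him).mul_const Complex.I)).const_mul
    (η : ℂ)⁻¹).congr' ?_
  filter_upwards [hτ, hvc] with n hn hc
  have hcc : Continuous fun t => coeffs (v (h n) (t * τ (h n))) :=
    continuous_coeffs.comp (hc.comp (by fun_prop))
  have hi : IntervalIntegrable (fun t => form (fun _ => 1) m (coeffs (v (h n) (t * τ (h n))))
      (coeffs (v (h n) (t * τ (h n))))) volume t₀ (t₀ + η) :=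
    (continuous_form (B := 1) (fun _ => by simp) m hcc hcc).intervalIntegrable _ _
  have h1 := intervalIntegral.integral_comp_mul_right (a := t₀) (b := t₀ + η)
    (fun s => form (fun _ => 1) m (coeffs (v (h n) s)) (coeffs (v (h n) s))) hn.ne'
  have hτ' : (τ (h n) : ℂ) ≠ 0 := by exact_mod_cast hn.ne'
  have hη' : (η : ℂ) ≠ 0 := by exact_mod_cast hη.ne'
  rw [formAverage, ← add_mul]
  have h2 : ∫ s in t₀ * τ (h n)..(t₀ + η) * τ (h n),
      form (fun _ => 1) m (coeffs (v (h n) s)) (coeffs (v (h n) s)) =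
      τ (h n) * ∫ t in t₀..(t₀ + η), form (fun _ => 1) m (coeffs (v (h n) (t * τ (h n))))
      (coeffs (v (h n) (t * τ (h n)))) := by
    rw [h1, Complex.real_smul, Complex.ofReal_inv, mul_inv_cancel_left₀ hτ']
  rw [h2, hcomplex _ hi]
  simp only [form_eq, Function.comp_apply, Complex.add_re, Complex.add_im, Complex.mul_re,
    Complex.mul_im, Complex.ofReal_re, Complex.ofReal_im, Complex.I_re, Complex.I_im, mul_zero,
    mul_one, sub_zero, add_zero, zero_add]
  rw [Complex.ofReal_mul, mul_inv, mul_assoc, inv_mul_cancel_left₀ hτ']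

end Limits

/-! ### Diagonal extraction of a sequence of long windows at a fixed time -/

section Extraction

variable {V : Torus → ℝ} {ε τ : ℝ → ℝ} {u : ℝ → L2Torus} {v : ℝ → ℝ → L2Torus}
  {ν : ℝ → FiniteMeasure Torus}

/-- At almost every time, the accumulation point is the limit of averages over long time
intervals along a suitable sequence. -/
theorem exists_regime (hV : SmoothOnTorus V) (hε_pos : ∀ᶠ ħ in 𝓝[>] (0 : ℝ), 0 < ε ħ)
    (hε : Tendsto ε (𝓝[>] 0) (𝓝 0)) (hħε : Tendsto (fun ħ : ℝ => ħ / ε ħ) (𝓝[>] 0) (𝓝 0))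
    (hτε : Tendsto (fun ħ : ℝ => τ ħ * ε ħ) (𝓝[>] 0) atTop) (hu : IsAdmissibleData u)
    (hv : ∀ ħ : ℝ, 0 < ħ → IsSchrodingerSolution ħ (ε ħ) V (u ħ) (v ħ))
    (hν : IsAccumulationPoint τ v ν) :
    ∀ᵐ t₀ : ℝ, ∃ (ħ ε' a ℓ : ℕ → ℝ) (c : ℕ → ℝ → SeqL2),
      Regime (fourierCoef fun x => (V x : ℂ)) ħ ε' a ℓ c ∧
      ∀ m : Freq, Tendsto (fun n => formAverage (a n) (ℓ n) (c n) (fun _ => 1) m) atTop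
        (𝓝 (measureCoef (ν t₀) m)) := by
  have hw := isPotential_fourierCoef hV.ofReal
  obtain ⟨h, hh, hlim⟩ := hν.limit
  have hhpos : ∀ᶠ n in atTop, 0 < h n := hh.eventually self_mem_nhdsWithin
  have hεh : ∀ᶠ n in atTop, 0 < ε (h n) := hh.eventually hε_pos
  have hτεh : Tendsto (fun n => τ (h n) * ε (h n)) atTop atTop := hτε.comp hh
  have hτpos : ∀ᶠ n in atTop, 0 < τ (h n) := by
    filter_upwards [hεh, hτεh.eventually_gt_atTop 0] with n h1 h2
    exact pos_of_mul_pos_left h2 h1.le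
  have hvc : ∀ᶠ n in atTop, Continuous (v (h n)) :=
    hhpos.mono fun n hn => (hv _ hn).continuous
  filter_upwards [hν.ae_tendsto_average] with t₀ ht₀
  -- Diagonal choice. At stage i, η is taken first, so small that the averages of the first i
  -- frequencies over [t₀, t₀ + η] are close to their values at t₀. Then n is taken large enough for
  -- these averages to be approximated and for the window, of length ητ, to satisfy ητε ≥ i + 1. The
  -- two approximations give the tolerance 2/(i + 1).
  have hchoice : ∀ i : ℕ, ∃ (η : ℝ) (n : ℕ), 0 < η ∧ i ≤ n ∧ 0 < h n ∧ 0 < ε (h n) ∧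
      0 < τ (h n) ∧ (i : ℝ) + 1 ≤ η * (τ (h n) * ε (h n)) ∧
      ∀ m : Freq, Encodable.encode m < i →
        dist (formAverage (t₀ * τ (h n)) (η * τ (h n)) (fun t => coeffs (v (h n) t))
          (fun _ => 1) m) (measureCoef (ν t₀) m) ≤ 2 * ((i : ℝ) + 1)⁻¹ := by
    intro i
    have hi : (0 : ℝ) < ((i : ℝ) + 1)⁻¹ := by positivity
    set F : Set Freq := {m | Encodable.encode m < i} with hF
    have hFfin : F.Finite := (Set.finite_lt_nat i).preimage Encodable.encode_injective.injOn
    have h1 : ∀ᶠ η : ℝ in 𝓝[>] 0, ∀ m ∈ F, dist ((η : ℂ)⁻¹ *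
        ∫ t in t₀..(t₀ + η), measureCoef (ν t) m) (measureCoef (ν t₀) m) < ((i : ℝ) + 1)⁻¹ :=
      hFfin.eventually_all.mpr fun m _ => (tendsto_iff_dist_tendsto_zero.mp
        (ht₀ m)).eventually_lt_const hi
    obtain ⟨η, hη, hη0⟩ := (h1.and self_mem_nhdsWithin).exists
    have hη0' : 0 < η := hη0
    have h2 : ∀ᶠ n in atTop, ∀ m ∈ F, dist (formAverage (t₀ * τ (h n)) (η * τ (h n))
        (fun t => coeffs (v (h n) t)) (fun _ => 1) m)
        ((η : ℂ)⁻¹ * ∫ t in t₀..(t₀ + η), measureCoef (ν t) m) < ((i : ℝ) + 1)⁻¹ :=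
      hFfin.eventually_all.mpr fun m _ => (tendsto_iff_dist_tendsto_zero.mp
        (tendsto_formAverage hν hτpos hvc hlim m t₀ hη0')).eventually_lt_const hi
    have h3 : ∀ᶠ n in atTop, (i : ℝ) + 1 ≤ η * (τ (h n) * ε (h n)) :=
      (hτεh.const_mul_atTop hη0').eventually_ge_atTop _
    obtain ⟨n, hn1, hn2, hn3, hn4, hn5, hn6⟩ := (h2.and (h3.and (hhpos.and (hεh.and
      (hτpos.and (eventually_ge_atTop i)))))).exists
    refine ⟨η, n, hη0', hn6, hn3, hn4, hn5, hn2, fun m hm => ?_⟩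
    exact (dist_triangle _ _ _).trans
      ((add_le_add (hn1 m hm).le (hη m hm).le).trans_eq (two_mul _).symm)
  choose η n hη hin hhn hεn hτn hlen hdist using hchoice
  have hn : Tendsto n atTop atTop := tendsto_atTop_mono hin tendsto_id
  have hhn' : Tendsto (fun i => h (n i)) atTop (𝓝[>] 0) := hh.comp hn
  have hinv : Tendsto (fun i : ℕ => ((i : ℝ) + 1)⁻¹) atTop (𝓝 0) :=
    tendsto_inv_atTop_zero.comp (tendsto_natCast_atTop_atTop.atTop_add tendsto_const_nhds)
  refine ⟨fun i => h (n i), fun i => ε (h (n i)), fun i => t₀ * τ (h (n i)),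
    fun i => η i * τ (h (n i)), fun i t => coeffs (v (h (n i)) t), ?_, fun m => ?_⟩
  · have hsol : ∀ i, IsFourierSolution (h (n i)) (ε (h (n i))) (fourierCoef fun x => (V x : ℂ))
        fun t => coeffs (v (h (n i)) t) := fun i => (hv _ (hhn i)).isFourierSolution hV (hhn i)
    exact
      { potential := hw
        ħ_pos := hhn
        ε_pos := hεn
        ℓ_pos := fun i => mul_pos (hη i) (hτn i)
        sol := hsol
        norm_eq := fun i t => by
          rw [(hsol i).norm_eq hw.toIsRealSummable 0 t, norm_coeffs, (hv _ (hhn i)).initial,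
            hu.norm_eq_one _ (hhn i)]
        tendsto_ratio := hħε.comp hhn'
        tendsto_ε := hε.comp hhn'
        tendsto_length := by
          refine squeeze_zero (fun i => ?_) (fun i => ?_) hinv
          · have := hη i; have := hτn i; have := hεn i
            positivity
          · refine inv_anti₀ (by positivity) ?_
            rw [mul_assoc]
            exact hlen i
        low := fun κ hκ => by
          obtain ⟨δ, hδ, hlow⟩ := eventually_low_energy_le hV hε hu hv hκ
          exact ⟨δ, hδ, hhn'.eventually hlow⟩ }
  · rw [tendsto_iff_dist_tendsto_zero]
    refine squeeze_zero' (Eventually.of_forall fun i => dist_nonneg) ?_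
      (by simpa using hinv.const_mul 2)
    filter_upwards [eventually_gt_atTop (Encodable.encode m)] with i hi
    exact hdist i m hi

/-- The structure of the accumulation points at almost every time. -/
theorem ae_structure (hV : SmoothOnTorus V) (hε_pos : ∀ᶠ ħ in 𝓝[>] (0 : ℝ), 0 < ε ħ)
    (hε : Tendsto ε (𝓝[>] 0) (𝓝 0)) (hħε : Tendsto (fun ħ : ℝ => ħ / ε ħ) (𝓝[>] 0) (𝓝 0))
    (hτε : Tendsto (fun ħ : ℝ => τ ħ * ε ħ) (𝓝[>] 0) atTop)
    (hν : ν ∈ accumulationPoints V τ ε) :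
    ∀ᵐ t : ℝ, (∀ γ : Set Torus, IsClosedGeodesic γ → ¬ γ ⊆ criticalSet V →
      (ν t : Measure Torus) γ = 0) ∧
    ∃ (f : Torus → ℝ) (α : ℝ≥0) (νsing : FiniteMeasure Torus),
      Integrable f volume ∧ (∀ x, 0 ≤ f x) ∧ α ≤ 1 ∧ νsing ∈ criticalMeasures V ∧
      (ν t : Measure Torus) = volume.withDensity (fun x => ENNReal.ofReal (f x)) +
          α • (νsing : Measure Torus) := by
  obtain ⟨u, v, hu, hv, hν⟩ := hν
  filter_upwards [exists_regime hV hε_pos hε hħε hτε hu hv hν] with t ht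
  obtain ⟨ħ, ε', a, ℓ, c, hreg, hlim⟩ := ht
  -- No mass is lost: the zero Fourier coefficient is the limit of the averages of the conserved
  -- norms.
  have h1 : measureCoef (ν t) 0 = 1 := by
    refine tendsto_nhds_unique (hlim 0) (tendsto_const_nhds.congr fun n => ?_)
    exact (formAverage_one_zero (hreg.ℓ_pos n) (hreg.norm_eq n)).symm
  have hprob : IsProbabilityMeasure (ν t : Measure Torus) := by
    refine ⟨?_⟩
    simp only [measureCoef, neg_zero, UnitAddTorus.mFourier_zero, ContinuousMap.one_apply,
      integral_const, Complex.real_smul, mul_one] at h1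
    have h2 : (ν t : Measure Torus).real Set.univ = 1 := by exact_mod_cast h1
    rw [← ofReal_measureReal (measure_ne_top _ _), h2, ENNReal.ofReal_one]
  exact hreg.structure hV.continuous (hasFourierSeries_fourierCoef hV.ofReal) (ν t) hlim

end Extraction

end TorusSchrodinger

end

theorem theorem3p1 (V : TorusSchrodinger.Torus → ℝ) (hV : TorusSchrodinger.SmoothOnTorus V)
    (ε τ : ℝ → ℝ)
    (hε_pos : ∀ᶠ ħ in 𝓝[>] (0 : ℝ), 0 < ε ħ)
    (hε : Tendsto ε (𝓝[>] 0) (𝓝 0))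
    (hħε : Tendsto (fun ħ : ℝ => ħ / ε ħ) (𝓝[>] 0) (𝓝 0))
    (hτε : Tendsto (fun ħ : ℝ => τ ħ * ε ħ) (𝓝[>] 0) atTop)
    (ν : ℝ → FiniteMeasure TorusSchrodinger.Torus)
    (hν : ν ∈ TorusSchrodinger.accumulationPoints V τ ε) :
    (∀ᵐ t : ℝ, ∀ γ : Set TorusSchrodinger.Torus, TorusSchrodinger.IsClosedGeodesic γ →
      ¬ γ ⊆ TorusSchrodinger.criticalSet V → (ν t : Measure TorusSchrodinger.Torus) γ = 0) ∧
    (∀ᵐ t : ℝ, ∃ (f : TorusSchrodinger.Torus → ℝ) (α : ℝ≥0)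
      (νsing : FiniteMeasure TorusSchrodinger.Torus),
      Integrable f volume ∧ (∀ x, 0 ≤ f x) ∧ α ≤ 1 ∧
      νsing ∈ TorusSchrodinger.criticalMeasures V ∧
      (ν t : Measure TorusSchrodinger.Torus) =
        volume.withDensity (fun x => ENNReal.ofReal (f x)) +
          α • (νsing : Measure TorusSchrodinger.Torus)) := by
  have h := TorusSchrodinger.ae_structure hV hε_pos hε hħε hτε hν
  exact ⟨h.mono fun _ ht => ht.1, h.mono fun _ ht => ht.2⟩
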